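/- Let $G=(V,E,w)$ be a connected simple graph on $n\ge 1$ vertices with real edge weights. A minimum weight spanning tree (MWST) is a spanning tree of $G$ of least total weight, and $\Delta^*$ denotes the smallest maximum degree of an MWST of $G$. For a parameter $b>1$, Fischer's sequential local search algorithm is the following. (0) Start with any MWST $T$ of $G$; let $w_1,\dots,w_l$ be the distinct weights of the edges of $T$. (1) Let $\Delta_T$ be the maximum degree of $T$. (2) For each vertex $v$ in turn, conduct a depth-first traversal of $T$ from $v$, maintaining, for the current vertex $u$ of the traversal, the numbers $M_1,\dots,M_l$, where $M_i$ is the maximum degree in $T$ of the ends of the edges of weight $w_i$ on the path $P$ from $v$ to $u$ in $T$ (and $0$ if there are none). If $vu\in E$ has weight $w_i$, and $M_i$ is at least $\deg_T(v)+2$, at least $\deg_T(u)+2$ and at least $\Delta_T-\lceil\log_b n\rceil$, then replace in $T$ an edge of weight $w_i$ of $P$ that has an end of degree $M_i$ by the edge $vu$, and go to (1) for the next round. (3) If no such swap was found in any of the traversals, stop; $T$ is the output. Time is the number of steps on a unit-cost random access machine with integer and real registers and arrays, where the input is $b$, $n$, the adjacency matrix and the matrix of edge weights of $G$. Theorem.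 For every constant $b>1$ there is a constant $C$, depending only on $b$, such that for every connected weighted graph $G$ on $n$ vertices, Fischer's algorithm halts with an MWST of maximum degree at most $b\Delta^*+\lceil\log_b n\rceil$ after at most $C\,n^{3+1/\ln b}$ steps, that is, in time $O(n^{3+1/\ln b})$. This holds whatever MWST of $G$ is given to the algorithm to start with, and it also holds if nothing but the weighted graph and $b$ are given and the time to construct a starting MWST is counted. -/

import Mathlib

namespace Fischer

/-! ### Minimum weight spanning trees and their degrees -/

section Trees

open scoped Classical in
/-- Total weight of the edges of a graph. -/
noncomputable def weight {V : Type} [Fintype V] (w : Sym2 V → ℝ) (T : SimpleGraph V) : ℝ :=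
  ∑ e ∈ T.edgeFinset, w e

/-- `T` is a spanning tree of `G`: a tree on all the vertices, made of edges of `G`. -/
def IsSpanningTree {V : Type} (G T : SimpleGraph V) : Prop :=
  T ≤ G ∧ T.IsTree

/-- `T` is a minimum weight spanning tree of the weighted graph `(G, w)`. -/
def IsMWST {V : Type} [Fintype V] (G : SimpleGraph V) (w : Sym2 V → ℝ) (T : SimpleGraph V) :
    Prop :=
  IsSpanningTree G T ∧ ∀ T' : SimpleGraph V, IsSpanningTree G T' → weight w T ≤ weight w T'

open scoped Classical in
/-- Maximum degree of a finite graph. -/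
noncomputable def maxDeg {V : Type} [Fintype V] (T : SimpleGraph V) : ℕ :=
  T.maxDegree

/-- The optimal value: the smallest maximum degree of a minimum weight spanning tree. -/
noncomputable def optDeg {V : Type} [Fintype V] (G : SimpleGraph V) (w : Sym2 V → ℝ) : ℕ :=
  sInf {d : ℕ | ∃ T : SimpleGraph V, IsMWST G w T ∧ maxDeg T = d}

end Trees

/-! ### The sequential machine

A unit-cost random access machine with integer and real registers and arrays, programmed in a
while language. Every constant, register access, array access, arithmetic operation, comparison,
connective, assignment and branching test counts as one step. -/

/-- Integer registers. -/
inductive NVar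
  | size | logn | numW | top | root | cur | nxt | up | pos | lab | i | j | k | x | y
  | found | walking | scanning | going | seen
  deriving DecidableEq

/-- Integer arrays; a matrix with `size` columns has its entry `(u, v)` in cell `u * size + v`. -/
inductive NArr
  | graph | tree | inTree | deg | nbr | par | ptr | sav | label | M
  deriving DecidableEq

/-- Real registers. -/
inductive RVar
  | base | power | best
  deriving DecidableEq

/-- Real arrays. -/
inductive RArr
  | wt | dist
  deriving DecidableEq

/-- Memory contents. -/
structure State where
  nv : NVar → ℕ
  na : NArr → ℕ → ℕ
  rv : RVar → ℝ
  ra : RArr → ℕ → ℝ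

/-- Integer expressions. -/
inductive NExp
  | lit (c : ℕ)
  | var (v : NVar)
  | get (a : NArr) (e : NExp)
  | add (e f : NExp)
  | mul (e f : NExp)

/-- Real expressions (`cast` converts an integer into a real). -/
inductive RExp
  | cast (e : NExp)
  | var (v : RVar)
  | get (a : RArr) (e : NExp)
  | mul (e f : RExp)

/-- Boolean expressions. -/
inductive BExp
  | lt (e f : NExp)
  | eq (e f : NExp)
  | rlt (e f : RExp)
  | req (e f : RExp)
  | not (c : BExp)
  | and (c d : BExp)
  | or (c d : BExp)

/-- Programs. -/
inductive Stmt
  | skip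
  | setN (v : NVar) (e : NExp)
  | setA (a : NArr) (e f : NExp)
  | setR (v : RVar) (e : RExp)
  | setB (a : RArr) (e : NExp) (f : RExp)
  | seq (s t : Stmt)
  | ite (c : BExp) (s t : Stmt)
  | loop (c : BExp) (s : Stmt)

def NExp.eval (σ : State) : NExp → ℕ
  | .lit c => c
  | .var v => σ.nv v
  | .get a e => σ.na a (e.eval σ)
  | .add e f => e.eval σ + f.eval σ
  | .mul e f => e.eval σ * f.eval σ

def NExp.cost : NExp → ℕ
  | .lit _ => 1
  | .var _ => 1
  | .get _ e => e.cost + 1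
  | .add e f => e.cost + f.cost + 1
  | .mul e f => e.cost + f.cost + 1

noncomputable def RExp.eval (σ : State) : RExp → ℝ
  | .cast e => (e.eval σ : ℝ)
  | .var v => σ.rv v
  | .get a e => σ.ra a (e.eval σ)
  | .mul e f => e.eval σ * f.eval σ

def RExp.cost : RExp → ℕ
  | .cast e => e.cost + 1
  | .var _ => 1
  | .get _ e => e.cost + 1
  | .mul e f => e.cost + f.cost + 1

def BExp.holds (σ : State) : BExp → Prop
  | .lt e f => e.eval σ < f.eval σ
  | .eq e f => e.eval σ = f.eval σ
  | .rlt e f => e.eval σ < f.eval σ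
  | .req e f => e.eval σ = f.eval σ
  | .not c => ¬ c.holds σ
  | .and c d => c.holds σ ∧ d.holds σ
  | .or c d => c.holds σ ∨ d.holds σ

def BExp.cost : BExp → ℕ
  | .lt e f => e.cost + f.cost + 1
  | .eq e f => e.cost + f.cost + 1
  | .rlt e f => e.cost + f.cost + 1
  | .req e f => e.cost + f.cost + 1
  | .not c => c.cost + 1
  | .and c d => c.cost + d.cost + 1
  | .or c d => c.cost + d.cost + 1

def State.setN (σ : State) (v : NVar) (m : ℕ) : State :=
  { σ with nv := Function.update σ.nv v m }

def State.setA (σ : State) (a : NArr) (p m : ℕ) : State :=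
  { σ with na := Function.update σ.na a (Function.update (σ.na a) p m) }

def State.setR (σ : State) (v : RVar) (m : ℝ) : State :=
  { σ with rv := Function.update σ.rv v m }

def State.setB (σ : State) (a : RArr) (p : ℕ) (m : ℝ) : State :=
  { σ with ra := Function.update σ.ra a (Function.update (σ.ra a) p m) }

/-- `Exec s σ t τ`: the program `s`, started in the memory state `σ`, halts after exactly `t`
steps, in the memory state `τ`. -/
inductive Exec : Stmt → State → ℕ → State → Prop
  | skip (σ : State) : Exec .skip σ 1 σ
  | setN (σ : State) (v : NVar) (e : NExp) :
      Exec (.setN v e) σ (e.cost + 1) (σ.setN v (e.eval σ))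
  | setA (σ : State) (a : NArr) (e f : NExp) :
      Exec (.setA a e f) σ (e.cost + f.cost + 1) (σ.setA a (e.eval σ) (f.eval σ))
  | setR (σ : State) (v : RVar) (e : RExp) :
      Exec (.setR v e) σ (e.cost + 1) (σ.setR v (e.eval σ))
  | setB (σ : State) (a : RArr) (e : NExp) (f : RExp) :
      Exec (.setB a e f) σ (e.cost + f.cost + 1) (σ.setB a (e.eval σ) (f.eval σ))
  | seq {s₁ s₂ : Stmt} {σ ρ τ : State} {t₁ t₂ : ℕ} :
      Exec s₁ σ t₁ ρ → Exec s₂ ρ t₂ τ → Exec (.seq s₁ s₂) σ (t₁ + t₂) τ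
  | iteTrue {c : BExp} {s₁ s₂ : Stmt} {σ τ : State} {t : ℕ} :
      c.holds σ → Exec s₁ σ t τ → Exec (.ite c s₁ s₂) σ (c.cost + 1 + t) τ
  | iteFalse {c : BExp} {s₁ s₂ : Stmt} {σ τ : State} {t : ℕ} :
      ¬ c.holds σ → Exec s₂ σ t τ → Exec (.ite c s₁ s₂) σ (c.cost + 1 + t) τ
  | loopTrue {c : BExp} {s : Stmt} {σ ρ τ : State} {t₁ t₂ : ℕ} :
      c.holds σ → Exec s σ t₁ ρ → Exec (.loop c s) ρ t₂ τ →
      Exec (.loop c s) σ (c.cost + 1 + t₁ + t₂) τ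
  | loopFalse {c : BExp} {s : Stmt} {σ : State} :
      ¬ c.holds σ → Exec (.loop c s) σ (c.cost + 1) σ

/-- The machine is deterministic: a halting run is the only one. -/
theorem Exec.unique {s : Stmt} {σ τ : State} {t : ℕ} (h : Exec s σ t τ) :
    ∀ {t' : ℕ} {τ' : State}, Exec s σ t' τ' → t = t' ∧ τ = τ' := by
  induction h with
  | skip => intro _ _ h'; cases h'; exact ⟨rfl, rfl⟩
  | setN => intro _ _ h'; cases h'; exact ⟨rfl, rfl⟩
  | setA => intro _ _ h'; cases h'; exact ⟨rfl, rfl⟩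
  | setR => intro _ _ h'; cases h'; exact ⟨rfl, rfl⟩
  | setB => intro _ _ h'; cases h'; exact ⟨rfl, rfl⟩
  | seq _ _ ih₁ ih₂ =>
    intro _ _ h'
    cases h' with
    | seq h₁ h₂ =>
      obtain ⟨rfl, rfl⟩ := ih₁ h₁
      obtain ⟨rfl, rfl⟩ := ih₂ h₂
      exact ⟨rfl, rfl⟩
  | iteTrue hc _ ih =>
    intro _ _ h'
    cases h' with
    | iteTrue _ h₁ => obtain ⟨rfl, rfl⟩ := ih h₁; exact ⟨rfl, rfl⟩
    | iteFalse hn _ => exact absurd hc hn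
  | iteFalse hc _ ih =>
    intro _ _ h'
    cases h' with
    | iteTrue hn _ => exact absurd hn hc
    | iteFalse _ h₁ => obtain ⟨rfl, rfl⟩ := ih h₁; exact ⟨rfl, rfl⟩
  | loopTrue hc _ _ ih₁ ih₂ =>
    intro _ _ h'
    cases h' with
    | loopTrue _ h₁ h₂ =>
      obtain ⟨rfl, rfl⟩ := ih₁ h₁
      obtain ⟨rfl, rfl⟩ := ih₂ h₂
      exact ⟨rfl, rfl⟩
    | loopFalse hn => exact absurd hc hn
  | loopFalse hc =>
    intro _ _ h'
    cases h' with
    | loopTrue hn _ _ => exact absurd hn hc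
    | loopFalse _ => exact ⟨rfl, rfl⟩

/-! ### The algorithm -/

section Algorithm

open NVar NArr RVar RArr

instance : Coe NVar NExp := ⟨NExp.var⟩
instance : Coe RVar RExp := ⟨RExp.var⟩
instance (c : ℕ) : OfNat NExp c := ⟨NExp.lit c⟩

/-- Execution of a list of programs, one after the other. -/
def block : List Stmt → Stmt
  | [] => .skip
  | [s] => s
  | s :: t :: l => .seq s (block (t :: l))

/-- One-armed conditional. -/
def Stmt.when (c : BExp) (s : Stmt) : Stmt := .ite c s .skip

/-- `for v = 0, …, e - 1 do s`. -/
def Stmt.for (v : NVar) (e : NExp) (s : Stmt) : Stmt :=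
  .seq (.setN v 0) (.loop (.lt v e) (.seq s (.setN v (.add v 1))))

/-- Position of the matrix entry `(e, f)`. -/
def cell (e f : NExp) : NExp := .add (.mul e size) f

/-- A minimum weight spanning tree is grown from vertex `0`, adding in each
turn a lightest edge `xy` of the graph that leaves the set of vertices reached so far. -/
def growTree : Stmt := block [
  .setA inTree 0 1,
  .setN k 1,
  .loop (.lt k size) (block [
    .setN found 0,
    .for i size (.for j size
      (.when (.and (.and (.eq (.get inTree i) 1) (.eq (.get inTree j) 0))
          (.and (.eq (.get graph (cell i j)) 1)
            (.or (.eq found 0) (.rlt (.get wt (cell i j)) best))))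
        (block [
          .setN found 1,
          .setR best (.get wt (cell i j)),
          .setN x i,
          .setN y j]))),
    .setA tree (cell x y) 1,
    .setA tree (cell y x) 1,
    .setA inTree y 1,
    .setN k (.add k 1)])]

/-- `logn` becomes the least `m` such that `base ^ m` is at least `size`. -/
def computeLog : Stmt := block [
  .setN logn 0,
  .setR power (.cast 1),
  .loop (.rlt power (.cast size)) (block [
    .setR power (.mul power base),
    .setN logn (.add logn 1)])]

/-- The distinct weights of the edges of the tree are listed as
`dist 0, …, dist (numW - 1)`; `label (u, v)` becomes the index of the weight of `uv` in this list,
or `numW` if it does not occur there. -/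
def labelWeights : Stmt := block [
  .setN numW 0,
  .for i size (.for j size
    (.when (.eq (.get tree (cell i j)) 1) (block [
      .setN seen 0,
      .for k numW (.when (.req (.get dist k) (.get wt (cell i j))) (.setN seen 1)),
      .when (.eq seen 0) (block [
        .setB dist numW (.get wt (cell i j)),
        .setN numW (.add numW 1)])]))),
  .for i size (.for j size (block [
    .setA label (cell i j) numW,
    .for k numW (.when (.req (.get dist k) (.get wt (cell i j)))
      (.setA label (cell i j) k))]))]

/-- The degrees in the tree, the lists of neighbours in the tree, and the maximum
degree `top`. -/
def computeDegrees : Stmt := block [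
  .setN top 0,
  .for i size (block [
    .setA deg i 0,
    .for j size (.when (.eq (.get tree (cell i j)) 1) (block [
      .setA nbr (cell i (.get deg i)) j,
      .setA deg i (.add (.get deg i) 1)])),
    .when (.lt top (.get deg i)) (.setN top (.get deg i))])]

/-- The edge between `root` and `cur` replaces, in the tree, an edge with weight index `lab` on
the path from `root` to `cur` which has an end of degree `M lab`. -/
def swapEdges : Stmt := block [
  .setN x cur,
  .setN scanning 1,
  .loop (.eq scanning 1) (block [
    .setN up (.get par x),
    .ite (.and (.eq (.get label (cell up x)) lab)
        (.or (.eq (.get deg up) (.get M lab)) (.eq (.get deg x) (.get M lab))))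
      (block [
        .setA tree (cell up x) 0,
        .setA tree (cell x up) 0,
        .setA tree (cell root cur) 1,
        .setA tree (cell cur root) 1,
        .setN scanning 0])
      (.setN x up)])]

/-- If `root` and `cur` are joined by an edge of the graph, with weight index `lab`, and
`M lab` is at least the degree of `root` plus two, at least the degree of `cur` plus two, and at
least `top - logn`, then the appropriate swap is made, and the traversal stops. -/
def checkSwap : Stmt :=
  .when (.eq (.get graph (cell root cur)) 1) (block [
    .setN lab (.get label (cell root cur)),
    .when (.and (.and (.lt (.add (.get deg root) 1) (.get M lab))
            (.lt (.add (.get deg cur) 1) (.get M lab)))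
          (.lt top (.add (.add (.get M lab) logn) 1)))
      (block [
        swapEdges,
        .setN found 1,
        .setN walking 0])])

/-- The traversal from one vertex: a depth first traversal of the tree from `root`. While
the traversal stands at `cur`, `M m` is the maximum degree of the ends of the edges with weight
index `m` on the path from `root` to `cur` (and `0` if there are no such edges). The value of `M`
that the descent into a vertex changes is kept in `sav`, and put back on the way up. -/
def traverse : Stmt := block [
  .for k numW (.setA M k 0),
  .setA par root root,
  .setA ptr root 0,
  .setN cur root,
  .setN walking 1,
  .loop (.eq walking 1)
    (.ite (.lt (.get ptr cur) (.get deg cur))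
      (block [
        .setN nxt (.get nbr (cell cur (.get ptr cur))),
        .setA ptr cur (.add (.get ptr cur) 1),
        .when (.not (.eq nxt (.get par cur))) (block [
          .setN pos (.get label (cell cur nxt)),
          .setA sav nxt (.get M pos),
          .when (.lt (.get M pos) (.get deg cur)) (.setA M pos (.get deg cur)),
          .when (.lt (.get M pos) (.get deg nxt)) (.setA M pos (.get deg nxt)),
          .setA par nxt cur,
          .setA ptr nxt 0,
          .setN cur nxt,
          checkSwap])])
      (.ite (.eq cur root)
        (.setN walking 0)
        (block [
          .setA M (.get label (cell (.get par cur) cur)) (.get sav cur),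
          .setN cur (.get par cur)])))]

/-- One round: traversals from the vertices in turn, until one of them makes a swap. -/
def round : Stmt := block [
  computeDegrees,
  .setN found 0,
  .setN root 0,
  .loop (.and (.lt root size) (.eq found 0)) (block [
    traverse,
    .setN root (.add root 1)])]

/-- The local search, with a minimum weight spanning tree in `tree` to start with: rounds are made
until one of them makes no swap. -/
def localSearch : Stmt := block [
  computeLog,
  labelWeights,
  .setN going 1,
  .loop (.eq going 1) (block [
    round,
    .setN going found])]

/-- The whole algorithm, including the construction of a minimum weight spanning tree to start
with. -/
def algorithm : Stmt := .seq growTree localSearch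

end Algorithm

/-! ### Input and output -/

open scoped Classical in
/-- The adjacency matrix of a graph on `Fin n`, as the contents of an array. -/
noncomputable def adjArray {n : ℕ} (H : SimpleGraph (Fin n)) (p : ℕ) : ℕ :=
  if ∃ u v : Fin n, H.Adj u v ∧ p = u * n + v then 1 else 0

open scoped Classical in
/-- The matrix of the weights of the edges of `G`, as the contents of an array (`0` elsewhere). -/
noncomputable def weightArray {n : ℕ} (G : SimpleGraph (Fin n)) (w : Sym2 (Fin n) → ℝ) (p : ℕ) :
    ℝ :=
  ∑ u : Fin n, ∑ v : Fin n, if G.Adj u v ∧ p = u * n + v then w s(u, v) else 0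

/-- The memory at the start: the parameter `b`, the number `n` of vertices, the matrices of the
weighted graph `(G, w)`, and the graph `H` in the array `tree`; everything else is `0`. -/
noncomputable def input {n : ℕ} (b : ℝ) (G : SimpleGraph (Fin n)) (w : Sym2 (Fin n) → ℝ)
    (H : SimpleGraph (Fin n)) : State where
  nv
    | .size => n
    | _ => 0
  na
    | .graph => adjArray G
    | .tree => adjArray H
    | _ => fun _ => 0
  rv
    | .base => b
    | _ => 0
  ra
    | .wt => weightArray G w
    | _ => fun _ => 0

/-- The array `tree` holds the adjacency matrix of `T`. -/
def Outputs {n : ℕ} (τ : State) (T : SimpleGraph (Fin n)) : Prop :=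
  ∀ u v : Fin n, (T.Adj u v → τ.na .tree (u * n + v) = 1) ∧
    (¬ T.Adj u v → τ.na .tree (u * n + v) = 0)

/-- The program `s`, run from the memory state `σ`, halts after at most `B` steps, and then holds
in `tree` a minimum weight spanning tree of `(G, w)` of maximum degree at most
`b * Δ* + ⌈log_b n⌉`, where `Δ*` is the optimal value. -/
def FindsWithin {n : ℕ} (s : Stmt) (σ : State) (b : ℝ) (G : SimpleGraph (Fin n))
    (w : Sym2 (Fin n) → ℝ) (B : ℝ) : Prop :=
  ∃ (t : ℕ) (τ : State) (T : SimpleGraph (Fin n)),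
    Exec s σ t τ ∧ (t : ℝ) ≤ B ∧ Outputs τ T ∧ IsMWST G w T ∧
      (maxDeg T : ℝ) ≤ b * (optDeg G w : ℝ) + (⌈Real.logb b (n : ℝ)⌉ : ℝ)

end Fischer

/-! ### Halting runs with a step count -/

namespace Fischer

/-! Quality of the output. Let `T` be an MWST that admits no swap, let `T'` be an MWST of maximum
degree Δ*, and let S_d be the set of vertices of degree at least d in `T`. Rooting `T` shows that
S_(d+1) meets at least d·|S_(d+1)| edges of `T` (`card_mul_le_incident`). Hall's theorem matches the
edges of `T` injectively with edges of `T'` so that each may be exchanged for its partner, and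
minimality of both trees forces partners to have equal weights (`IsMWST.exists_injective`). As no
swap is possible, for d + 1 ≥ Δ_T − L the partner of an edge meeting S_(d+1) meets S_d, so
d·|S_(d+1)| ≤ Δ*·|S_d|. Since n ≤ b^L, the sizes |S_d| cannot grow by a factor above b at each of
the L levels below Δ_T; a level with factor at most b gives Δ_T ≤ bΔ* + L
(`maxDeg_le_of_locallyOptimal`).

Number of swaps. The potential Φ is the sum of (5/2)^deg(v). Every swap lowers it by a constant
fraction of (5/2)^(Δ_T − L) (`expSum_exchange_le`). Because the degrees of a tree sum to less than
2n, convexity gives Φ ≤ (3n/Δ_T)(5/2)^Δ_T (`maxDeg_mul_expSum_le`), so the swaps made while the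
maximum degree is Δ number O((5/2)^L n/Δ). Summing over Δ yields O((5/2)^L n log n) swaps, which
`swapBound` records as one decreasing quantity. The base lies strictly between 2 and e: above 2 the
potential drops, and below e the logarithm is absorbed, so that there are O(n^(1+1/ln b)) swaps
(`exists_const_swaps`).

Running time. A traversal is linear, so a round is quadratic (`wp_traverse`, `wp_round`). Swaps
exchange edges of equal weight, hence the labels computed once in cubic time stay valid. The
starting tree is grown in cubic time, correct by the cut property (`Partial.grow`). The programs are
verified in a total-correctness logic whose loop invariants carry a bound for the remaining steps
(`wp_loop`). -/

/-- The program `s`, started in `σ`, halts after some number `t` of steps in a state `τ` with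
`Q t τ`. -/
def wp (s : Stmt) (Q : ℕ → State → Prop) (σ : State) : Prop :=
  ∃ t τ, Exec s σ t τ ∧ Q t τ

theorem wp.mono {s : Stmt} {P Q : ℕ → State → Prop} {σ : State} (h : wp s P σ)
    (hPQ : ∀ t τ, P t τ → Q t τ) : wp s Q σ := by
  obtain ⟨t, τ, h, hp⟩ := h
  exact ⟨t, τ, h, hPQ _ _ hp⟩

theorem wp_skip {Q : ℕ → State → Prop} {σ : State} : wp .skip Q σ ↔ Q 1 σ := by
  constructor
  · rintro ⟨t, τ, h, hq⟩; cases h; exact hq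
  · exact fun h => ⟨_, _, .skip _, h⟩

theorem wp_setN {v e} {Q : ℕ → State → Prop} {σ : State} :
    wp (.setN v e) Q σ ↔ Q (e.cost + 1) (σ.setN v (e.eval σ)) := by
  constructor
  · rintro ⟨t, τ, h, hq⟩; cases h; exact hq
  · exact fun h => ⟨_, _, .setN .., h⟩

theorem wp_setA {a e f} {Q : ℕ → State → Prop} {σ : State} :
    wp (.setA a e f) Q σ ↔ Q (e.cost + f.cost + 1) (σ.setA a (e.eval σ) (f.eval σ)) := by
  constructor
  · rintro ⟨t, τ, h, hq⟩; cases h; exact hq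
  · exact fun h => ⟨_, _, .setA .., h⟩

theorem wp_setR {v e} {Q : ℕ → State → Prop} {σ : State} :
    wp (.setR v e) Q σ ↔ Q (e.cost + 1) (σ.setR v (e.eval σ)) := by
  constructor
  · rintro ⟨t, τ, h, hq⟩; cases h; exact hq
  · exact fun h => ⟨_, _, .setR .., h⟩

theorem wp_setB {a e f} {Q : ℕ → State → Prop} {σ : State} :
    wp (.setB a e f) Q σ ↔ Q (e.cost + f.cost + 1) (σ.setB a (e.eval σ) (f.eval σ)) := by
  constructor
  · rintro ⟨t, τ, h, hq⟩; cases h; exact hq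
  · exact fun h => ⟨_, _, .setB .., h⟩

theorem wp_seq {s₁ s₂} {Q : ℕ → State → Prop} {σ : State} :
    wp (.seq s₁ s₂) Q σ ↔ wp s₁ (fun t₁ ρ => wp s₂ (fun t₂ τ => Q (t₁ + t₂) τ) ρ) σ := by
  constructor
  · rintro ⟨t, τ, h, hq⟩
    cases h with
    | seq h₁ h₂ => exact ⟨_, _, h₁, _, _, h₂, hq⟩
  · rintro ⟨_, _, h₁, _, _, h₂, hq⟩
    exact ⟨_, _, .seq h₁ h₂, hq⟩

theorem wp_ite {c s₁ s₂} {Q : ℕ → State → Prop} {σ : State} :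
    wp (.ite c s₁ s₂) Q σ ↔
      (c.holds σ → wp s₁ (fun t τ => Q (c.cost + 1 + t) τ) σ) ∧
      (¬ c.holds σ → wp s₂ (fun t τ => Q (c.cost + 1 + t) τ) σ) := by
  constructor
  · rintro ⟨t, τ, h, hq⟩
    cases h with
    | iteTrue hc h => exact ⟨fun _ => ⟨_, _, h, hq⟩, fun hn => absurd hc hn⟩
    | iteFalse hc h => exact ⟨fun hn => absurd hn hc, fun _ => ⟨_, _, h, hq⟩⟩
  · rintro ⟨h₁, h₂⟩
    by_cases hc : c.holds σ
    · obtain ⟨t, τ, h, hq⟩ := h₁ hc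
      exact ⟨_, _, .iteTrue hc h, hq⟩
    · obtain ⟨t, τ, h, hq⟩ := h₂ hc
      exact ⟨_, _, .iteFalse hc h, hq⟩

theorem wp_when {c s} {Q : ℕ → State → Prop} {σ : State} :
    wp (.when c s) Q σ ↔
      (c.holds σ → wp s (fun t τ => Q (c.cost + 1 + t) τ) σ) ∧
      (¬ c.holds σ → Q (c.cost + 1 + 1) σ) := by
  rw [Stmt.when, wp_ite, wp_skip]

/-- A loop whose invariant `Inv B` carries a bound `B` for the number of steps to come. -/
theorem wp_loop {c s} (Inv : ℕ → State → Prop)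
    (step : ∀ B σ, Inv B σ → c.holds σ →
      wp s (fun t τ => ∃ B', Inv B' τ ∧ t + c.cost + 1 + B' ≤ B) σ)
    {B : ℕ} {σ : State} (h : Inv B σ) :
    wp (.loop c s) (fun t τ => ∃ B', Inv B' τ ∧ ¬ c.holds τ ∧ t + B' ≤ B + c.cost + 1) σ := by
  -- Each turn uses at least one step of the budget `B`, so strong induction on the budget gives
  -- termination together with the time bound.
  induction B using Nat.strong_induction_on generalizing σ with
  | _ B ih =>
    by_cases hc : c.holds σ
    · obtain ⟨t, ρ, he, B', hi, hB⟩ := step B σ h hc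
      obtain ⟨t', τ, he', B'', hi', hc', hB'⟩ := ih B' (by omega) hi
      exact ⟨_, _, .loopTrue hc he he', B'', hi', hc', by omega⟩
    · exact ⟨_, _, .loopFalse hc, B, h, hc, by omega⟩

/-- A counting loop of at most `N` turns of at most `B` steps each. -/
theorem wp_for {v e s} (N B : ℕ) (Inv : ℕ → State → Prop)
    (hv : ∀ i σ, Inv i σ → σ.nv v = i ∧ e.eval σ = N)
    (step : ∀ i σ, Inv i σ → i < N →
      wp s (fun t τ => t ≤ B ∧ Inv (i + 1) (τ.setN v (τ.nv v + 1))) σ)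
    {σ : State} (h : Inv 0 (σ.setN v 0)) :
    wp (.for v e s) (fun t τ => t ≤ N * (B + e.cost + 8) + e.cost + 8 ∧ Inv N τ) σ := by
  rw [Stmt.for, wp_seq, wp_setN]
  -- Apart from the body and the evaluation of `e`, a turn takes seven steps for the test and the
  -- increment; eight is a convenient upper bound.
  refine (wp_loop (fun b τ => ∃ i ≤ N, b = (N - i) * (B + e.cost + 8) ∧ Inv i τ) ?_
    ⟨0, Nat.zero_le _, rfl, h⟩).mono ?_
  · rintro b ρ ⟨i, -, rfl, hi⟩ hc
    obtain ⟨h1, h2⟩ := hv _ _ hi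
    have hiN : i < N := by simpa [BExp.holds, NExp.eval, h1, h2] using hc
    rw [wp_seq]
    refine (step i ρ hi hiN).mono ?_
    rintro t τ ⟨ht, hτ⟩
    rw [wp_setN]
    refine ⟨(N - (i + 1)) * (B + e.cost + 8), ⟨i + 1, hiN, rfl, hτ⟩, ?_⟩
    obtain ⟨d, rfl⟩ : ∃ d, N = i + 1 + d := ⟨N - (i + 1), by omega⟩
    have e1 : i + 1 + d - (i + 1) = d := by omega
    have e2 : i + 1 + d - i = d + 1 := by omega
    rw [e1, e2, Nat.add_mul]
    simp only [NExp.cost, BExp.cost]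
    omega
  · rintro t τ ⟨b, ⟨i, hi, rfl, hI⟩, hc, ht⟩
    obtain ⟨h1, h2⟩ := hv _ _ hI
    have hiN : i = N := by
      have : ¬ i < N := by simpa [BExp.holds, NExp.eval, h1, h2] using hc
      omega
    subst hiN
    refine ⟨?_, hI⟩
    simp only [NExp.cost, BExp.cost, Nat.sub_zero] at ht ⊢
    omega

/-! ### What a program leaves alone -/

/-- The program assigns to the integer register `v`. -/
def Stmt.writesN (v : NVar) : Stmt → Bool
  | .setN u _ => v = u
  | .seq s t => s.writesN v || t.writesN v
  | .ite _ s t => s.writesN v || t.writesN v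
  | .loop _ s => s.writesN v
  | _ => false

/-- The program assigns to the integer array `a`. -/
def Stmt.writesA (a : NArr) : Stmt → Bool
  | .setA u _ _ => a = u
  | .seq s t => s.writesA a || t.writesA a
  | .ite _ s t => s.writesA a || t.writesA a
  | .loop _ s => s.writesA a
  | _ => false

/-- The program assigns to the real register `v`. -/
def Stmt.writesR (v : RVar) : Stmt → Bool
  | .setR u _ => v = u
  | .seq s t => s.writesR v || t.writesR v
  | .ite _ s t => s.writesR v || t.writesR v
  | .loop _ s => s.writesR v
  | _ => false

/-- The program assigns to the real array `a`. -/
def Stmt.writesB (a : RArr) : Stmt → Bool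
  | .setB u _ _ => a = u
  | .seq s t => s.writesB a || t.writesB a
  | .ite _ s t => s.writesB a || t.writesB a
  | .loop _ s => s.writesB a
  | _ => false

/-- Whether a program writes to a place is computed from its syntax, so for concrete programs such
hypotheses are closed by `rfl`. -/
theorem Exec.nv_eq {s σ t τ} (h : Exec s σ t τ) {v : NVar} (hv : s.writesN v = false) :
    τ.nv v = σ.nv v := by
  induction h <;> simp_all [Stmt.writesN, State.setN, State.setA, State.setR, State.setB]

theorem Exec.na_eq {s σ t τ} (h : Exec s σ t τ) {a : NArr} (hv : s.writesA a = false) :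
    τ.na a = σ.na a := by
  induction h <;> simp_all [Stmt.writesA, State.setN, State.setA, State.setR, State.setB]

theorem Exec.rv_eq {s σ t τ} (h : Exec s σ t τ) {v : RVar} (hv : s.writesR v = false) :
    τ.rv v = σ.rv v := by
  induction h <;> simp_all [Stmt.writesR, State.setN, State.setA, State.setR, State.setB]

theorem Exec.ra_eq {s σ t τ} (h : Exec s σ t τ) {a : RArr} (hv : s.writesB a = false) :
    τ.ra a = σ.ra a := by
  induction h <;> simp_all [Stmt.writesB, State.setN, State.setA, State.setR, State.setB]

/-- `τ` agrees with `σ` wherever the program `s` does not write. -/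
structure Frame (s : Stmt) (σ τ : State) : Prop where
  nv : ∀ v, s.writesN v = false → τ.nv v = σ.nv v
  na : ∀ a, s.writesA a = false → τ.na a = σ.na a
  rv : ∀ v, s.writesR v = false → τ.rv v = σ.rv v
  ra : ∀ a, s.writesB a = false → τ.ra a = σ.ra a

theorem wp.frame {s : Stmt} {Q : ℕ → State → Prop} {σ : State} (h : wp s Q σ) :
    wp s (fun t τ => Q t τ ∧ Frame s σ τ) σ := by
  obtain ⟨t, τ, h, hq⟩ := h
  exact ⟨t, τ, h, hq, fun _ => h.nv_eq, fun _ => h.na_eq, fun _ => h.rv_eq, fun _ => h.ra_eq⟩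

/-! ### Reading the memory after an assignment -/

section Simp

variable (σ : State)

@[simp] theorem State.setN_nv (v m u) : (σ.setN v m).nv u = if u = v then m else σ.nv u := by
  simp [State.setN, Function.update_apply]
@[simp] theorem State.setN_na (v m) : (σ.setN v m).na = σ.na := rfl
@[simp] theorem State.setN_rv (v m) : (σ.setN v m).rv = σ.rv := rfl
@[simp] theorem State.setN_ra (v m) : (σ.setN v m).ra = σ.ra := rfl
@[simp] theorem State.setA_nv (a p m) : (σ.setA a p m).nv = σ.nv := rfl
@[simp] theorem State.setA_na (a p m a') :
    (σ.setA a p m).na a' = if a' = a then Function.update (σ.na a) p m else σ.na a' := by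
  simp [State.setA, Function.update_apply]
@[simp] theorem State.setA_rv (a p m) : (σ.setA a p m).rv = σ.rv := rfl
@[simp] theorem State.setA_ra (a p m) : (σ.setA a p m).ra = σ.ra := rfl
@[simp] theorem State.setR_nv (v m) : (σ.setR v m).nv = σ.nv := rfl
@[simp] theorem State.setR_na (v m) : (σ.setR v m).na = σ.na := rfl
@[simp] theorem State.setR_rv (v m u) : (σ.setR v m).rv u = if u = v then m else σ.rv u := by
  simp [State.setR, Function.update_apply]
@[simp] theorem State.setR_ra (v m) : (σ.setR v m).ra = σ.ra := rfl
@[simp] theorem State.setB_nv (a p m) : (σ.setB a p m).nv = σ.nv := rfl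
@[simp] theorem State.setB_na (a p m) : (σ.setB a p m).na = σ.na := rfl
@[simp] theorem State.setB_rv (a p m) : (σ.setB a p m).rv = σ.rv := rfl
@[simp] theorem State.setB_ra (a p m a') :
    (σ.setB a p m).ra a' = if a' = a then Function.update (σ.ra a) p m else σ.ra a' := by
  simp [State.setB, Function.update_apply]

@[simp] theorem NExp.eval_ofNat (c : ℕ) : NExp.eval σ (OfNat.ofNat c) = c := rfl
@[simp] theorem NExp.cost_ofNat (c : ℕ) : NExp.cost (OfNat.ofNat c) = 1 := rfl

attribute [simp] NExp.eval NExp.cost RExp.eval RExp.cost BExp.holds BExp.cost cell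

end Simp

end Fischer

namespace Fischer

open SimpleGraph

/-! ### Exchanging edges of trees -/

section Exchange

variable {V : Type}

/-- `T` with the edge `xy` replaced by the edge `uv`. -/
def exchange (T : SimpleGraph V) (x y u v : V) : SimpleGraph V :=
  T.deleteEdges {s(x, y)} ⊔ edge u v

theorem exchange_adj {T : SimpleGraph V} {x y u v a b : V} :
    (exchange T x y u v).Adj a b ↔
      (T.Adj a b ∧ s(a, b) ≠ s(x, y)) ∨ (s(a, b) = s(u, v) ∧ a ≠ b) := by
  simp [exchange, edge_adj, deleteEdges_adj]

/-- Follow a walk towards `x` until it is about to use the deleted edge: it then stands at `x` or at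
`y`. -/
theorem reachable_deleteEdges_or {G : SimpleGraph V} {x y : V} {a : V} (h : G.Reachable a x) :
    (G.deleteEdges {s(x, y)}).Reachable a x ∨ (G.deleteEdges {s(x, y)}).Reachable a y := by
  obtain ⟨p⟩ := h
  induction p with
  | nil => exact .inl .rfl
  | @cons a b c hab p ih =>
    by_cases he : s(a, b) = s(c, y)
    · rcases Sym2.eq_iff.1 he with ⟨rfl, rfl⟩ | ⟨rfl, rfl⟩
      · exact .inl .rfl
      · exact .inr .rfl
    · have hr : (G.deleteEdges {s(c, y)}).Reachable a b :=
        Adj.reachable (by simpa [deleteEdges_adj, hab] using he)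
      exact ih.imp hr.trans hr.trans

theorem connected_exchange {T : SimpleGraph V} (hT : T.Connected) {x y u v : V}
    (h : ¬ (T.deleteEdges {s(x, y)}).Reachable u v) : (exchange T x y u v).Connected := by
  have huv : u ≠ v := fun e => h (e ▸ .rfl)
  have hle : T.deleteEdges {s(x, y)} ≤ exchange T x y u v := le_sup_left
  have hadj : (exchange T x y u v).Reachable u v :=
    Adj.reachable (exchange_adj.2 (.inr ⟨rfl, huv⟩))
  have hxy : (exchange T x y u v).Reachable x y := by
    rcases reachable_deleteEdges_or (y := y) (hT.preconnected u x) with hu | hu <;>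
    rcases reachable_deleteEdges_or (y := y) (hT.preconnected v x) with hv | hv
    · exact absurd (hu.trans hv.symm) h
    · exact ((hu.mono hle).symm.trans hadj).trans (hv.mono hle)
    · exact (((hu.mono hle).symm.trans hadj).trans (hv.mono hle)).symm
    · exact absurd (hu.trans hv.symm) h
  have hx : ∀ a, (exchange T x y u v).Reachable a x := fun a => by
    rcases reachable_deleteEdges_or (y := y) (hT.preconnected a x) with ha | ha
    · exact ha.mono hle
    · exact (ha.mono hle).trans hxy.symm
  have := hT.nonempty
  exact ⟨fun a b => (hx a).trans (hx b).symm⟩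

theorem isTree_exchange {T : SimpleGraph V} (hT : T.IsTree) {x y u v : V}
    (h : ¬ (T.deleteEdges {s(x, y)}).Reachable u v) : (exchange T x y u v).IsTree :=
  ⟨connected_exchange hT.connected h,
    (hT.isAcyclic.anti (deleteEdges_le _)).sup_edge_of_not_reachable h⟩

theorem isSpanningTree_exchange {G T : SimpleGraph V} (hT : IsSpanningTree G T) {x y u v : V}
    (hG : G.Adj u v) (h : ¬ (T.deleteEdges {s(x, y)}).Reachable u v) :
    IsSpanningTree G (exchange T x y u v) := by
  refine ⟨fun a b hab => ?_, isTree_exchange hT.2 h⟩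
  rcases exchange_adj.1 hab with ⟨h, -⟩ | ⟨h, -⟩
  · exact hT.1 h
  · rcases Sym2.eq_iff.1 h with ⟨rfl, rfl⟩ | ⟨rfl, rfl⟩
    · exact hG
    · exact hG.symm

/-- Paths in a tree are unique: the path from `u` to `v` is also the one that survives the deletion
of any single edge of `A`, so it avoids all of `A`. -/
theorem IsTree.reachable_deleteEdges {T : SimpleGraph V} (hT : T.IsTree) {A : Set (Sym2 V)}
    {u v : V} (h : ∀ e ∈ A, (T.deleteEdges {e}).Reachable u v) :
    (T.deleteEdges A).Reachable u v := by
  classical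
  obtain ⟨p, hp⟩ := (hT.connected u v).exists_isPath
  refine ⟨p.toDeleteEdges A fun e hep heA => ?_⟩
  obtain ⟨q, hq⟩ := (h e heA).exists_isPath
  have hpq : p = q.mapLe (deleteEdges_le _) :=
    (hT.existsUnique_path u v).unique hp (hq.mapLe _)
  rw [hpq] at hep
  have : e ∈ q.edges := by simpa [Walk.mapLe, Walk.edges_map] using hep
  have := q.edges_subset_edgeSet this
  simp [edgeSet_deleteEdges] at this

variable [Fintype V]

open scoped Classical in
theorem weight_exchange (w : Sym2 V → ℝ) {T : SimpleGraph V} {x y u v : V} (hxy : T.Adj x y)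
    (h : ¬ (T.deleteEdges {s(x, y)}).Reachable u v) :
    weight w (exchange T x y u v) = weight w T - w s(x, y) + w s(u, v) := by
  have huv : u ≠ v := fun e => h (e ▸ .rfl)
  have hE : (exchange T x y u v).edgeFinset =
      insert s(u, v) (T.edgeFinset.erase s(x, y)) := by
    ext e
    induction e with | h a b => ?_
    simp only [mem_edgeFinset, mem_edgeSet, exchange_adj, Finset.mem_insert, Finset.mem_erase]
    constructor
    · tauto
    · rintro (h | h)
      · refine .inr ⟨h, fun e => huv ?_⟩
        subst e
        have h' : u = a ∧ v = a := by simpa [Sym2.eq_iff, eq_comm] using h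
        exact h'.1.trans h'.2.symm
      · tauto
  -- If `uv` were an edge of `T` other than `xy`, it would still join `u` to `v` after the deletion.
  have hn : s(u, v) ∉ T.edgeFinset.erase s(x, y) := fun hm => by
    simp only [Finset.mem_erase, mem_edgeFinset, mem_edgeSet] at hm
    exact h (Adj.reachable (by simpa [deleteEdges_adj, hm.2] using hm.1))
  have hm : s(x, y) ∈ T.edgeFinset := by simpa using hxy
  unfold weight
  rw [hE, Finset.sum_insert hn, ← Finset.add_sum_erase _ _ hm]
  ring

theorem IsMWST.le_of_exchange {G T : SimpleGraph V} {w : Sym2 V → ℝ} (hT : IsMWST G w T)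
    {x y u v : V} (hxy : T.Adj x y) (hG : G.Adj u v)
    (h : ¬ (T.deleteEdges {s(x, y)}).Reachable u v) : w s(x, y) ≤ w s(u, v) := by
  have := hT.2 _ (isSpanningTree_exchange hT.1 hG h)
  rw [weight_exchange w hxy h] at this
  linarith

theorem IsMWST.exchange {G T : SimpleGraph V} {w : Sym2 V → ℝ} (hT : IsMWST G w T)
    {x y u v : V} (hxy : T.Adj x y) (hG : G.Adj u v)
    (h : ¬ (T.deleteEdges {s(x, y)}).Reachable u v) (hw : w s(u, v) ≤ w s(x, y)) :
    IsMWST G w (exchange T x y u v) := by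
  refine ⟨isSpanningTree_exchange hT.1 hG h, fun T' hT' => ?_⟩
  have := hT.2 _ hT'
  rw [weight_exchange w hxy h]
  linarith

theorem exists_isMWST {G : SimpleGraph V} (hG : G.Connected) (w : Sym2 V → ℝ) :
    ∃ T, IsMWST G w T := by
  classical
  obtain ⟨T₀, h₀, h₀'⟩ := hG.exists_isTree_le
  obtain ⟨T, hT, hmin⟩ := Set.exists_min_image {T | IsSpanningTree G T} (weight w)
    (Set.toFinite _) ⟨T₀, h₀, h₀'⟩
  exact ⟨T, hT, hmin⟩

/-- The edge `e` of the tree `T` lies on the path of `T` between the ends of `f`. -/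
def Separates (T : SimpleGraph V) (e f : Sym2 V) : Prop :=
  ∀ u v, f = s(u, v) → ¬ (T.deleteEdges {e}).Reachable u v

open scoped Classical in
/-- The edges of a spanning tree can be matched with those of another one so that each may be
exchanged for its partner. -/
theorem exists_injective_separates {T T' : SimpleGraph V} (hT : T.IsTree) (hT' : T'.IsTree) :
    ∃ φ : T.edgeFinset → Sym2 V, Function.Injective φ ∧
      ∀ e, φ e ∈ T'.edgeFinset ∧ Separates T e (φ e) := by
  -- Hall's theorem, for the relation that an edge of `T` separates the ends of an edge of `T'`.
  have key := (Finset.all_card_le_biUnion_card_iff_exists_injective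
    (fun e : T.edgeFinset => T'.edgeFinset.filter (Separates T e.1))).1 ?_
  · simpa only [Finset.mem_filter] using key
  intro s
  set N := s.biUnion fun e : T.edgeFinset => T'.edgeFinset.filter (Separates T e.1) with hN
  set A : Finset (Sym2 V) := s.map (Function.Embedding.subtype _) with hA
  have hAT : A ⊆ T.edgeFinset := by
    intro e he
    obtain ⟨e', -, rfl⟩ := Finset.mem_map.1 he
    exact e'.2
  -- Remove `A` from `T` and add its neighbours `N`. The result is connected: an edge of `T'`
  -- outside `N` is separated by no edge of `A`, so its ends are still joined in `T` without `A`. A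
  -- connected graph has at least as many edges as a tree, whence `N` is at least as large as `A`.
  let H : SimpleGraph V := T.deleteEdges (A : Set (Sym2 V)) ⊔ fromEdgeSet (N : Set (Sym2 V))
  have hadj : ∀ u v, T'.Adj u v → H.Reachable u v := by
    intro u v huv
    by_cases hm : s(u, v) ∈ N
    · exact Adj.reachable (by simp [H, hm, huv.ne])
    · refine Reachable.mono le_sup_left (IsTree.reachable_deleteEdges hT fun e he => ?_)
      obtain ⟨e', he', rfl⟩ := Finset.mem_map.1 (Finset.mem_coe.1 he)
      by_contra hr
      refine hm (Finset.mem_biUnion.2 ⟨e', he', Finset.mem_filter.2 ⟨by simpa using huv, ?_⟩⟩)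
      intro a b hab
      rcases Sym2.eq_iff.1 hab with ⟨rfl, rfl⟩ | ⟨rfl, rfl⟩
      · exact hr
      · exact fun h => hr h.symm
  have hcon : H.Connected := by
    have := hT'.connected.nonempty
    refine ⟨fun u v => ?_⟩
    obtain ⟨p⟩ := hT'.connected u v
    induction p with
    | nil => exact .rfl
    | cons h _ ih => exact (hadj _ _ h).trans ih
  have h1 := hcon.card_vert_le_card_edgeSet_add_one
  rw [Nat.card_eq_fintype_card, ← hT.card_edgeFinset, Nat.card_eq_fintype_card,
    ← edgeFinset_card] at h1
  have h2 : H.edgeFinset ⊆ (T.edgeFinset \ A) ∪ N := by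
    intro e he
    simp only [mem_edgeFinset, H, edgeSet_sup, edgeSet_deleteEdges, edgeSet_fromEdgeSet,
      Set.mem_union, Set.mem_sdiff, Finset.mem_coe] at he
    simp only [Finset.mem_union, Finset.mem_sdiff, mem_edgeFinset]
    tauto
  have h3 := (Finset.card_le_card h2).trans (Finset.card_union_le _ _)
  rw [Finset.card_sdiff_of_subset hAT] at h3
  have h4 := Finset.card_le_card hAT
  have h5 : A.card = s.card := Finset.card_map _
  omega

open scoped Classical in
/-- The edges of a minimum weight spanning tree can be matched with those of another one so that
each may be exchanged for its partner, which has the same weight. -/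
theorem IsMWST.exists_injective {G T T' : SimpleGraph V} {w : Sym2 V → ℝ} (hT : IsMWST G w T)
    (hT' : IsMWST G w T') :
    ∃ φ : T.edgeFinset → Sym2 V, Function.Injective φ ∧
      ∀ e, φ e ∈ T'.edgeFinset ∧ Separates T e (φ e) ∧ w (φ e) = w e := by
  obtain ⟨φ, hφ, h⟩ := exists_injective_separates hT.1.2 hT'.1.2
  have hle : ∀ e ∈ (Finset.univ : Finset T.edgeFinset), w e.1 ≤ w (φ e) := by
    rintro ⟨e, he⟩ -
    obtain ⟨h1, h2⟩ := h ⟨e, he⟩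
    generalize φ ⟨e, he⟩ = f at h1 h2
    induction e with | h x y => ?_
    induction f with | h u v => ?_
    exact hT.le_of_exchange (by simpa using he) (hT'.1.1 (by simpa using h1)) (h2 u v rfl)
  -- Both trees have equally many edges, so the injection is onto. The termwise inequality `hle`
  -- then sums to an equality of the two minimum weights, and every term must be an equality.
  have himg : Finset.univ.image φ = T'.edgeFinset := by
    refine Finset.eq_of_subset_of_card_le ?_ ?_
    · intro f hf
      obtain ⟨e, -, rfl⟩ := Finset.mem_image.1 hf
      exact (h e).1
    · rw [Finset.card_image_of_injective _ hφ, Finset.card_univ, Fintype.card_coe]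
      have := hT.1.2.card_edgeFinset
      have := hT'.1.2.card_edgeFinset
      omega
  have hsum : ∑ e : T.edgeFinset, w e.1 = ∑ e : T.edgeFinset, w (φ e) := by
    rw [Finset.sum_coe_sort T.edgeFinset w, ← Finset.sum_image (f := w) (g := φ)
      (fun a _ b _ hab => hφ hab), himg]
    exact le_antisymm (hT.2 _ hT'.1) (hT'.2 _ hT.1)
  have heq := (Finset.sum_eq_sum_iff_of_le hle).1 hsum
  exact ⟨φ, hφ, fun e => ⟨(h e).1, (h e).2, (heq e (Finset.mem_univ _)).symm⟩⟩

end Exchange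

/-! ### Rooted trees -/

section Rooted

variable {V : Type}

/-- `p` maps each vertex other than `r` to its parent in the tree `T` with root `r`, and `dp` is
the depth. -/
structure Rooted (T : SimpleGraph V) (r : V) (p : V → V) (dp : V → ℕ) : Prop where
  root : p r = r
  depth_root : dp r = 0
  adj : ∀ v, v ≠ r → T.Adj (p v) v
  depth : ∀ v, v ≠ r → dp v = dp (p v) + 1
  edge : ∀ u v, T.Adj u v → (u ≠ r ∧ p u = v) ∨ (v ≠ r ∧ p v = u)

theorem exists_rooted [Fintype V] {T : SimpleGraph V} (hT : T.IsTree) (r : V) :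
    ∃ p dp, Rooted T r p dp ∧ ∀ v, dp v < Fintype.card V := by
  classical
  have hex : ∀ v, v ≠ r → ∃ u, T.Adj u v ∧ T.dist r v = T.dist r u + 1 := by
    intro v hv
    obtain ⟨q, hq, hl⟩ := hT.connected.exists_path_of_dist v r
    cases q with
    | nil => exact absurd rfl hv
    | @cons _ u _ h q =>
      refine ⟨u, h.symm, ?_⟩
      have h1 := T.dist_le q
      have h2 := hT.dist_eq_dist_add_one_of_adj r h
      simp only [Walk.length_cons] at hl
      rw [@SimpleGraph.dist_comm _ T v r] at hl
      rw [@SimpleGraph.dist_comm _ T u r] at h1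
      omega
  choose! p hp using hex
  refine ⟨Function.update p r r, T.dist r, ⟨by simp, by simp, ?_, ?_, ?_⟩, ?_⟩
  · intro v hv; simpa [hv] using (hp v hv).1
  · intro v hv; simpa [hv] using (hp v hv).2
  · have key : ∀ u v, T.Adj u v → T.dist r u = T.dist r v + 1 → u ≠ r ∧ p u = v := by
      intro u v huv hd
      have hu : u ≠ r := by rintro rfl; simp at hd
      refine ⟨hu, ?_⟩
      obtain ⟨h1, h2⟩ := hp u hu
      -- Two neighbours of `u` that are closer to `r` would be the second vertices of two paths from
      -- `u` to `r`; the path is unique, so the parent is too.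
      have path : ∀ z, T.Adj z u → T.dist r u = T.dist r z + 1 →
          ∃ q : T.Walk u r, q.IsPath ∧ q.snd = z := by
        intro z hz hd
        obtain ⟨q, hq, hl⟩ := hT.connected.exists_path_of_dist z r
        refine ⟨.cons hz.symm q, ?_, by simp⟩
        rw [Walk.cons_isPath_iff]
        refine ⟨hq, fun hm => ?_⟩
        have h3 := T.dist_le (q.dropUntil u hm)
        have h4 := congrArg Walk.length (q.take_spec hm)
        rw [Walk.length_append] at h4
        rw [@SimpleGraph.dist_comm _ T u r] at h3
        rw [@SimpleGraph.dist_comm _ T z r] at hl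
        omega
      obtain ⟨q1, hq1, e1⟩ := path _ h1 h2
      obtain ⟨q2, hq2, e2⟩ := path v huv.symm hd
      rw [← e1, ← e2, (hT.existsUnique_path u r).unique hq1 hq2]
    intro u v huv
    rcases hT.dist_eq_dist_add_one_of_adj r huv with h | h
    · obtain ⟨h1, h2⟩ := key u v huv h
      exact .inl ⟨h1, by simpa [h1] using h2⟩
    · obtain ⟨h1, h2⟩ := key v u huv.symm h
      exact .inr ⟨h1, by simpa [h1] using h2⟩
  · intro v
    obtain ⟨q, hq, hl⟩ := hT.connected.exists_path_of_dist r v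
    exact hl ▸ hq.length_lt

namespace Rooted

variable {T : SimpleGraph V} {r : V} {p : V → V} {dp : V → ℕ} (h : Rooted T r p dp)
include h

theorem iterate_root (k : ℕ) : p^[k] r = r := by
  induction k with
  | zero => rfl
  | succ k ih => rw [Function.iterate_succ_apply, h.root, ih]

theorem iterate_eq_root {k : ℕ} {v : V} (hk : dp v ≤ k) : p^[k] v = r := by
  induction k generalizing v with
  | zero =>
    by_contra hv
    have := h.depth v hv
    omega
  | succ k ih =>
    rw [Function.iterate_succ_apply]
    by_cases hv : v = r
    · rw [hv, h.root, h.iterate_root]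
    · have := h.depth v hv
      exact ih (by omega)

/-- The descendants of `x` are joined to the rest of the tree by the deleted edge only, and the root
is not among them. -/
theorem not_reachable {x c : V} (hx : x ≠ r) {k : ℕ} (hk : p^[k] c = x) :
    ¬ (T.deleteEdges {s(p x, x)}).Reachable r c := by
  suffices H : ∀ a b, (T.deleteEdges {s(p x, x)}).Reachable a b → (∃ k, p^[k] b = x) →
      ∃ k, p^[k] a = x by
    intro hr
    obtain ⟨k, hk⟩ := H _ _ hr ⟨k, hk⟩
    exact hx (by rw [← hk, h.iterate_root])
  rintro a b ⟨q⟩ hb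
  induction q with
  | nil => exact hb
  | @cons a c b hac q ih =>
    obtain ⟨k, hk⟩ := ih hb
    simp only [deleteEdges_adj, Set.mem_singleton_iff] at hac
    obtain ⟨hac, hne⟩ := hac
    rcases h.edge a c hac with ⟨-, e⟩ | ⟨-, e⟩
    · exact ⟨k + 1, by rw [Function.iterate_succ_apply, e, hk]⟩
    · cases k with
      | zero =>
        subst hk e
        exact absurd rfl hne
      | succ k => exact ⟨k, by rw [← hk, Function.iterate_succ_apply, e]⟩

/-- The chain of parents from `c` to the root avoids `x`, so all its edges survive. -/
theorem reachable {x c : V} (hc : ∀ k, p^[k] c ≠ x) :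
    (T.deleteEdges {s(p x, x)}).Reachable r c := by
  obtain ⟨n, hn⟩ : ∃ n, n = dp c := ⟨_, rfl⟩
  induction n generalizing c with
  | zero => rw [← h.iterate_eq_root hn.symm.le]; exact .rfl
  | succ n ih =>
    have hcr : c ≠ r := by rintro rfl; rw [h.depth_root] at hn; omega
    have hd := h.depth c hcr
    refine (ih (c := p c) (fun k => ?_) (by omega)).trans (Adj.reachable ?_)
    · simpa using hc (k + 1)
    · rw [deleteEdges_adj]
      refine ⟨h.adj c hcr, fun he => ?_⟩
      rcases Sym2.eq_iff.1 he with ⟨e1, e2⟩ | ⟨e1, e2⟩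
      · exact hc 0 e2
      · exact hc 1 e1

end Rooted

end Rooted

end Fischer

namespace Fischer

open SimpleGraph

/-! ### Local optimality and the degree bound -/

section Degrees

variable {V : Type} [Fintype V]

open scoped Classical in
/-- The degree of a vertex. -/
noncomputable def vdeg (T : SimpleGraph V) (v : V) : ℕ := T.degree v

open scoped Classical in
theorem vdeg_eq_card (T : SimpleGraph V) (v : V) :
    vdeg T v = (Finset.univ.filter (T.Adj v)).card := by
  rw [vdeg, ← card_neighborFinset_eq_degree]
  congr 1
  ext; simp

theorem vdeg_le_maxDeg (T : SimpleGraph V) (v : V) : vdeg T v ≤ maxDeg T := by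
  classical
  exact T.degree_le_maxDegree v

theorem exists_vdeg_eq_maxDeg [Nonempty V] (T : SimpleGraph V) : ∃ v, vdeg T v = maxDeg T := by
  classical
  obtain ⟨v, hv⟩ := T.exists_maximal_degree_vertex
  exact ⟨v, hv.symm⟩

theorem maxDeg_le {T : SimpleGraph V} {k : ℕ} (h : ∀ v, vdeg T v ≤ k) : maxDeg T ≤ k := by
  classical
  exact T.maxDegree_le_of_forall_degree_le k h

theorem vdeg_lt_card (T : SimpleGraph V) (v : V) : vdeg T v < Fintype.card V := by
  classical
  exact T.degree_lt_card_verts v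

theorem sum_vdeg {T : SimpleGraph V} (hT : T.IsTree) :
    ∑ v, vdeg T v + 2 = 2 * Fintype.card V := by
  classical
  have h1 := T.sum_degrees_eq_twice_card_edges
  have h2 := hT.card_edgeFinset
  simp only [vdeg]
  omega

/-- No swap is possible in `T`. -/
def LocallyOptimal (G : SimpleGraph V) (w : Sym2 V → ℝ) (L : ℕ) (T : SimpleGraph V) : Prop :=
  ∀ x y u v, T.Adj x y → G.Adj u v → ¬ (T.deleteEdges {s(x, y)}).Reachable u v →
    w s(u, v) = w s(x, y) →
      ¬ (vdeg T u + 2 ≤ vdeg T x ∧ vdeg T v + 2 ≤ vdeg T x ∧ maxDeg T ≤ vdeg T x + L)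

/-- `T'` arises from `T` by a swap. -/
def IsSwap (G : SimpleGraph V) (w : Sym2 V → ℝ) (L : ℕ) (T T' : SimpleGraph V) : Prop :=
  ∃ x y u v, T.Adj x y ∧ G.Adj u v ∧ ¬ (T.deleteEdges {s(x, y)}).Reachable u v ∧
    w s(u, v) = w s(x, y) ∧ vdeg T u + 2 ≤ vdeg T x ∧ vdeg T v + 2 ≤ vdeg T x ∧
    maxDeg T ≤ vdeg T x + L ∧ T' = exchange T x y u v

theorem IsSwap.isMWST {G T T' : SimpleGraph V} {w : Sym2 V → ℝ} {L : ℕ}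
    (h : IsSwap G w L T T') (hT : IsMWST G w T) : IsMWST G w T' := by
  obtain ⟨x, y, u, v, hxy, hG, hr, hw, -, -, -, rfl⟩ := h
  exact hT.exchange hxy hG hr hw.le

open scoped Classical in
/-- A set of vertices of degree at least `d + 1` in a tree meets at least `d` edges per vertex. -/
theorem card_mul_le_incident {T : SimpleGraph V} (hT : T.IsTree) {S : Finset V} {d : ℕ}
    (hS : ∀ v ∈ S, d + 1 ≤ vdeg T v) :
    d * S.card ≤ (T.edgeFinset.filter fun e => ∃ v ∈ S, v ∈ e).card := by
  have := hT.connected.nonempty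
  inhabit V
  obtain ⟨p, dp, hp, -⟩ := exists_rooted hT (default : V)
  -- An edge is charged only to its parent end, which makes the families disjoint; a vertex gives up
  -- at most the one edge to its own parent.
  let C : V → Finset (Sym2 V) := fun v =>
    ((Finset.univ.filter (T.Adj v)).erase (p v)).image fun z => s(v, z)
  have hC : ∀ v ∈ S, d ≤ (C v).card := by
    intro v hv
    have h1 := hS v hv
    rw [vdeg_eq_card] at h1
    have h2 := (Finset.univ.filter (T.Adj v)).pred_card_le_card_erase (a := p v)
    rw [Finset.card_image_of_injective _ fun a b hab => Sym2.congr_right.1 hab]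
    omega
  have hdisj : (S : Set V).PairwiseDisjoint C := by
    intro v _ v' _ hne
    simp only [Function.onFun]
    rw [Finset.disjoint_left]
    intro e he he'
    simp only [C, Finset.mem_image, Finset.mem_erase, Finset.mem_filter, Finset.mem_univ,
      true_and] at he he'
    obtain ⟨z, ⟨hz, hvz⟩, rfl⟩ := he
    obtain ⟨z', ⟨hz', hvz'⟩, heq⟩ := he'
    rcases Sym2.eq_iff.1 heq with ⟨h1, h2⟩ | ⟨h1, h2⟩
    · exact hne h1.symm
    · subst h1 h2
      rcases hp.edge _ _ hvz with ⟨-, h⟩ | ⟨-, h⟩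
      · exact hz h.symm
      · exact hz' h.symm
  calc d * S.card = ∑ v ∈ S, d := by rw [Finset.sum_const, smul_eq_mul, mul_comm]
    _ ≤ ∑ v ∈ S, (C v).card := Finset.sum_le_sum hC
    _ = (S.biUnion C).card := (Finset.card_biUnion hdisj).symm
    _ ≤ _ := by
        refine Finset.card_le_card fun e he => ?_
        simp only [C, Finset.mem_biUnion, Finset.mem_image, Finset.mem_erase, Finset.mem_filter,
          Finset.mem_univ, true_and] at he
        obtain ⟨v, hv, z, ⟨-, hvz⟩, rfl⟩ := he
        exact Finset.mem_filter.2 ⟨by simpa using hvz, v, hv, by simp⟩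

open scoped Classical in
theorem incident_card_le (T : SimpleGraph V) (S : Finset V) :
    (T.edgeFinset.filter fun e => ∃ v ∈ S, v ∈ e).card ≤ maxDeg T * S.card := by
  calc _ ≤ (S.biUnion fun v => T.incidenceFinset v).card := by
        refine Finset.card_le_card fun e he => ?_
        obtain ⟨he, v, hv, hve⟩ := Finset.mem_filter.1 he
        exact Finset.mem_biUnion.2 ⟨v, hv, by
          simpa [mem_incidenceFinset, incidenceSet, hve] using he⟩
    _ ≤ ∑ v ∈ S, (T.incidenceFinset v).card := Finset.card_biUnion_le
    _ ≤ ∑ v ∈ S, maxDeg T := Finset.sum_le_sum fun v _ => by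
        rw [card_incidenceFinset_eq_degree]; exact vdeg_le_maxDeg T v
    _ = _ := by rw [Finset.sum_const, smul_eq_mul, mul_comm]

-- The partner in `T'` of an edge with an end of degree at least `d + 1` must have an end of degree
-- at least `d`, as otherwise exchanging the two would be a swap. The incident edges of both sets
-- are then compared through the matching.
open scoped Classical in
theorem card_mul_le_of_locallyOptimal {G T T' : SimpleGraph V} {w : Sym2 V → ℝ} {L d : ℕ}
    (hT : IsMWST G w T) (hT' : IsMWST G w T') (hopt : LocallyOptimal G w L T)
    (hd : maxDeg T ≤ d + 1 + L) :
    d * (Finset.univ.filter fun v => d + 1 ≤ vdeg T v).card ≤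
      maxDeg T' * (Finset.univ.filter fun v => d ≤ vdeg T v).card := by
  refine (card_mul_le_incident hT.1.2 (S := Finset.univ.filter fun v => d + 1 ≤ vdeg T v)
    fun v hv => (Finset.mem_filter.1 hv).2).trans (le_trans ?_ (incident_card_le T' _))
  obtain ⟨φ, hφ, h⟩ := hT.exists_injective hT'
  refine Finset.card_le_card_of_injOn
    -- The value outside `T` is a dummy; the map is used on edges of `T` only.
    (fun e => if he : e ∈ T.edgeFinset then φ ⟨e, he⟩ else e) ?_ ?_
  · intro e he
    obtain ⟨he, x, hx, hxe⟩ := Finset.mem_filter.1 he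
    have hx : d + 1 ≤ vdeg T x := (Finset.mem_filter.1 hx).2
    obtain ⟨y, rfl⟩ := hxe
    simp only [he, dite_true]
    obtain ⟨h1, h2, h3⟩ := h ⟨s(x, y), he⟩
    generalize φ ⟨s(x, y), he⟩ = f at h1 h2 h3
    induction f with | h u v => ?_
    refine Finset.mem_coe.2 (Finset.mem_filter.2 ⟨h1, ?_⟩)
    have := hopt x y u v (by simpa using he) (hT'.1.1 (by simpa using h1)) (h2 u v rfl) h3
    by_cases hu : d ≤ vdeg T u
    · exact ⟨u, by simpa using hu, by simp⟩
    · exact ⟨v, by simp only [Finset.mem_filter, Finset.mem_univ, true_and]; omega, by simp⟩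
  · intro a ha b hb hab
    have ha := (Finset.mem_filter.1 (Finset.mem_coe.1 ha)).1
    have hb := (Finset.mem_filter.1 (Finset.mem_coe.1 hb)).1
    simp only [ha, hb, dite_true] at hab
    simpa using hφ hab

/-- A locally optimal minimum weight spanning tree has nearly optimal maximum degree. -/
theorem maxDeg_le_of_locallyOptimal {G T T' : SimpleGraph V} {w : Sym2 V → ℝ} {L : ℕ} {b : ℝ}
    (hb : 1 < b) (hL : (Fintype.card V : ℝ) ≤ b ^ L) (hT : IsMWST G w T) (hT' : IsMWST G w T')
    (hopt : LocallyOptimal G w L T) : (maxDeg T : ℝ) ≤ b * maxDeg T' + L := by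
  classical
  have := hT.1.2.connected.nonempty
  let N : ℕ → ℕ := fun d => (Finset.univ.filter fun v => d ≤ vdeg T v).card
  have hNle : ∀ d, N d ≤ Fintype.card V := fun d => Finset.card_le_univ _
  have hN0 : 1 ≤ N (maxDeg T) := by
    obtain ⟨v, hv⟩ := exists_vdeg_eq_maxDeg T
    exact Finset.card_pos.2 ⟨v, by simp [hv]⟩
  by_cases hΔ : maxDeg T ≤ L
  · have : (maxDeg T : ℝ) ≤ L := by exact_mod_cast hΔ
    have : 0 ≤ b * maxDeg T' := by positivity
    linarith
  -- If the count grew by a factor above `b` at each of the `L` levels, starting from at least one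
  -- vertex of maximum degree, more than `b ^ L` vertices would be found in the end.
  obtain ⟨j, hj, hjN⟩ : ∃ j < L, (N (maxDeg T - (j + 1)) : ℝ) ≤ b * N (maxDeg T - j) := by
    by_contra! hcon
    have hpow : ∀ j ≤ L, b ^ j ≤ N (maxDeg T - j) := by
      intro j
      induction j with
      | zero => intro _; simpa using (by exact_mod_cast hN0 : (1 : ℝ) ≤ N (maxDeg T))
      | succ j ih =>
        intro hj
        have h1 := ih (by omega)
        have h2 := hcon j (by omega)
        rw [pow_succ']
        nlinarith
    -- For `L = 0` there is no strict growth to exploit, but then there is at most one vertex and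
    -- the maximum degree is zero.
    rcases Nat.eq_zero_or_pos L with rfl | hLpos
    · have hcard : Fintype.card V ≤ 1 := by simpa using hL
      have h0 : maxDeg T ≤ 0 := maxDeg_le fun v => by have := vdeg_lt_card T v; omega
      exact hΔ h0
    · obtain ⟨l, rfl⟩ : ∃ l, L = l + 1 := ⟨L - 1, by omega⟩
      have h1 := hpow l (by omega)
      have h2 := hcon l (by omega)
      have h3 : (N (maxDeg T - (l + 1)) : ℝ) ≤ Fintype.card V := by exact_mod_cast hNle _
      rw [pow_succ'] at hL
      nlinarith
  obtain ⟨d, hd⟩ : ∃ d, maxDeg T - j = d + 1 := ⟨maxDeg T - j - 1, by omega⟩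
  have hd' : maxDeg T - (j + 1) = d := by omega
  have key := card_mul_le_of_locallyOptimal (d := d) hT hT' hopt (by omega)
  change d * N (d + 1) ≤ maxDeg T' * N d at key
  rw [hd, hd'] at hjN
  have hpos : 1 ≤ N (d + 1) := by
    refine hN0.trans (Finset.card_le_card fun v hv => ?_)
    simp only [Finset.mem_filter, Finset.mem_univ, true_and] at hv ⊢
    omega
  have hpos' : (0 : ℝ) < N (d + 1) := by exact_mod_cast hpos
  have key' : (d : ℝ) * N (d + 1) ≤ maxDeg T' * N d := by exact_mod_cast key
  have hfin : (d : ℝ) ≤ b * maxDeg T' := by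
    have h1 : (maxDeg T' : ℝ) * N d ≤ maxDeg T' * (b * N (d + 1)) :=
      mul_le_mul_of_nonneg_left hjN (by positivity)
    nlinarith
  have : (maxDeg T : ℝ) ≤ d + L := by exact_mod_cast (by omega : maxDeg T ≤ d + L)
  linarith

theorem exists_maxDeg_eq_optDeg {G : SimpleGraph V} {w : Sym2 V → ℝ} {T : SimpleGraph V}
    (hT : IsMWST G w T) : ∃ T', IsMWST G w T' ∧ maxDeg T' = optDeg G w :=
  Nat.sInf_mem (s := {d : ℕ | ∃ T : SimpleGraph V, IsMWST G w T ∧ maxDeg T = d}) ⟨_, T, hT, rfl⟩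

end Degrees

/-! ### The number of swaps -/

section Potential

variable {V : Type} [Fintype V]

theorem vdeg_exchange_le {T : SimpleGraph V} {x y u v z : V} (hu : z ≠ u) (hv : z ≠ v) :
    vdeg (exchange T x y u v) z ≤ vdeg T z := by
  classical
  rw [vdeg_eq_card, vdeg_eq_card]
  refine Finset.card_le_card fun a ha => ?_
  simp only [Finset.mem_filter, Finset.mem_univ, true_and, exchange_adj, Sym2.eq_iff] at ha ⊢
  tauto

theorem vdeg_exchange_le_succ {T : SimpleGraph V} {x y u v z : V} (huv : u ≠ v) :
    vdeg (exchange T x y u v) z ≤ vdeg T z + 1 := by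
  classical
  rw [vdeg_eq_card, vdeg_eq_card]
  refine (Finset.card_le_card (t := insert (if z = u then v else u) _)
    fun a ha => ?_).trans (Finset.card_insert_le _ _)
  simp only [Finset.mem_filter, Finset.mem_univ, true_and, exchange_adj, Sym2.eq_iff,
    Finset.mem_insert] at ha ⊢
  split_ifs with h
  · grind
  · grind

theorem vdeg_exchange_lt {T : SimpleGraph V} {x y u v : V} (hxy : T.Adj x y) (hu : x ≠ u)
    (hv : x ≠ v) : vdeg (exchange T x y u v) x + 1 ≤ vdeg T x := by
  classical
  rw [vdeg_eq_card, vdeg_eq_card]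
  refine Finset.card_lt_card ⟨fun a ha => ?_, fun h => ?_⟩
  · simp only [Finset.mem_filter, Finset.mem_univ, true_and, exchange_adj, Sym2.eq_iff] at ha ⊢
    tauto
  · have := h (Finset.mem_filter.2 ⟨Finset.mem_univ y, hxy⟩)
    simp only [Finset.mem_filter, Finset.mem_univ, true_and, exchange_adj, Sym2.eq_iff] at this
    tauto

/-- The exponential potential. -/
noncomputable def expSum (T : SimpleGraph V) : ℝ := ∑ v, (5 / 2 : ℝ) ^ vdeg T v

/-- Let `x` have degree e + 2. With base a, the loss of an edge at `x` saves at least a^(e+2) −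
a^(e+1), and `u` and `v`, of degree at most e, cost at most a^(e+1) − a^e each. The net gain a^e(a −
1)(a − 2) is positive only if a > 2; for a = 5/2 it equals 3/4·a^e = 3/25·a^(e+2). -/
theorem expSum_exchange_le {T : SimpleGraph V} {x y u v : V} (hxy : T.Adj x y) (huv : u ≠ v)
    (hu : vdeg T u + 2 ≤ vdeg T x) (hv : vdeg T v + 2 ≤ vdeg T x) :
    expSum (exchange T x y u v) + 3 / 25 * (5 / 2 : ℝ) ^ vdeg T x ≤ expSum T := by
  classical
  obtain ⟨e, he⟩ : ∃ e, vdeg T x = e + 2 := ⟨vdeg T x - 2, by omega⟩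
  have hxu : x ≠ u := by rintro rfl; omega
  have hxv : x ≠ v := by rintro rfl; omega
  set c : ℝ := (5 / 2 : ℝ) ^ e with hc
  have hone : (1 : ℝ) ≤ 5 / 2 := by norm_num
  have up : ∀ z, vdeg T z + 2 ≤ vdeg T x →
      (5 / 2 : ℝ) ^ vdeg (exchange T x y u v) z ≤ (5 / 2 : ℝ) ^ vdeg T z + 3 / 2 * c := by
    intro z hz
    have h1 : (5 / 2 : ℝ) ^ vdeg (exchange T x y u v) z ≤ (5 / 2 : ℝ) ^ (vdeg T z + 1) :=
      pow_le_pow_right₀ hone (vdeg_exchange_le_succ huv)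
    have h2 : (5 / 2 : ℝ) ^ vdeg T z ≤ c := pow_le_pow_right₀ hone (by omega)
    rw [pow_succ] at h1
    linarith
  have hpt : ∀ z, (5 / 2 : ℝ) ^ vdeg (exchange T x y u v) z ≤ (5 / 2 : ℝ) ^ vdeg T z +
      ((if z = x then -(15 / 4 * c) else 0) + (if z = u then 3 / 2 * c else 0) +
        (if z = v then 3 / 2 * c else 0)) := by
    intro z
    by_cases h1 : z = x
    · subst h1
      have h2 : (5 / 2 : ℝ) ^ vdeg (exchange T z y u v) z ≤ (5 / 2 : ℝ) ^ (e + 1) :=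
        pow_le_pow_right₀ hone (by have := vdeg_exchange_lt hxy hxu hxv; omega)
      rw [pow_succ, ← hc] at h2
      simp only [if_true, hxu, hxv, if_false, he, pow_succ, ← hc]
      linarith
    · by_cases h2 : z = u
      · subst h2
        have := up z hu
        simp only [h1, huv, if_true, if_false]
        linarith
      · by_cases h3 : z = v
        · subst h3
          have := up z hv
          simp only [h1, h2, if_true, if_false]
          linarith
        · simp only [h1, h2, h3, if_false, add_zero]
          exact pow_le_pow_right₀ hone (vdeg_exchange_le h2 h3)
  have hsum := Finset.sum_le_sum fun z (_ : z ∈ Finset.univ) => hpt z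
  simp only [Finset.sum_add_distrib, Finset.sum_ite_eq', Finset.mem_univ, if_true] at hsum
  rw [expSum, expSum, he, pow_add, ← hc]
  linarith

/-- Convexity in disguise: after division by `m`, the exponential lies below its chord over the
interval from 0 to `m`. -/
theorem mul_pow_le (k m : ℕ) (h : k ≤ m) :
    (m : ℝ) * (5 / 2 : ℝ) ^ k ≤ m + k * (5 / 2 : ℝ) ^ m := by
  induction m, h using Nat.le_induction with
  | base => have : (0 : ℝ) ≤ k := by positivity
            linarith
  | succ m hkm ih =>
    rcases Nat.eq_zero_or_pos k with rfl | hk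
    · simp
    have h1 : (5 / 2 : ℝ) ^ k ≤ (5 / 2 : ℝ) ^ m := pow_le_pow_right₀ (by norm_num) hkm
    have h2 : (1 : ℝ) ≤ k := by exact_mod_cast hk
    have h3 : (0 : ℝ) < (5 / 2 : ℝ) ^ m := by positivity
    rw [pow_succ]
    push_cast
    nlinarith

theorem le_pow_five_halves (m : ℕ) : (m : ℝ) ≤ (5 / 2 : ℝ) ^ m := by
  induction m with
  | zero => simp
  | succ m ih =>
    have h3 : (1 : ℝ) ≤ (5 / 2 : ℝ) ^ m := one_le_pow₀ (by norm_num)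
    rw [pow_succ]
    push_cast
    linarith

/-- The chord bound is linear in the degrees, whose sum in a tree is below 2n. Compared with the
trivial estimate of the potential this gains a factor of the order of the maximum degree, which is
what makes the sum over all maximum degrees harmonic. -/
theorem maxDeg_mul_expSum_le {T : SimpleGraph V} (hT : T.IsTree) :
    maxDeg T * expSum T ≤ 3 * Fintype.card V * (5 / 2 : ℝ) ^ maxDeg T := by
  have hs : (∑ v, (vdeg T v : ℝ)) ≤ 2 * Fintype.card V := by
    have := sum_vdeg hT
    exact_mod_cast (by omega : ∑ v, vdeg T v ≤ 2 * Fintype.card V)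
  calc maxDeg T * expSum T = ∑ v, maxDeg T * (5 / 2 : ℝ) ^ vdeg T v := by
        rw [expSum, Finset.mul_sum]
    _ ≤ ∑ v, ((maxDeg T : ℝ) + vdeg T v * (5 / 2 : ℝ) ^ maxDeg T) :=
        Finset.sum_le_sum fun v _ => mul_pow_le _ _ (vdeg_le_maxDeg T v)
    _ = Fintype.card V * maxDeg T + (∑ v, (vdeg T v : ℝ)) * (5 / 2 : ℝ) ^ maxDeg T := by
        rw [Finset.sum_add_distrib, Finset.sum_const, Finset.sum_mul, nsmul_eq_mul,
          Finset.card_univ]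
    _ ≤ Fintype.card V * (5 / 2 : ℝ) ^ maxDeg T +
          (2 * Fintype.card V) * (5 / 2 : ℝ) ^ maxDeg T := by
        gcongr
        exact le_pow_five_halves _
    _ = _ := by ring

/-- A bound for the number of swaps still to come. -/
noncomputable def swapBound (L : ℕ) (T : SimpleGraph V) : ℝ :=
  (5 / 2 : ℝ) ^ L * (25 / 3) *
    (3 * Fintype.card V * (harmonic (maxDeg T - 1) : ℝ) + expSum T / (5 / 2 : ℝ) ^ maxDeg T)

theorem expSum_nonneg (T : SimpleGraph V) : 0 ≤ expSum T :=
  Finset.sum_nonneg fun _ _ => by positivity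

theorem harmonic_mono {a b : ℕ} (h : a ≤ b) : (harmonic a : ℝ) ≤ harmonic b := by
  induction b, h using Nat.le_induction with
  | base => exact le_rfl
  | succ b _ ih =>
    rw [harmonic_succ]
    push_cast
    have : (0 : ℝ) ≤ ((b : ℝ) + 1)⁻¹ := by positivity
    linarith

theorem swapBound_nonneg (L : ℕ) (T : SimpleGraph V) : 0 ≤ swapBound L T := by
  have h1 := expSum_nonneg T
  have h2 : (0 : ℝ) ≤ harmonic (maxDeg T - 1) := by
    simpa using harmonic_mono (Nat.zero_le (maxDeg T - 1))
  unfold swapBound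
  positivity

/-- For maximum degree Δ the scaled potential is at most 3n/Δ, exactly what the last term of the
harmonic sum provides. So a tree that has just come down to Δ is paid for by that term. -/
theorem harmonic_add_expSum_le {T : SimpleGraph V} (hT : T.IsTree) (h : 1 ≤ maxDeg T) :
    3 * Fintype.card V * (harmonic (maxDeg T - 1) : ℝ) + expSum T / (5 / 2 : ℝ) ^ maxDeg T ≤
      3 * Fintype.card V * (harmonic (maxDeg T) : ℝ) := by
  have h0 := maxDeg_mul_expSum_le hT
  obtain ⟨m, hm⟩ : ∃ m, maxDeg T = m + 1 := ⟨maxDeg T - 1, by omega⟩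
  rw [hm] at h0 ⊢
  have h1 : expSum T / (5 / 2 : ℝ) ^ (m + 1) ≤ 3 * Fintype.card V * ((m : ℝ) + 1)⁻¹ := by
    rw [div_le_iff₀ (by positivity), mul_right_comm, ← div_eq_mul_inv,
      le_div_iff₀ (by positivity)]
    push_cast at h0
    linarith
  rw [harmonic_succ, Nat.add_sub_cancel]
  push_cast
  rw [mul_add]
  linarith

theorem swapBound_le {T : SimpleGraph V} (hT : T.IsTree) (L : ℕ) :
    swapBound L T ≤ (5 / 2 : ℝ) ^ L * 25 * Fintype.card V * (2 + Real.log (Fintype.card V)) := by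
  have := hT.connected.nonempty
  have hpos : 0 < Fintype.card V := Fintype.card_pos
  have hlog : (0 : ℝ) ≤ Real.log (Fintype.card V) := Real.log_natCast_nonneg _
  have hmain : 3 * Fintype.card V * (harmonic (maxDeg T - 1) : ℝ) +
      expSum T / (5 / 2 : ℝ) ^ maxDeg T ≤
      3 * Fintype.card V * (2 + Real.log (Fintype.card V)) := by
    rcases Nat.eq_zero_or_pos (maxDeg T) with h0 | h0
    · have hE : expSum T = Fintype.card V := by
        have : ∀ v, vdeg T v = 0 := fun v => by have := vdeg_le_maxDeg T v; omega
        simp [expSum, this]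
      rw [h0, hE]
      simp only [Nat.zero_sub, harmonic_zero, Rat.cast_zero, mul_zero, pow_zero, div_one, zero_add]
      have : (0 : ℝ) ≤ Fintype.card V := by positivity
      nlinarith
    · refine (harmonic_add_expSum_le hT h0).trans ?_
      have h1 : (harmonic (maxDeg T) : ℝ) ≤ harmonic (Fintype.card V) :=
        harmonic_mono (maxDeg_le fun v => (vdeg_lt_card T v).le)
      have h2 := harmonic_le_one_add_log (Fintype.card V)
      gcongr
      linarith
  have hmul := mul_le_mul_of_nonneg_left hmain
    (by positivity : (0 : ℝ) ≤ (5 / 2 : ℝ) ^ L * (25 / 3))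
  unfold swapBound
  linarith

/-- If the maximum degree stays, the scaled potential pays for the swap. If it falls, the old scaled
potential pays for the swap, and the new one is covered by the harmonic term that is released. -/
theorem IsSwap.swapBound_add_one_le {G T T' : SimpleGraph V} {w : Sym2 V → ℝ} {L : ℕ}
    (h : IsSwap G w L T T') (hT : IsMWST G w T) : swapBound L T' + 1 ≤ swapBound L T := by
  have hT' := h.isMWST hT
  obtain ⟨x, y, u, v, hxy, hG, hr, hw, hu, hv, hL, rfl⟩ := h
  set T' := Fischer.exchange T x y u v with hTdef
  have huv : u ≠ v := hG.ne
  have hE := expSum_exchange_le hxy huv hu hv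
  rw [← hTdef] at hE
  have hpow : (5 / 2 : ℝ) ^ maxDeg T ≤ (5 / 2 : ℝ) ^ vdeg T x * (5 / 2 : ℝ) ^ L := by
    rw [← pow_add]; exact pow_le_pow_right₀ (by norm_num) hL
  have hle : maxDeg T' ≤ maxDeg T := by
    refine maxDeg_le fun z => ?_
    have hx := vdeg_le_maxDeg T x
    have hz := vdeg_le_maxDeg T z
    by_cases h1 : z = u
    · subst h1
      have := vdeg_exchange_le_succ (T := T) (x := x) (y := y) (z := z) huv
      rw [← hTdef] at this
      omega
    · by_cases h2 : z = v
      · subst h2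
        have := vdeg_exchange_le_succ (T := T) (x := x) (y := y) (z := z) huv
        rw [← hTdef] at this
        omega
      · exact (vdeg_exchange_le h1 h2).trans hz
  have h1 : 1 ≤ maxDeg T' := by
    refine le_trans ?_ (vdeg_le_maxDeg T' u)
    classical
    rw [vdeg_eq_card]
    exact Finset.card_pos.2 ⟨v, by simp [hTdef, exchange_adj, huv]⟩
  -- The vertex `x` has degree at least Δ − L, so the drop relative to (5/2)^Δ is at least
  -- 3/25·(5/2)^(−L). The prefactor of `swapBound` normalises this to one.
  have hA : (1 : ℝ) ≤ (5 / 2 : ℝ) ^ L * (25 / 3) *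
      ((3 / 25 * (5 / 2 : ℝ) ^ vdeg T x) / (5 / 2 : ℝ) ^ maxDeg T) := by
    rw [mul_div_assoc', le_div_iff₀ (by positivity)]
    linarith
  have hpos : (0 : ℝ) ≤ (5 / 2 : ℝ) ^ L * (25 / 3) := by positivity
  have hmain : 3 * Fintype.card V * (harmonic (maxDeg T' - 1) : ℝ) +
      expSum T' / (5 / 2 : ℝ) ^ maxDeg T' +
        (3 / 25 * (5 / 2 : ℝ) ^ vdeg T x) / (5 / 2 : ℝ) ^ maxDeg T ≤
      3 * Fintype.card V * (harmonic (maxDeg T - 1) : ℝ) + expSum T / (5 / 2 : ℝ) ^ maxDeg T := by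
    rcases hle.eq_or_lt with heq | hlt
    · rw [heq, add_assoc, ← add_div]
      gcongr
    · have h2 := harmonic_add_expSum_le hT'.1.2 h1
      have h3 : (harmonic (maxDeg T') : ℝ) ≤ harmonic (maxDeg T - 1) := harmonic_mono (by omega)
      have h4 := expSum_nonneg T'
      have h5 : 3 * Fintype.card V * (harmonic (maxDeg T') : ℝ) ≤
          3 * Fintype.card V * (harmonic (maxDeg T - 1) : ℝ) := by gcongr
      have h6 : (3 / 25 * (5 / 2 : ℝ) ^ vdeg T x) / (5 / 2 : ℝ) ^ maxDeg T ≤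
          expSum T / (5 / 2 : ℝ) ^ maxDeg T := by
        gcongr
        linarith
      linarith
  have := mul_le_mul_of_nonneg_left hmain hpos
  rw [mul_add] at this
  unfold swapBound
  linarith

/-- The number of swaps, times the square of the number of vertices, is within the claim. -/
theorem exists_const_swaps (b : ℝ) (hb : 1 < b) :
    ∃ C : ℝ, 0 ≤ C ∧ ∀ n L : ℕ, 1 ≤ n → b ^ L ≤ b * n →
      (5 / 2 : ℝ) ^ L * 25 * n * (2 + Real.log n) * (n : ℝ) ^ 2 ≤
        C * (n : ℝ) ^ (3 + 1 / Real.log b) := by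
  have hlb : 0 < Real.log b := Real.log_pos hb
  set g : ℝ := Real.log (5 / 2) / Real.log b with hg
  -- The base is less than e. The gap makes `ε` positive, and `n ^ ε` absorbs the logarithm.
  have hc1 : Real.log (5 / 2) < 1 := by
    rw [Real.log_lt_iff_lt_exp (by norm_num)]
    have := Real.exp_one_gt_d9
    linarith
  have hc0 : 0 < Real.log (5 / 2) := Real.log_pos (by norm_num)
  set ε : ℝ := 1 / Real.log b - g with hε
  have hεpos : 0 < ε := by
    rw [hε, hg, ← sub_div]
    exact div_pos (by linarith) hlb
  refine ⟨25 * b ^ g * (2 + 1 / ε), by positivity, fun n L hn hL => ?_⟩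
  have hn1 : (1 : ℝ) ≤ n := by exact_mod_cast hn
  have hn0 : (0 : ℝ) < n := by linarith
  have h1 : (5 / 2 : ℝ) ^ L ≤ b ^ g * (n : ℝ) ^ g := by
    have e1 : (5 / 2 : ℝ) ^ L = (b ^ L) ^ g := by
      have hbg : b ^ g = 5 / 2 := by
        rw [Real.rpow_def_of_pos (by linarith), hg, mul_div_cancel₀ _ hlb.ne',
          Real.exp_log (by norm_num)]
      rw [← Real.rpow_natCast b L, ← Real.rpow_mul (by linarith), mul_comm, Real.rpow_mul
        (by linarith), hbg, Real.rpow_natCast]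
    rw [e1, ← Real.mul_rpow (by linarith) hn0.le]
    exact Real.rpow_le_rpow (by positivity) hL (by positivity)
  have h2 : 2 + Real.log n ≤ (2 + 1 / ε) * (n : ℝ) ^ ε := by
    have e1 := Real.log_le_rpow_div hn0.le hεpos
    have e2 : 1 ≤ (n : ℝ) ^ ε := Real.one_le_rpow hn1 hεpos.le
    rw [add_mul, one_div, inv_mul_eq_div]
    linarith
  have h3 : (n : ℝ) ^ (3 + 1 / Real.log b) = (n : ℝ) ^ g * (n : ℝ) ^ ε * (n : ℝ) ^ 3 := by
    rw [← Real.rpow_add hn0, ← Real.rpow_natCast (n : ℝ) 3, ← Real.rpow_add hn0]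
    congr 1
    rw [hε]; push_cast; ring
  have hlog : (0 : ℝ) ≤ Real.log n := Real.log_natCast_nonneg _
  calc (5 / 2 : ℝ) ^ L * 25 * n * (2 + Real.log n) * (n : ℝ) ^ 2
      = (5 / 2 : ℝ) ^ L * (2 + Real.log n) * (25 * (n : ℝ) ^ 3) := by ring
    _ ≤ (b ^ g * (n : ℝ) ^ g) * ((2 + 1 / ε) * (n : ℝ) ^ ε) * (25 * (n : ℝ) ^ 3) := by gcongr
    _ = _ := by rw [h3]; ring

end Potential

end Fischer

namespace Fischer

open NVar NArr RVar RArr SimpleGraph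

/-! ### Loops, with their frames -/

theorem Frame.refl (s : Stmt) (σ : State) : Frame s σ σ :=
  ⟨fun _ _ => rfl, fun _ _ => rfl, fun _ _ => rfl, fun _ _ => rfl⟩

theorem Frame.trans {s : Stmt} {σ ρ τ : State} (h : Frame s σ ρ) (h' : Frame s ρ τ) :
    Frame s σ τ :=
  ⟨fun v hv => (h'.nv v hv).trans (h.nv v hv), fun v hv => (h'.na v hv).trans (h.na v hv),
    fun v hv => (h'.rv v hv).trans (h.rv v hv), fun v hv => (h'.ra v hv).trans (h.ra v hv)⟩

/-- `wp_loop` with the frame of the loop at hand in each turn. -/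
theorem wp_loop_frame {c s} (Inv : ℕ → State → Prop) {σ : State}
    (step : ∀ B ρ, Frame (.loop c s) σ ρ → Inv B ρ → c.holds ρ →
      wp s (fun t τ => ∃ B', Inv B' τ ∧ t + c.cost + 1 + B' ≤ B) ρ)
    {B : ℕ} (h : Inv B σ) :
    wp (.loop c s) (fun t τ => ∃ B', Inv B' τ ∧ ¬ c.holds τ ∧ t + B' ≤ B + c.cost + 1) σ := by
  refine (wp_loop (fun B ρ => Frame (.loop c s) σ ρ ∧ Inv B ρ) ?_ ⟨Frame.refl _ _, h⟩).mono ?_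
  · rintro B ρ ⟨hF, hI⟩ hc
    refine (step B ρ hF hI hc).frame.mono ?_
    rintro t τ ⟨⟨B', hB, ht⟩, hF'⟩
    exact ⟨B', ⟨hF.trans ⟨hF'.nv, hF'.na, hF'.rv, hF'.ra⟩, hB⟩, ht⟩
  · rintro t τ ⟨B', ⟨-, h⟩, hc⟩
    exact ⟨B', h, hc⟩

/-- `wp_for` for a loop up to a register, with the frame of the loop at hand in each turn. -/
theorem wp_for_frame {v u : NVar} {s} (N B : ℕ) (Inv : ℕ → State → Prop) {σ : State}
    (hN : σ.nv u = N) (huv : u ≠ v) (hsv : s.writesN v = false) (hsu : s.writesN u = false)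
    (h : Inv 0 (σ.setN v 0))
    (step : ∀ i ρ, Frame (.for v u s) σ ρ → ρ.nv v = i → i < N → Inv i ρ →
      wp s (fun t τ => t ≤ B ∧ Inv (i + 1) (τ.setN v (i + 1))) ρ) :
    wp (.for v u s) (fun t τ => t ≤ N * (B + 9) + 9 ∧ Inv N τ) σ := by
  refine (wp_for N B (fun i ρ => Frame (.for v u s) σ ρ ∧ ρ.nv v = i ∧ Inv i ρ) ?_ ?_ ?_).mono ?_
  · rintro i ρ ⟨hF, hv, -⟩
    refine ⟨hv, ?_⟩
    rw [NExp.eval, hF.nv u (by simp [Stmt.for, Stmt.writesN, huv, hsu]), hN]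
  · rintro i ρ ⟨hF, hv, hI⟩ hi
    refine (step i ρ hF hv hi hI).frame.mono ?_
    rintro t τ ⟨⟨ht, hI'⟩, hF'⟩
    have hv' : τ.nv v = i := by rw [hF'.nv v hsv, hv]
    refine ⟨ht, hF.trans ⟨?_, ?_, ?_, ?_⟩, by simp [hv'], by rwa [hv']⟩
    · intro a ha
      simp only [Stmt.for, Stmt.writesN, Bool.or_eq_false_iff, decide_eq_false_iff_not] at ha
      simp [ha.1, hF'.nv a ha.2.1]
    · intro a ha
      simp only [Stmt.for, Stmt.writesA, Bool.or_false, Bool.false_or] at ha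
      exact hF'.na a ha
    · intro a ha
      simp only [Stmt.for, Stmt.writesR, Bool.or_false, Bool.false_or] at ha
      exact hF'.rv a ha
    · intro a ha
      simp only [Stmt.for, Stmt.writesB, Bool.or_false, Bool.false_or] at ha
      exact hF'.ra a ha
  · refine ⟨⟨?_, fun _ _ => rfl, fun _ _ => rfl, fun _ _ => rfl⟩, by simp, h⟩
    intro a ha
    simp only [Stmt.for, Stmt.writesN, Bool.or_eq_false_iff, decide_eq_false_iff_not] at ha
    simp [ha.1]
  · rintro t τ ⟨ht, -, -, hI⟩
    exact ⟨ht, hI⟩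

/-! ### Matrices in memory -/

theorem cell_inj {n : ℕ} {u v u' v' : ℕ} (hv : v < n) (hv' : v' < n) :
    u * n + v = u' * n + v' ↔ u = u' ∧ v = v' := by
  constructor
  · intro h
    have hn : 0 < n := by omega
    have h1 : (u * n + v) / n = u := by
      rw [mul_comm, Nat.mul_add_div hn, Nat.div_eq_of_lt hv, add_zero]
    have h2 : (u' * n + v') / n = u' := by
      rw [mul_comm, Nat.mul_add_div hn, Nat.div_eq_of_lt hv', add_zero]
    have h3 : u = u' := by rw [← h1, h, h2]
    subst h3
    exact ⟨rfl, by omega⟩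
  · rintro ⟨rfl, rfl⟩; rfl

/-- The array `f` holds the adjacency matrix of `T`. -/
def IsAdj {n : ℕ} (f : ℕ → ℕ) (T : SimpleGraph (Fin n)) : Prop :=
  ∀ u v : Fin n, (T.Adj u v → f (u * n + v) = 1) ∧ (¬ T.Adj u v → f (u * n + v) = 0)

theorem IsAdj.eq_one_iff {n : ℕ} {f : ℕ → ℕ} {T : SimpleGraph (Fin n)} (h : IsAdj f T)
    (u v : Fin n) : f (u * n + v) = 1 ↔ T.Adj u v := by
  by_cases ha : T.Adj u v
  · simp [ha, (h u v).1 ha]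
  · simp [ha, (h u v).2 ha]

theorem isAdj_adjArray {n : ℕ} (T : SimpleGraph (Fin n)) : IsAdj (adjArray T) T := by
  intro u v
  have key : (∃ a b : Fin n, T.Adj a b ∧ (u * n + v : ℕ) = a * n + b) ↔ T.Adj u v := by
    constructor
    · rintro ⟨a, b, hab, he⟩
      obtain ⟨h1, h2⟩ := (cell_inj v.2 b.2).1 he
      rwa [Fin.ext h1, Fin.ext h2]
    · exact fun h => ⟨u, v, h, rfl⟩
  exact ⟨fun h => if_pos (key.2 h), fun h => if_neg (mt key.1 h)⟩

theorem weightArray_cell {n : ℕ} (G : SimpleGraph (Fin n)) (w : Sym2 (Fin n) → ℝ) (u v : Fin n) :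
    (G.Adj u v → weightArray G w (u * n + v) = w s(u, v)) ∧
      (¬ G.Adj u v → weightArray G w (u * n + v) = 0) := by
  classical
  have key : ∀ a b : Fin n, (G.Adj a b ∧ (u * n + v : ℕ) = a * n + b) ↔
      (a = u ∧ b = v ∧ G.Adj u v) := by
    intro a b
    rw [cell_inj v.2 b.2, ← Fin.ext_iff, ← Fin.ext_iff]
    constructor
    · rintro ⟨h, rfl, rfl⟩; exact ⟨rfl, rfl, h⟩
    · rintro ⟨rfl, rfl, h⟩; exact ⟨h, rfl, rfl⟩
  unfold weightArray
  simp only [key]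
  constructor
  · intro h
    rw [Finset.sum_eq_single u, Finset.sum_eq_single v] <;> simp_all
  · intro h; simp [h]

/-! ### The logarithm -/

theorem wp_computeLog {b : ℝ} {n L : ℕ} {σ : State} (hb : σ.rv base = b) (hn : σ.nv size = n)
    (hL : (n : ℝ) ≤ b ^ L) (hlt : ∀ m < L, b ^ m < n) :
    wp computeLog (fun t τ => t ≤ 16 * (L + 1) ∧ τ.nv logn = L) σ := by
  simp only [computeLog, block, wp_seq, wp_setN, wp_setR]
  refine (wp_loop_frame (fun B ρ => ∃ m ≤ L, ρ.nv logn = m ∧ ρ.rv power = b ^ m ∧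
    B = 16 * (L - m)) ?_ ⟨0, Nat.zero_le _, by simp, by simp, rfl⟩).frame.mono ?_
  · rintro B ρ hF ⟨m, hm, h1, h2, rfl⟩ hc
    have hbase := hF.rv base rfl
    have hsize := hF.nv size rfl
    simp [h2, hn, hsize] at hc hbase
    have hm' : m < L := by
      refine lt_of_le_of_ne hm fun h => ?_
      subst h
      linarith
    rw [wp_seq, wp_setR, wp_setN]
    refine ⟨16 * (L - (m + 1)), ⟨m + 1, hm', by simp [h1], ?_, rfl⟩, ?_⟩
    · simp [h2, hbase, hb, pow_succ]
    · simp; omega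
  · rintro t τ ⟨⟨B, ⟨m, hm, h1, h2, rfl⟩, hc, ht⟩, hF⟩
    have hsize := hF.nv size rfl
    simp [h2, hn, hsize] at hc
    have hm' : m = L := by
      by_contra h
      linarith [hlt m (by omega)]
    subst hm'
    simp at ht ⊢
    exact ⟨by omega, h1⟩

end Fischer

namespace Fischer

open NVar NArr RVar RArr SimpleGraph

/-! ### The distinct weights -/

section Labels

variable {n : ℕ}

/-- `d 0, …, d (N - 1)` are distinct weights of edges of `T`, among them the weights of those edges
`uv` of `T` for which `(u, v)` comes before `(a, c)`. -/
structure ListsWeights (T : SimpleGraph (Fin n)) (w : Sym2 (Fin n) → ℝ) (a c N : ℕ) (d : ℕ → ℝ) :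
    Prop where
  mem : ∀ m < N, ∃ e ∈ T.edgeSet, d m = w e
  inj : ∀ m < N, ∀ m' < N, d m = d m' → m = m'
  covers : ∀ u v : Fin n, T.Adj u v → (u.1 < a ∨ (u.1 = a ∧ v.1 < c)) → ∃ m < N, d m = w s(u, v)

theorem ListsWeights.next {T : SimpleGraph (Fin n)} {w : Sym2 (Fin n) → ℝ} {a c N : ℕ} {d : ℕ → ℝ}
    (h : ListsWeights T w a c N d)
    (hc : ∀ u v : Fin n, T.Adj u v → u.1 = a → v.1 = c → ∃ m < N, d m = w s(u, v)) :
    ListsWeights T w a (c + 1) N d where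
  mem := h.mem
  inj := h.inj
  covers u v huv hlt := by
    by_cases he : u.1 = a ∧ v.1 = c
    · exact hc u v huv he.1 he.2
    · exact h.covers u v huv (by omega)

theorem ListsWeights.row {T : SimpleGraph (Fin n)} {w : Sym2 (Fin n) → ℝ} {a N : ℕ} {d : ℕ → ℝ}
    (h : ListsWeights T w a n N d) : ListsWeights T w (a + 1) 0 N d where
  mem := h.mem
  inj := h.inj
  covers u v huv hlt := h.covers u v huv (by omega)

theorem ListsWeights.insert {T : SimpleGraph (Fin n)} {w : Sym2 (Fin n) → ℝ} {a c N : ℕ}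
    {d : ℕ → ℝ} (h : ListsWeights T w a c N d) {u v : Fin n} (huv : T.Adj u v) (hu : u.1 = a)
    (hv : v.1 = c) (hnew : ∀ m < N, d m ≠ w s(u, v)) :
    ListsWeights T w a (c + 1) (N + 1) (Function.update d N (w s(u, v))) := by
  have hold : ∀ m < N, Function.update d N (w s(u, v)) m = d m := fun m hm => by
    rw [Function.update_of_ne hm.ne]
  have hN : Function.update d N (w s(u, v)) N = w s(u, v) := Function.update_self ..
  have cases : ∀ m < N + 1, m = N ∨ m < N := fun m hm => by omega
  refine ⟨fun m hm => ?_, fun m hm m' hm' he => ?_, fun u' v' hadj hlt => ?_⟩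
  · rcases cases m hm with rfl | hm
    · exact ⟨_, huv, hN⟩
    · rw [hold m hm]; exact h.mem m hm
  · rcases cases m hm with rfl | hm <;> rcases cases m' hm' with rfl | hm'
    · rfl
    · rw [hN, hold m' hm'] at he; exact absurd he.symm (hnew m' hm')
    · rw [hN, hold m hm] at he; exact absurd he (hnew m hm)
    · rw [hold m hm, hold m' hm'] at he; exact h.inj m hm m' hm' he
  · by_cases he : u'.1 = a ∧ v'.1 = c
    · have e1 : u' = u := Fin.ext (he.1.trans hu.symm)
      have e2 : v' = v := Fin.ext (he.2.trans hv.symm)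
      subst e1 e2
      exact ⟨N, by omega, hN⟩
    · obtain ⟨m, hm, e⟩ := h.covers u' v' hadj (by omega)
      exact ⟨m, by omega, by rw [hold m hm, e]⟩

/-- Distinct weights come from distinct edges, and a tree on `n` vertices has n − 1 of them. This
keeps each search through the list linear. -/
theorem ListsWeights.lt {T : SimpleGraph (Fin n)} {w : Sym2 (Fin n) → ℝ} {a c N : ℕ}
    {d : ℕ → ℝ} (h : ListsWeights T w a c N d) (hT : T.IsTree) : N < n := by
  classical
  have h1 : ((Finset.range N).image d).card = N := by
    rw [Finset.card_image_of_injOn, Finset.card_range]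
    intro m hm m' hm' he
    exact h.inj m (by simpa using hm) m' (by simpa using hm') he
  have h2 : (Finset.range N).image d ⊆ T.edgeFinset.image w := by
    intro x hx
    obtain ⟨m, hm, rfl⟩ := Finset.mem_image.1 hx
    obtain ⟨e, he, hd⟩ := h.mem m (by simpa using hm)
    exact Finset.mem_image.2 ⟨e, by simpa using he, hd.symm⟩
  have h3 := (Finset.card_le_card h2).trans Finset.card_image_le
  have h4 := hT.card_edgeFinset
  rw [Fintype.card_fin] at h4
  omega

/-- `l` is the index of `x` among `d 0, …, d (N - 1)`, and `N` if there is none. -/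
def IsIndex (N : ℕ) (d : ℕ → ℝ) (l : ℕ) (x : ℝ) : Prop :=
  (l < N ∧ d l = x) ∨ (l = N ∧ ∀ m < N, d m ≠ x)

/-- The array `lab` holds indices of weights; those of the edges of `T` are below `N`. -/
structure Labeling (T : SimpleGraph (Fin n)) (W : ℕ → ℝ) (N : ℕ) (lab : ℕ → ℕ) : Prop where
  le : ∀ u v : Fin n, lab (u * n + v) ≤ N
  tree : ∀ u v : Fin n, T.Adj u v → lab (u * n + v) < N
  eq_iff : ∀ u v u' v' : Fin n, lab (u * n + v) < N →
    (lab (u' * n + v') = lab (u * n + v) ↔ W (u' * n + v') = W (u * n + v))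

/-- Only labels below `N` are claimed to reflect equality of weights; `N` itself is shared by all
weights foreign to the tree. The tree enters only through its edges having labels below `N`, a
property that swaps preserve. -/
theorem labeling_of_isIndex {T : SimpleGraph (Fin n)} {w : Sym2 (Fin n) → ℝ} {W : ℕ → ℝ} {N : ℕ}
    {d : ℕ → ℝ} {lab : ℕ → ℕ} (hW : ∀ u v : Fin n, T.Adj u v → W (u * n + v) = w s(u, v))
    (h : ListsWeights T w n 0 N d)
    (hlab : ∀ u v : Fin n, IsIndex N d (lab (u * n + v)) (W (u * n + v))) :
    Labeling T W N lab where
  le u v := by rcases hlab u v with h | h <;> omega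
  tree u v huv := by
    rcases hlab u v with h' | ⟨-, h'⟩
    · exact h'.1
    · obtain ⟨m, hm, e⟩ := h.covers u v huv (.inl u.2)
      exact absurd (e.trans (hW u v huv).symm) (h' m hm)
  eq_iff u v u' v' hlt := by
    have h1 : d (lab (u * n + v)) = W (u * n + v) := by
      rcases hlab u v with h | h
      · exact h.2
      · omega
    rcases hlab u' v' with ⟨h2, h3⟩ | ⟨h2, h3⟩
    · rw [← h1, ← h3]
      exact ⟨fun e => by rw [e], fun e => h.inj _ h2 _ hlt e⟩
    · refine ⟨fun e => by omega, fun e => ?_⟩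
      exact absurd (h1.trans e.symm) (h3 _ hlt)

theorem wp_seen {N q : ℕ} {x : ℝ} {σ : State} (hN : σ.nv numW = N) (hseen : σ.nv seen = 0)
    (hq : σ.nv i * σ.nv size + σ.nv j = q) (hx : σ.ra wt q = x) :
    wp (.for k numW (.when (.req (.get dist k) (.get wt (cell i j))) (.setN seen 1)))
      (fun t τ => t ≤ N * 23 + 9 ∧ (τ.nv seen = 0 ↔ ∀ m < N, σ.ra dist m ≠ x)) σ := by
  refine (wp_for_frame N 14 (fun m ρ => ρ.nv seen = 0 ↔ ∀ m' < m, σ.ra dist m' ≠ x) hN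
    (by decide) rfl rfl (by simp [hseen]) ?_).mono fun t τ h => h
  intro m ρ hF hm hmN hI
  have e1 := hF.nv i rfl
  have e2 := hF.nv j rfl
  have e3 := hF.nv size rfl
  have e4 := hF.ra dist rfl
  have e5 := hF.ra wt rfl
  simp only [wp_when, wp_setN]
  simp [e1, e2, e3, e4, e5, hm, hq, hx]
  refine ⟨fun he => ⟨m, by omega, he⟩, fun hne => ?_⟩
  rw [hI]
  exact ⟨fun h m' hm' => by
    rcases hm'.lt_or_eq with h' | rfl
    · exact h m' h'
    · exact hne, fun h m' hm' => h m' (by omega)⟩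

theorem wp_setLabel {N q : ℕ} {x : ℝ} {σ : State} (hN : σ.nv numW = N)
    (hq : σ.nv i * σ.nv size + σ.nv j = q) (hx : σ.ra wt q = x) (hl : σ.na label q = N) :
    wp (.for k numW (.when (.req (.get dist k) (.get wt (cell i j)))
        (.setA label (cell i j) k)))
      (fun t τ => t ≤ N * 29 + 9 ∧ (∀ q' ≠ q, τ.na label q' = σ.na label q') ∧
        IsIndex N (σ.ra dist) (τ.na label q) x) σ := by
  refine (wp_for_frame N 20 (fun m ρ => (∀ q' ≠ q, ρ.na label q' = σ.na label q') ∧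
    ((ρ.na label q < m ∧ m ≤ N ∧ σ.ra dist (ρ.na label q) = x) ∨
      (ρ.na label q = N ∧ ∀ m' < m, σ.ra dist m' ≠ x))) hN
    (by decide) rfl rfl (by simp [hl]) ?_).mono ?_
  · intro m ρ hF hm hmN ⟨hI, hJ⟩
    have e1 := hF.nv i rfl
    have e2 := hF.nv j rfl
    have e3 := hF.nv size rfl
    have e4 := hF.ra dist rfl
    have e5 := hF.ra wt rfl
    simp only [wp_when, wp_setA]
    simp [e1, e2, e3, e4, e5, hm, hq, hx]
    refine ⟨fun he => ⟨fun q' hq' => ?_, .inl ⟨hmN, he⟩⟩, fun hne => ⟨hI, ?_⟩⟩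
    · rw [Function.update_of_ne hq', hI q' hq']
    · rcases hJ with ⟨h1, -, h2⟩ | ⟨h1, h2⟩
      · exact .inl ⟨by omega, by omega, h2⟩
      · refine .inr ⟨h1, fun m' hm' => ?_⟩
        rcases hm'.lt_or_eq with h' | rfl
        · exact h2 m' h'
        · exact hne
  · rintro t τ ⟨ht, h1, h2⟩
    refine ⟨ht, h1, ?_⟩
    rcases h2 with h2 | h2
    · exact .inl ⟨h2.1, h2.2.2⟩
    · exact .inr h2

theorem wp_labelWeights {T : SimpleGraph (Fin n)} {w : Sym2 (Fin n) → ℝ} {σ : State}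
    (hn : σ.nv size = n) (hT : T.IsTree) (htree : IsAdj (σ.na tree) T)
    (hW : ∀ u v : Fin n, T.Adj u v → σ.ra wt (u * n + v) = w s(u, v)) :
    wp labelWeights (fun t τ => t ≤ 1000 * n ^ 3 ∧ τ.nv numW ≤ n ∧
      Labeling T (σ.ra wt) (τ.nv numW) (τ.na label)) σ := by
  have hn1 : 1 ≤ n := by
    have := hT.connected.nonempty
    exact Fin.pos_iff_nonempty.2 this
  rw [labelWeights]
  simp only [block]
  rw [wp_seq, wp_setN, wp_seq]
  refine (wp_for_frame n (n * (n * 23 + 70) + 9)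
    (fun a ρ => ListsWeights T w a 0 (ρ.nv numW) (ρ.ra dist)) (by simpa using hn)
    (by decide) rfl rfl ?_ ?_).frame.mono ?_
  · simp
    exact ⟨fun m hm => by omega, fun m hm => by omega, fun u v _ h => by omega⟩
  · intro a ρ hF ha haN hI
    have e0 := hF.nv size rfl
    simp [hn] at e0
    refine (wp_for_frame n (n * 23 + 61)
      (fun c τ => ListsWeights T w a c (τ.nv numW) (τ.ra dist)) e0
      (by decide) rfl rfl (by simpa using hI) ?_).mono ?_
    · intro c ρ' hF' hc hcN hJ
      have e1 := hF'.nv i rfl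
      have e2 := (hF'.nv size rfl).trans e0
      have e3 := ((hF'.na tree rfl).trans (hF.na tree rfl))
      have e5 := ((hF'.ra wt rfl).trans (hF.ra wt rfl))
      simp at e3 e5
      rw [ha] at e1
      have hadj := htree.eq_one_iff ⟨a, haN⟩ ⟨c, hcN⟩
      simp only at hadj
      have hNn := hJ.lt hT
      rw [wp_when]
      simp only [BExp.holds, NExp.eval, cell, e1, hc, e2, e3, hadj]
      refine ⟨fun huv => ?_, fun huv => ⟨by simp, ?_⟩⟩
      · simp only [wp_seq, wp_setN]
        refine (wp_seen (N := ρ'.nv numW) (q := a * n + c) (x := w s(⟨a, haN⟩, ⟨c, hcN⟩))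
          (by simp) (by simp) (by simp [e1, e2, hc])
          (by simpa [e5] using hW _ _ huv)).frame.mono ?_
        rintro t τ ⟨⟨ht, hs⟩, hG⟩
        have g1 := hG.nv numW rfl
        have g2 := hG.ra dist rfl
        have g3 := (hG.nv i rfl)
        have g4 := (hG.nv j rfl)
        have g5 := (hG.nv size rfl)
        have g6 := hG.ra wt rfl
        simp [e1, e2, hc, e5] at g1 g2 g3 g4 g5 g6
        rw [wp_when]
        simp only [wp_seq, wp_setN, wp_setB]
        simp [g1, g2, g3, g4, g5, g6] at hs ⊢
        have hmul : ρ'.nv numW * 23 ≤ n * 23 := Nat.mul_le_mul_right _ hNn.le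
        refine ⟨fun h0 => ⟨by omega, ?_⟩, fun h0 => ⟨by omega, ?_⟩⟩
        · rw [hW ⟨a, haN⟩ ⟨c, hcN⟩ huv]
          exact hJ.insert huv rfl rfl (hs.1 h0)
        · refine hJ.next fun u v _ hu hv => ?_
          have : u = ⟨a, haN⟩ := Fin.ext hu
          have : v = ⟨c, hcN⟩ := Fin.ext hv
          subst u v
          by_contra! hcon
          exact h0 (hs.2 hcon)
      · simp
        refine hJ.next fun u v hadj' hu hv => ?_
        have : u = ⟨a, haN⟩ := Fin.ext hu
        have : v = ⟨c, hcN⟩ := Fin.ext hv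
        subst u v
        exact absurd hadj' huv
    · rintro t τ ⟨ht, hJ⟩
      exact ⟨by omega, by simpa using hJ.row⟩
  · rintro t₁ τ₁ ⟨⟨ht₁, hL⟩, hF₁⟩
    have f0 := hF₁.nv size rfl
    have f1 := hF₁.ra wt rfl
    simp [hn] at f0 f1
    have hNn := hL.lt hT
    refine (wp_for_frame n (n * (n * 29 + 70) + 9)
      (fun a ρ => ∀ u v : Fin n, u.1 < a →
        IsIndex (τ₁.nv numW) (τ₁.ra dist) (ρ.na label (u * n + v)) (σ.ra wt (u * n + v)))
      f0 (by decide) rfl rfl (by simp) ?_).frame.mono ?_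
    · intro a ρ hF ha haN hI
      have e0 := (hF.nv size rfl).trans f0
      refine (wp_for_frame n (n * 29 + 61)
        (fun c τ => ∀ u v : Fin n, (u.1 < a ∨ (u.1 = a ∧ v.1 < c)) →
          IsIndex (τ₁.nv numW) (τ₁.ra dist) (τ.na label (u * n + v)) (σ.ra wt (u * n + v))) e0
        (by decide) rfl rfl (by simpa using hI) ?_).mono ?_
      · intro c ρ' hF' hc hcN hJ
        have e1 := hF'.nv i rfl
        have e2 := (hF'.nv size rfl).trans e0
        have e3 := ((hF'.nv numW rfl).trans (hF.nv numW rfl))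
        have e4 := ((hF'.ra dist rfl).trans (hF.ra dist rfl))
        have e5 := ((hF'.ra wt rfl).trans (hF.ra wt rfl)).trans f1
        rw [ha] at e1
        rw [wp_seq, wp_setA]
        refine (wp_setLabel (N := τ₁.nv numW) (q := a * n + c) (x := σ.ra wt (a * n + c))
          (by simp [e3]) (by simp [e1, e2, hc]) (by simp [e5])
          (by simp [e1, e2, e3, hc])).mono ?_
        rintro t τ ⟨ht, h1, h2⟩
        simp [e1, e2, hc, e4] at h1 h2 ⊢
        have hmul : τ₁.nv numW * 29 ≤ n * 29 := Nat.mul_le_mul_right _ hNn.le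
        refine ⟨by omega, fun u v huv => ?_⟩
        by_cases he : u.1 = a ∧ v.1 = c
        · obtain ⟨rfl, rfl⟩ := he
          exact h2
        · have hne : (u * n + v : ℕ) ≠ a * n + c := fun h => he ((cell_inj v.2 hcN).1 h)
          rw [h1 _ hne, Function.update_of_ne hne]
          exact hJ u v (by omega)
      · rintro t τ ⟨ht, hJ⟩
        exact ⟨by omega, fun u v huv => by simpa using hJ u v (by omega)⟩
    · rintro t₂ τ₂ ⟨⟨ht₂, hI⟩, hF₂⟩
      have g1 := hF₂.nv numW rfl
      rw [g1]
      refine ⟨?_, hNn.le, labeling_of_isIndex hW hL fun u v => hI u v u.2⟩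
      have hn2 : n ≤ n * n := Nat.le_mul_self n
      have hn3 : n * n ≤ n * n * n := Nat.le_mul_of_pos_right _ hn1
      simp
      ring_nf at *
      omega

end Labels

end Fischer

namespace Fischer

open NVar NArr RVar RArr SimpleGraph

/-! ### Degrees and lists of neighbours -/

section DegTable

variable {n : ℕ}

/-- The first `d` entries of `row` list the neighbours of `u` below `c` in increasing order. -/
structure ListsRow (T : SimpleGraph (Fin n)) (u : Fin n) (c d : ℕ) (row : ℕ → ℕ) : Prop where
  le : d ≤ c
  adj : ∀ m < d, ∃ v : Fin n, T.Adj u v ∧ v.1 < c ∧ row m = v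
  surj : ∀ v : Fin n, T.Adj u v → v.1 < c → ∃ m < d, row m = v
  inj : ∀ m < d, ∀ m' < d, row m = row m' → m = m'

theorem ListsRow.card {T : SimpleGraph (Fin n)} {u : Fin n} {d : ℕ} {row : ℕ → ℕ}
    (h : ListsRow T u n d row) : d = vdeg T u := by
  classical
  have h1 : ((Finset.range d).image row).card = d := by
    rw [Finset.card_image_of_injOn, Finset.card_range]
    intro m hm m' hm' he
    exact h.inj m (by simpa using hm) m' (by simpa using hm') he
  rw [vdeg_eq_card, ← h1, ← Finset.card_image_of_injective _ Fin.val_injective]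
  congr 1
  ext x
  simp only [Finset.mem_image, Finset.mem_range, Finset.mem_filter, Finset.mem_univ, true_and]
  constructor
  · rintro ⟨m, hm, rfl⟩
    obtain ⟨v, hv, -, e⟩ := h.adj m hm
    exact ⟨v, hv, e.symm⟩
  · rintro ⟨v, hv, rfl⟩
    exact h.surj v hv v.2

theorem ListsRow.congr {T : SimpleGraph (Fin n)} {u : Fin n} {c d : ℕ} {row row' : ℕ → ℕ}
    (h : ListsRow T u c d row) (he : ∀ m < c, row' m = row m) : ListsRow T u c d row' := by
  have he' : ∀ m < d, row' m = row m := fun m hm => he m (hm.trans_le h.le)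
  refine ⟨h.le, fun m hm => ?_, fun v hv hvc => ?_, fun m hm m' hm' e => ?_⟩
  · rw [he' m hm]; exact h.adj m hm
  · obtain ⟨m, hm, e⟩ := h.surj v hv hvc
    exact ⟨m, hm, by rw [he' m hm, e]⟩
  · rw [he' m hm, he' m' hm'] at e
    exact h.inj m hm m' hm' e

theorem ListsRow.skip {T : SimpleGraph (Fin n)} {u : Fin n} {d : ℕ} {v : Fin n} {row : ℕ → ℕ}
    (h : ListsRow T u v d row) (huv : ¬ T.Adj u v) : ListsRow T u (v + 1) d row := by
  refine ⟨h.le.trans (Nat.le_succ _), fun m hm => ?_, fun v' hv' hlt => ?_, h.inj⟩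
  · obtain ⟨v', h1, h2, h3⟩ := h.adj m hm
    exact ⟨v', h1, h2.trans (Nat.lt_succ_self _), h3⟩
  · refine h.surj v' hv' (lt_of_le_of_ne (Nat.lt_succ_iff.1 hlt) fun e => huv ?_)
    rwa [← Fin.ext e]

theorem ListsRow.push {T : SimpleGraph (Fin n)} {u : Fin n} {d : ℕ} {v : Fin n}
    {row row' : ℕ → ℕ} (h : ListsRow T u v d row) (huv : T.Adj u v)
    (hold : ∀ m < d, row' m = row m) (hnew : row' d = v) :
    ListsRow T u (v + 1) (d + 1) row' := by
  have cases : ∀ m < d + 1, m = d ∨ m < d := fun m hm => by omega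
  have hlt : ∀ m < d, row m < v := fun m hm => by
    obtain ⟨v', -, h2, h3⟩ := h.adj m hm
    omega
  refine ⟨Nat.succ_le_succ h.le, fun m hm => ?_, fun v' hv' hlt' => ?_, fun m hm m' hm' e => ?_⟩
  · rcases cases m hm with rfl | hm
    · exact ⟨v, huv, Nat.lt_succ_self _, hnew⟩
    · obtain ⟨v', h1, h2, h3⟩ := h.adj m hm
      exact ⟨v', h1, h2.trans (Nat.lt_succ_self _), by rw [hold m hm, h3]⟩
  · by_cases he : v'.1 = v
    · exact ⟨d, Nat.lt_succ_self _, by rw [hnew, he]⟩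
    · obtain ⟨m, hm, e⟩ := h.surj v' hv' (by omega)
      exact ⟨m, by omega, by rw [hold m hm, e]⟩
  · rcases cases m hm with rfl | hm <;> rcases cases m' hm' with rfl | hm'
    · rfl
    · have := hlt m' hm'
      rw [hnew, hold m' hm'] at e; omega
    · have := hlt m hm
      rw [hnew, hold m hm] at e; omega
    · rw [hold m hm, hold m' hm'] at e; exact h.inj m hm m' hm' e

/-- The arrays `dg` and `nb` hold the degrees and the lists of neighbours of the vertices. -/
structure DegTable (T : SimpleGraph (Fin n)) (dg nb : ℕ → ℕ) : Prop where
  deg : ∀ u : Fin n, dg u = vdeg T u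
  row : ∀ u : Fin n, ListsRow T u n (vdeg T u) (fun m => nb (u * n + m))

theorem wp_computeDegrees {T : SimpleGraph (Fin n)} {σ : State} (hn : σ.nv size = n) (hn1 : 1 ≤ n)
    (htree : IsAdj (σ.na tree) T) :
    wp computeDegrees (fun t τ => t ≤ 200 * n ^ 2 ∧ τ.nv top = maxDeg T ∧
      DegTable T (τ.na deg) (τ.na nbr)) σ := by
  rw [computeDegrees]
  simp only [block]
  rw [wp_seq, wp_setN]
  refine (wp_for_frame n (n * 45 + 60)
    (fun a ρ => (∀ u : Fin n, u.1 < a →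
        ListsRow T u n (ρ.na deg u) (fun m => ρ.na nbr (u * n + m)) ∧ ρ.na deg u ≤ ρ.nv top) ∧
      (ρ.nv top = 0 ∨ ∃ u : Fin n, u.1 < a ∧ ρ.nv top = ρ.na deg u))
    (by simpa using hn) (by decide) rfl rfl (by simp) ?_).mono ?_
  · intro a ρ hF ha haN ⟨hI, hJ⟩
    have e0 := hF.nv size rfl
    have et := hF.na tree rfl
    simp [hn] at e0 et
    rw [wp_seq, wp_setA, wp_seq]
    refine (wp_for_frame n 36
      (fun c τ => ListsRow T ⟨a, haN⟩ c (τ.na deg a) (fun m => τ.na nbr (a * n + m)) ∧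
        (∀ q ≠ a, τ.na deg q = ρ.na deg q) ∧
        (∀ q ≠ a, ∀ m < n, τ.na nbr (q * n + m) = ρ.na nbr (q * n + m)))
      (by simpa using e0) (by decide) rfl rfl ?_ ?_).frame.mono ?_
    · simp only [NExp.eval, ha, State.setN_na, State.setA_na, if_true,
        Function.update_self]
      refine ⟨⟨by omega, fun m hm => by omega, fun v _ hv => by omega, fun m hm => by omega⟩,
        fun q hq => ?_, fun q hq m _ => by simp⟩
      rw [Function.update_of_ne hq]
    · intro c τ hG hc hcN ⟨h1, h2, h3⟩
      have g1 := hG.nv i rfl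
      have g2 := hG.nv size rfl
      have g3 := hG.na tree rfl
      simp [e0, et, ha] at g1 g2 g3
      have hadj := htree.eq_one_iff ⟨a, haN⟩ ⟨c, hcN⟩
      simp only at hadj
      simp only [wp_when, wp_seq, wp_setA]
      simp [g1, g2, g3, hc, hadj]
      -- At most `c` neighbours come before column `c`, so the new entry has an index below `n` and
      -- does not spill into another row.
      have hd := h1.le
      refine ⟨fun huv => ⟨h1.push (v := ⟨c, hcN⟩) huv (fun m hm => ?_) (by simp),
        fun q hq => ?_, fun q hq m hm => ?_⟩, fun huv => ⟨h1.skip (v := ⟨c, hcN⟩) huv, h2, h3⟩⟩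
      · rw [Function.update_of_ne (by omega)]
      · rw [Function.update_of_ne hq, h2 q hq]
      · rw [Function.update_of_ne, h3 q hq m hm]
        intro e
        exact hq ((cell_inj hm (hd.trans_lt hcN)).1 e).1
    · rintro t τ ⟨⟨ht, h1, h2, h3⟩, hG⟩
      have g1 := hG.nv i rfl
      have g4 := hG.nv top rfl
      simp [ha] at g1 g4
      simp only [wp_when, wp_setN]
      have hrow : ∀ u : Fin n, u.1 < a + 1 →
          ListsRow T u n (τ.na deg u) (fun m => τ.na nbr (u * n + m)) := by
        intro u hu
        by_cases he : u.1 = a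
        · subst he; exact h1
        · rw [h2 u he]
          exact (hI u (by omega)).1.congr fun m hm => h3 u he m hm
      have hle : ∀ u : Fin n, u.1 < a + 1 → u.1 ≠ a → τ.na deg u ≤ ρ.nv top := by
        intro u hu he
        rw [h2 u he]
        exact (hI u (by omega)).2
      simp [g1, g4]
      refine ⟨fun hlt => ⟨by omega, fun u hu => ⟨hrow u (by omega), ?_⟩,
          .inr ⟨⟨a, haN⟩, le_rfl, rfl⟩⟩,
        fun hge => ⟨by omega, fun u hu => ⟨hrow u (by omega), ?_⟩, ?_⟩⟩
      · by_cases he : u.1 = a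
        · rw [he]
        · exact (hle u (by omega) he).trans hlt.le
      · by_cases he : u.1 = a
        · rw [he]; exact hge
        · exact hle u (by omega) he
      · refine hJ.imp_right ?_
        rintro ⟨u, hu, e⟩
        exact ⟨u, hu.le, by rw [e, h2 u hu.ne]⟩
  · rintro t τ ⟨ht, h1, h2⟩
    have hdeg : ∀ u : Fin n, τ.na deg u = vdeg T u := fun u => (h1 u u.2).1.card
    refine ⟨?_, ?_, hdeg, fun u => ?_⟩
    · have hn2 : n ≤ n * n := Nat.le_mul_self n
      simp
      ring_nf at *
      omega
    · have : Nonempty (Fin n) := ⟨⟨0, hn1⟩⟩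
      apply le_antisymm
      · rcases h2 with h2 | ⟨u, -, h2⟩
        · omega
        · rw [h2, hdeg]; exact vdeg_le_maxDeg T u
      · refine maxDeg_le fun v => ?_
        rw [← hdeg v]; exact (h1 v v.2).2
    · rw [← hdeg u]; exact (h1 u u.2).1

end DegTable

end Fischer

namespace Fischer

open SimpleGraph

/-! ### Depth first traversals -/

section Dfs

variable {n : ℕ}

open scoped Classical in
/-- The maximum degree of the ends of the edges labelled `m` on the path from the root `r` to `z`,
and `0` if there are none. -/
noncomputable def pathMax (T : SimpleGraph (Fin n)) (lab : ℕ → ℕ) (r : Fin n) (p : Fin n → Fin n)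
    (z : Fin n) (m : ℕ) : ℕ :=
  (Finset.univ.filter fun x => x ≠ r ∧ (∃ k, p^[k] z = x) ∧ lab (p x * n + x) = m).sup
    fun x => max (vdeg T (p x)) (vdeg T x)

variable {G T : SimpleGraph (Fin n)} {lab : ℕ → ℕ} {r : Fin n} {p : Fin n → Fin n}
  {dp : Fin n → ℕ}

theorem Rooted.pathMax_root (h : Rooted T r p dp) (m : ℕ) : pathMax T lab r p r m = 0 := by
  classical
  rw [pathMax, Finset.filter_false_of_mem]
  · rfl
  · rintro x - ⟨hx, ⟨k, hk⟩, -⟩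
    exact hx (by rw [← hk, h.iterate_root])

/-- The path to `z` is the path to its parent with one more edge. Hence a descent changes a single
cell of `M`, and one saved value is enough to undo it. -/
theorem pathMax_of_ne {z : Fin n} (hz : z ≠ r) (m : ℕ) :
    pathMax T lab r p z m = if m = lab (p z * n + z) then
      max (pathMax T lab r p (p z) m) (max (vdeg T (p z)) (vdeg T z))
      else pathMax T lab r p (p z) m := by
  classical
  have anc : ∀ x, (∃ k, p^[k] z = x) ↔ x = z ∨ ∃ k, p^[k] (p z) = x := by
    intro x
    constructor
    · rintro ⟨k, hk⟩
      cases k with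
      | zero => exact .inl hk.symm
      | succ k => exact .inr ⟨k, hk⟩
    · rintro (rfl | ⟨k, hk⟩)
      · exact ⟨0, rfl⟩
      · exact ⟨k + 1, hk⟩
  split_ifs with h
  · rw [max_comm, pathMax, pathMax,
      ← Finset.sup_insert (f := fun x => max (vdeg T (p x)) (vdeg T x))]
    congr 1
    ext x
    simp only [Finset.mem_filter, Finset.mem_univ, true_and, Finset.mem_insert, anc]
    constructor
    · tauto
    · rintro (rfl | h')
      · exact ⟨hz, .inl rfl, h.symm⟩
      · tauto
  · rw [pathMax, pathMax]
    congr 1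
    ext x
    simp only [Finset.mem_filter, Finset.mem_univ, true_and, anc]
    constructor
    · rintro ⟨h1, rfl | h2, h3⟩
      · exact absurd h3.symm h
      · exact ⟨h1, h2, h3⟩
    · tauto

theorem le_pathMax {x z : Fin n} (hx : x ≠ r) {k : ℕ} (hk : p^[k] z = x) :
    max (vdeg T (p x)) (vdeg T x) ≤ pathMax T lab r p z (lab (p x * n + x)) := by
  classical
  exact Finset.le_sup (f := fun x => max (vdeg T (p x)) (vdeg T x))
    (Finset.mem_filter.2 ⟨Finset.mem_univ x, hx, ⟨k, hk⟩, rfl⟩)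

theorem exists_of_pathMax_pos {z : Fin n} {m : ℕ} (h : 0 < pathMax T lab r p z m) :
    ∃ x, x ≠ r ∧ (∃ k, p^[k] z = x) ∧ lab (p x * n + x) = m ∧
      max (vdeg T (p x)) (vdeg T x) = pathMax T lab r p z m := by
  classical
  have hne : (Finset.univ.filter fun x => x ≠ r ∧ (∃ k, p^[k] z = x) ∧
      lab (p x * n + x) = m).Nonempty := by
    by_contra hcon
    rw [Finset.not_nonempty_iff_eq_empty] at hcon
    rw [pathMax, hcon] at h
    exact lt_irrefl _ h
  obtain ⟨x, hx, he⟩ := Finset.exists_mem_eq_sup _ hne fun x => max (vdeg T (p x)) (vdeg T x)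
  obtain ⟨-, h1, h2, h3⟩ := Finset.mem_filter.1 hx
  exact ⟨x, h1, h2, h3, he.symm⟩

/-- The test made on arrival at `z` fails. -/
def NotEligible (G T : SimpleGraph (Fin n)) (lab : ℕ → ℕ) (L : ℕ) (r : Fin n) (p : Fin n → Fin n)
    (z : Fin n) : Prop :=
  G.Adj r z → ¬ (vdeg T r + 2 ≤ pathMax T lab r p z (lab (r * n + z)) ∧
    vdeg T z + 2 ≤ pathMax T lab r p z (lab (r * n + z)) ∧
    maxDeg T ≤ pathMax T lab r p z (lab (r * n + z)) + L)

/-- The traversal from `r` stands at `c`, having visited the vertices in `D`. -/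
structure Dfs (G T : SimpleGraph (Fin n)) (lab nb : ℕ → ℕ) (L : ℕ) (r : Fin n)
    (p : Fin n → Fin n) (c : Fin n) (D : Finset (Fin n)) (pr pt sv mx : ℕ → ℕ) : Prop where
  root_mem : r ∈ D
  cur_mem : c ∈ D
  par : ∀ z ∈ D, pr z = p z
  up : ∀ z ∈ D, p z ∈ D
  ptr_le : ∀ z ∈ D, pt z ≤ vdeg T z
  explored : ∀ z ∈ D, ∀ m < pt z, ∃ v ∈ D, nb (z * n + m) = Fin.val v
  reached : ∀ z ∈ D, z ≠ r → ∃ m < pt (p z), nb (p z * n + m) = z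
  unfinished : ∀ z ∈ D, pt z < vdeg T z → ∃ k, p^[k] c = z
  max : ∀ m, mx m = pathMax T lab r p c m
  saved : ∀ z ∈ D, z ≠ r → sv z = pathMax T lab r p (p z) (lab (p z * n + z))
  checked : ∀ z ∈ D, z ≠ r → NotEligible G T lab L r p z

open scoped Classical in
/-- The number of entries of lists of neighbours that are still to be read, with an allowance for
vertices not yet visited. -/
noncomputable def unread (T : SimpleGraph (Fin n)) (D : Finset (Fin n)) (pt : ℕ → ℕ) : ℕ :=
  ∑ z : Fin n, if z ∈ D then vdeg T z - pt z else vdeg T z + 2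

namespace Dfs

variable {nb : ℕ → ℕ} {L : ℕ} {c : Fin n} {D : Finset (Fin n)} {pr pt sv mx : ℕ → ℕ}

theorem start (hp : Rooted T r p dp) (hpr : pr r = r) (hpt : pt r = 0) (hmx : ∀ m, mx m = 0) :
    Dfs G T lab nb L r p r {r} pr pt sv mx where
  root_mem := by simp
  cur_mem := by simp
  par := by simp [hpr, hp.root]
  up := by simp [hp.root]
  ptr_le := by simp [hpt]
  explored := by simp [hpt]
  reached := by simp
  unfinished := by simpa using fun _ => ⟨0, rfl⟩
  max m := by rw [hmx, hp.pathMax_root]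
  saved := by simp
  checked := by simp

theorem skip (h : Dfs G T lab nb L r p c D pr pt sv mx) (hlt : pt c < vdeg T c)
    (hnb : nb (c * n + pt c) = p c) :
    Dfs G T lab nb L r p c D pr (Function.update pt c (pt c + 1)) sv mx := by
  have hval : ∀ z : Fin n, Function.update pt c (pt c + 1) z =
      if z = c then pt c + 1 else pt z := fun z => by
    rw [Function.update_apply]; simp only [Fin.ext_iff]
  refine ⟨h.root_mem, h.cur_mem, h.par, h.up, fun z hz => ?_, fun z hz m hm => ?_,
    fun z hz hzr => ?_, fun z hz hlt' => ?_, h.max, h.saved, h.checked⟩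
  · rw [hval]; split_ifs with he
    · subst he; exact hlt
    · exact h.ptr_le z hz
  · rw [hval] at hm; split_ifs at hm with he
    · subst he
      rcases Nat.lt_succ_iff_lt_or_eq.1 hm with h' | rfl
      · exact h.explored z hz m h'
      · exact ⟨_, h.up z hz, hnb⟩
    · exact h.explored z hz m hm
  · obtain ⟨m, hm, e⟩ := h.reached z hz hzr
    refine ⟨m, ?_, e⟩
    rw [hval]; split_ifs with he
    · rw [he] at hm; omega
    · exact hm
  · rw [hval] at hlt'; split_ifs at hlt' with he
    · exact ⟨0, he.symm⟩
    · exact h.unfinished z hz hlt'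

theorem unread_skip (h : Dfs G T lab nb L r p c D pr pt sv mx) (hlt : pt c < vdeg T c) :
    unread T D (Function.update pt c (pt c + 1)) + 1 ≤ unread T D pt := by
  classical
  have : ∀ z : Fin n, (if z ∈ D then vdeg T z - Function.update pt c (pt c + 1) z
      else vdeg T z + 2) + (if z = c then 1 else 0) ≤
      if z ∈ D then vdeg T z - pt z else vdeg T z + 2 := by
    intro z
    rw [Function.update_apply]; simp only [← Fin.ext_iff]
    by_cases he : z = c
    · subst he; simp only [h.cur_mem, if_true]; omega
    · simp [he]
  have hs := Finset.sum_le_sum fun z (_ : z ∈ Finset.univ) => this z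
  simpa [Finset.sum_add_distrib, unread] using hs

/-- A visited child of `c` was entered through an earlier entry of the row of `c`; since the row has
no repetitions, the entry now read cannot name it again. -/
theorem child (h : Dfs G T lab nb L r p c D pr pt sv mx) (hp : Rooted T r p dp)
    (hrow : ListsRow T c n (vdeg T c) fun m => nb (c * n + m)) (hlt : pt c < vdeg T c) :
    ∃ v : Fin n, nb (c * n + pt c) = v ∧ T.Adj c v ∧
      (v ≠ p c → v ∉ D ∧ v ≠ r ∧ p v = c) := by
  obtain ⟨v, hv, -, e⟩ := hrow.adj _ hlt
  refine ⟨v, e, hv, fun hne => ?_⟩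
  rcases hp.edge _ _ hv with ⟨-, h'⟩ | ⟨hvr, hvc⟩
  · exact absurd h'.symm hne
  · refine ⟨fun hvD => ?_, hvr, hvc⟩
    obtain ⟨m, hm, e'⟩ := h.reached v hvD hvr
    rw [hvc] at hm e'
    have := hrow.inj m (hm.trans hlt) _ hlt (e'.trans e.symm)
    omega

theorem descend (h : Dfs G T lab nb L r p c D pr pt sv mx) {v : Fin n} (hlt : pt c < vdeg T c)
    (hnb : nb (c * n + pt c) = v) (hvD : v ∉ D) (hvr : v ≠ r) (hvc : p v = c)
    {mx' : ℕ → ℕ} (hmx' : ∀ m, mx' m = pathMax T lab r p v m)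
    (hv : NotEligible G T lab L r p v) :
    Dfs G T lab nb L r p v (insert v D) (Function.update pr v c)
      (Function.update (Function.update pt c (pt c + 1)) v 0)
      (Function.update sv v (mx (lab (c * n + v)))) mx' := by
  have hcv : c ≠ v := fun e => hvD (e ▸ h.cur_mem)
  have hne : ∀ z ∈ D, z ≠ v := fun z hz e => hvD (e ▸ hz)
  have hnew : Function.update (Function.update pt c (pt c + 1)) (v : ℕ) 0 v = 0 := by simp
  have hold : ∀ z : Fin n, z ≠ v → Function.update (Function.update pt c (pt c + 1)) (v : ℕ) 0 z =
      if z = c then pt c + 1 else pt z := fun z hz => by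
    rw [Function.update_of_ne (fun e => hz (Fin.ext e)), Function.update_apply]
    simp only [Fin.ext_iff]
  refine ⟨by simp [h.root_mem], by simp, fun z hz => ?_, fun z hz => ?_, fun z hz => ?_,
    fun z hz m hm => ?_, fun z hz hzr => ?_, fun z hz hlt' => ?_, hmx', fun z hz hzr => ?_,
    fun z hz hzr => ?_⟩
  all_goals rcases Finset.mem_insert.1 hz with rfl | hzD
  · simp [hvc]
  · rw [Function.update_of_ne (fun e => hne z hzD (Fin.ext e))]; exact h.par z hzD
  · rw [hvc]; exact Finset.mem_insert_of_mem h.cur_mem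
  · exact Finset.mem_insert_of_mem (h.up z hzD)
  · rw [hnew]; exact Nat.zero_le _
  · rw [hold z (hne z hzD)]; split_ifs with he
    · subst he; exact hlt
    · exact h.ptr_le z hzD
  · rw [hnew] at hm; omega
  · rw [hold z (hne z hzD)] at hm
    split_ifs at hm with he
    · subst he
      rcases Nat.lt_succ_iff_lt_or_eq.1 hm with h' | rfl
      · obtain ⟨u, hu, e⟩ := h.explored z hzD m h'
        exact ⟨u, Finset.mem_insert_of_mem hu, e⟩
      · exact ⟨v, Finset.mem_insert_self _ _, hnb⟩
    · obtain ⟨u, hu, e⟩ := h.explored z hzD m hm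
      exact ⟨u, Finset.mem_insert_of_mem hu, e⟩
  · rw [hvc, hold c hcv, if_pos rfl]
    exact ⟨pt c, Nat.lt_succ_self _, hnb⟩
  · obtain ⟨m, hm, e⟩ := h.reached z hzD hzr
    refine ⟨m, ?_, e⟩
    rw [hold _ (hne _ (h.up z hzD))]; split_ifs with he
    · rw [he] at hm; omega
    · exact hm
  · exact ⟨0, rfl⟩
  · rw [hold z (hne z hzD)] at hlt'
    split_ifs at hlt' with he
    · exact ⟨1, by simpa [he] using hvc⟩
    · obtain ⟨k, hk⟩ := h.unfinished z hzD hlt'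
      exact ⟨k + 1, by rw [Function.iterate_succ_apply, hvc, hk]⟩
  · rw [Function.update_self, hvc, h.max]
  · rw [Function.update_of_ne (fun e => hne z hzD (Fin.ext e))]; exact h.saved z hzD hzr
  · exact hv
  · exact h.checked z hzD hzr

/-- One unit is the entry just read and two are the allowance for the new vertex. The surplus
compensates for the depth, which grows by one on a descent. -/
theorem unread_descend (h : Dfs G T lab nb L r p c D pr pt sv mx) {v : Fin n}
    (hlt : pt c < vdeg T c) (hvD : v ∉ D) :
    unread T (insert v D) (Function.update (Function.update pt c (pt c + 1)) v 0) + 3 ≤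
      unread T D pt := by
  classical
  have hcv : c ≠ v := fun e => hvD (e ▸ h.cur_mem)
  have : ∀ z : Fin n, (if z ∈ insert v D then
      vdeg T z - Function.update (Function.update pt c (pt c + 1)) (v : ℕ) 0 z
      else vdeg T z + 2) + ((if z = c then 1 else 0) + (if z = v then 2 else 0)) ≤
      if z ∈ D then vdeg T z - pt z else vdeg T z + 2 := by
    intro z
    rw [Function.update_apply, Function.update_apply]; simp only [← Fin.ext_iff]
    by_cases he : z = v
    · subst he; simp [hvD, hcv.symm]
    · by_cases he' : z = c
      · subst he'; simp only [Finset.mem_insert, h.cur_mem, he, if_true, if_false, or_true]; omega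
      · simp [he, he']
  have hs := Finset.sum_le_sum fun z (_ : z ∈ Finset.univ) => this z
  simp only [Finset.sum_add_distrib, Finset.sum_ite_eq', Finset.mem_univ, if_true] at hs
  exact hs

/-- The row of `c` is exhausted, so every unfinished vertex is a proper ancestor of `c`; restoring
one cell turns the maxima for `c` into those for its parent. -/
theorem ascend (h : Dfs G T lab nb L r p c D pr pt sv mx) (hge : ¬ pt c < vdeg T c) (hcr : c ≠ r)
    {mx' : ℕ → ℕ} (hmx' : ∀ m, mx' m = if m = lab (p c * n + c) then sv c else mx m) :
    Dfs G T lab nb L r p (p c) D pr pt sv mx' := by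
  refine ⟨h.root_mem, h.up c h.cur_mem, h.par, h.up, h.ptr_le, h.explored, h.reached,
    fun z hz hlt => ?_, fun m => ?_, h.saved, h.checked⟩
  · obtain ⟨k, hk⟩ := h.unfinished z hz hlt
    cases k with
    | zero => rw [← hk] at hlt; exact absurd hlt hge
    | succ k => exact ⟨k, hk⟩
  · rw [hmx']
    split_ifs with he
    · rw [he, h.saved c h.cur_mem hcr]
    · rw [h.max, pathMax_of_ne hcr, if_neg he]

/-- Unfinished vertices lie on the path to the current vertex. At the root, with its row exhausted,
none is left; the visited set is then closed under adjacency and hence contains every vertex. -/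
theorem finish (h : Dfs G T lab nb L r p r D pr pt sv mx) (hp : Rooted T r p dp)
    (hT : T.Connected) (hrow : ∀ u : Fin n, ListsRow T u n (vdeg T u) fun m => nb (u * n + m))
    (hge : ¬ pt r < vdeg T r) (z : Fin n) (hz : z ≠ r) : NotEligible G T lab L r p z := by
  refine h.checked z ?_ hz
  have hfull : ∀ u ∈ D, pt u = vdeg T u := by
    intro u hu
    refine le_antisymm (h.ptr_le u hu) (not_lt.1 fun hlt => ?_)
    obtain ⟨k, hk⟩ := h.unfinished u hu hlt
    rw [hp.iterate_root] at hk
    exact hge (hk ▸ hlt)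
  have hcl : ∀ u v, T.Adj u v → u ∈ D → v ∈ D := by
    intro u v huv hu
    obtain ⟨m, hm, e⟩ := (hrow u).surj v huv v.2
    obtain ⟨v', hv', e'⟩ := h.explored u hu m (by rwa [hfull u hu])
    rwa [Fin.ext (e.symm.trans e')]
  obtain ⟨q⟩ := hT.preconnected r z
  have : ∀ a b : Fin n, T.Walk a b → a ∈ D → b ∈ D := by
    intro a b q
    induction q with
    | nil => exact id
    | cons hadj _ ih => exact fun ha => ih (hcl _ _ hadj ha)
  exact this _ _ q h.root_mem

end Dfs

/-- If the traversals from all vertices find nothing, then the tree is locally optimal. -/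
theorem locallyOptimal_of_notEligible {w : Sym2 (Fin n) → ℝ} {L N : ℕ} {W : ℕ → ℝ}
    (hTG : T ≤ G) (hW : ∀ u v : Fin n, G.Adj u v → W (u * n + v) = w s(u, v))
    (hlab : Labeling T W N lab)
    (h : ∀ r, ∃ p dp, Rooted T r p dp ∧ ∀ z, z ≠ r → NotEligible G T lab L r p z) :
    LocallyOptimal G w L T := by
  rintro x y u v hxy huv hr hw ⟨h1, h2, h3⟩
  -- In the traversal from `u`, the edge `xy` lies on the path to `v` and carries the label of `uv`.
  -- The recorded maximum is therefore at least the degree of `x`, and the test at `v` would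
  -- succeed.
  obtain ⟨p, dp, hp, hne⟩ := h u
  obtain ⟨z, hz, hs, hd⟩ : ∃ z, z ≠ u ∧ s(p z, z) = s(x, y) ∧
      vdeg T x ≤ max (vdeg T (p z)) (vdeg T z) := by
    rcases hp.edge _ _ hxy with ⟨hx, e⟩ | ⟨hy, e⟩
    · exact ⟨x, hx, by rw [e, Sym2.eq_swap], le_max_right _ _⟩
    · exact ⟨y, hy, by rw [e], by rw [e]; exact le_max_left _ _⟩
  obtain ⟨k, hk⟩ : ∃ k, p^[k] v = z := by
    by_contra! hcon
    have := hp.reachable hcon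
    rw [hs] at this
    exact hr this
  have hl : lab (u * n + v) = lab (p z * n + z) := by
    rw [hlab.eq_iff _ _ _ _ (hlab.tree _ _ (hp.adj z hz)), hW _ _ huv,
      hW _ _ (hTG (hp.adj z hz)), hw, hs]
  have hle := le_pathMax (T := T) (lab := lab) (p := p) hz hk
  refine hne v huv.ne' huv ?_
  rw [hl]
  exact ⟨by omega, by omega, by omega⟩

/-- A swap, from what the traversal finds. -/
theorem isSwap_of_label {w : Sym2 (Fin n) → ℝ} {L N : ℕ} {W : ℕ → ℝ}
    (hTG : T ≤ G) (hW : ∀ u v : Fin n, G.Adj u v → W (u * n + v) = w s(u, v))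
    (hlab : Labeling T W N lab) (hp : Rooted T r p dp) {c x : Fin n} {d : ℕ} (hrc : G.Adj r c)
    (hx : x ≠ r) {k : ℕ} (hk : p^[k] c = x) (hl : lab (p x * n + x) = lab (r * n + c))
    (hd : vdeg T (p x) = d ∨ vdeg T x = d) (h1 : vdeg T r + 2 ≤ d) (h2 : vdeg T c + 2 ≤ d)
    (h3 : maxDeg T ≤ d + L) :
    IsSwap G w L T (exchange T (p x) x r c) ∧ Labeling (exchange T (p x) x r c) W N lab := by
  have hadj := hp.adj x hx
  have hr := hp.not_reachable hx hk
  have hlt := hlab.tree _ _ hadj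
  have hw : w s(r, c) = w s(p x, x) := by
    rw [← hW _ _ hrc, ← hW _ _ (hTG hadj)]
    exact (hlab.eq_iff _ _ _ _ hlt).1 hl.symm
  refine ⟨?_, hlab.le, fun u v huv => ?_, hlab.eq_iff⟩
  -- Either end of the removed edge may attain the maximum; `IsSwap` names that end first.
  · rcases hd with rfl | rfl
    · exact ⟨p x, x, r, c, hadj, hrc, hr, hw, h1, h2, h3, rfl⟩
    · refine ⟨x, p x, r, c, hadj.symm, hrc, ?_, ?_, h1, h2, h3, ?_⟩
      · rwa [Sym2.eq_swap]
      · rw [hw, Sym2.eq_swap]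
      · rw [exchange, exchange, Sym2.eq_swap]
  · rcases exchange_adj.1 huv with ⟨h, -⟩ | ⟨h, -⟩
    · exact hlab.tree u v h
    · rcases Sym2.eq_iff.1 h with ⟨rfl, rfl⟩ | ⟨rfl, rfl⟩
      · rwa [← hl]
      · have : lab (u * n + v) = lab (v * n + u) := by
          rw [hlab.eq_iff _ _ _ _ (hl ▸ hlt), hW _ _ hrc, hW _ _ hrc.symm, Sym2.eq_swap]
        rw [this, ← hl]; exact hlt

end Dfs

end Fischer

namespace Fischer

open NVar NArr RVar RArr SimpleGraph

/-! ### One round of the local search -/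

section Round

variable {n : ℕ}

/-- The memory during a round on the tree `T`, apart from the array `tree`. -/
structure Env (G T : SimpleGraph (Fin n)) (w : Sym2 (Fin n) → ℝ) (L : ℕ) (σ : State) : Prop where
  size : σ.nv NVar.size = n
  logn : σ.nv NVar.logn = L
  top : σ.nv NVar.top = maxDeg T
  graph : IsAdj (σ.na NArr.graph) G
  wt : ∀ u v : Fin n, G.Adj u v → σ.ra RArr.wt (u * n + v) = w s(u, v)
  labels : Labeling T (σ.ra RArr.wt) (σ.nv numW) (σ.na label)
  table : DegTable T (σ.na deg) (σ.na nbr)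

theorem Env.congr {G T : SimpleGraph (Fin n)} {w : Sym2 (Fin n) → ℝ} {L : ℕ} {σ τ : State}
    (h : Env G T w L σ) (e1 : τ.nv NVar.size = σ.nv NVar.size)
    (e2 : τ.nv NVar.logn = σ.nv NVar.logn) (e3 : τ.nv NVar.top = σ.nv NVar.top)
    (e4 : τ.na NArr.graph = σ.na NArr.graph) (e5 : τ.ra RArr.wt = σ.ra RArr.wt)
    (e6 : τ.nv numW = σ.nv numW) (e7 : τ.na label = σ.na label) (e8 : τ.na deg = σ.na deg)
    (e9 : τ.na nbr = σ.na nbr) : Env G T w L τ :=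
  ⟨e1.trans h.size, e2.trans h.logn, e3.trans h.top, by rw [e4]; exact h.graph,
    by rw [e5]; exact h.wt, by rw [e5, e6, e7]; exact h.labels, by rw [e8, e9]; exact h.table⟩

variable {G T : SimpleGraph (Fin n)} {w : Sym2 (Fin n) → ℝ} {L : ℕ} {r : Fin n}
  {p : Fin n → Fin n} {dp : Fin n → ℕ}

/-- The memory after a swap made from the tree `T`. -/
def Swapped (G T : SimpleGraph (Fin n)) (w : Sym2 (Fin n) → ℝ) (L : ℕ) (σ τ : State) : Prop :=
  ∃ T', IsSwap G w L T T' ∧ IsAdj (τ.na tree) T' ∧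
    Labeling T' (σ.ra wt) (σ.nv numW) (σ.na label)

/-- The entries of the new edge are written last, in agreement with `exchange`, where the new edge
is added after the deletion. -/
theorem isAdj_exchange {f : ℕ → ℕ} (hf : IsAdj f T) {x y u v : Fin n} (huv : u ≠ v) :
    IsAdj (Function.update (Function.update (Function.update (Function.update f
      (x * n + y) 0) (y * n + x) 0) (u * n + v) 1) (v * n + u) 1) (exchange T x y u v) := by
  intro a b
  simp only [Function.update_apply, cell_inj b.2 (Fin.is_lt _), ← Fin.ext_iff, exchange_adj,
    Sym2.eq_iff]
  have h1 := (hf a b).1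
  have h2 := (hf a b).2
  constructor
  · intro h
    grind
  · intro h
    grind

theorem wp_swapEdges (hp : Rooted T r p dp) {σ : State} {c : Fin n} (hE : Env G T w L σ)
    (htree : IsAdj (σ.na tree) T) (hroot : σ.nv root = r) (hcur : σ.nv cur = c) (hrc : r ≠ c)
    (hpar : ∀ k, σ.na par (p^[k] c) = p (p^[k] c))
    (hex : ∃ x, x ≠ r ∧ (∃ k, p^[k] c = x) ∧ σ.na label (p x * n + x) = σ.nv lab ∧
      (vdeg T (p x) = σ.na M (σ.nv lab) ∨ vdeg T x = σ.na M (σ.nv lab))) :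
    wp swapEdges (fun t τ => t ≤ 100 * (dp c + 1) ∧
      ∃ x, x ≠ r ∧ (∃ k, p^[k] c = x) ∧ σ.na label (p x * n + x) = σ.nv lab ∧
      (vdeg T (p x) = σ.na M (σ.nv lab) ∨ vdeg T x = σ.na M (σ.nv lab)) ∧
      IsAdj (τ.na tree) (exchange T (p x) x r c)) σ := by
  obtain ⟨x₀, hx₀, ⟨k₀, hk₀⟩, hl₀, hd₀⟩ := hex
  simp only [swapEdges, block]
  rw [wp_seq, wp_setN, wp_seq, wp_setN]
  -- The climb keeps the suitable vertex `x₀` among the ancestors of the current one, so it stops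
  -- before the root. A suitable edge may be met below `x₀`, hence the separate witness after the
  -- scan.
  refine (wp_loop_frame (fun B ρ =>
    (ρ.nv scanning = 1 ∧ IsAdj (ρ.na tree) T ∧ ∃ y : Fin n, ρ.nv x = y ∧ (∃ k, p^[k] c = y) ∧
      (∃ k, p^[k] y = x₀) ∧ B = 90 * (dp y + 1)) ∨
    (ρ.nv scanning = 0 ∧ B = 0 ∧ ∃ x, x ≠ r ∧ (∃ k, p^[k] c = x) ∧
      σ.na label (p x * n + x) = σ.nv lab ∧
      (vdeg T (p x) = σ.na M (σ.nv lab) ∨ vdeg T x = σ.na M (σ.nv lab)) ∧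
      IsAdj (ρ.na tree) (exchange T (p x) x r c))) ?_
    (.inl ⟨by simp, by simpa using htree, c, by simp [hcur], ⟨0, rfl⟩, ⟨k₀, hk₀⟩, rfl⟩)).mono ?_
  · rintro B ρ hF hI hc
    rcases hI with ⟨hs, ht, y, hy, ⟨k, hk⟩, ⟨k', hk'⟩, rfl⟩ | ⟨hs, -⟩
    swap
    · simp [hs] at hc
    have e1 := hF.na par rfl
    have e2 := hF.na label rfl
    have e3 := hF.na deg rfl
    have e4 := hF.na M rfl
    have e5 := (hF.nv size rfl)
    have e6 := hF.nv root rfl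
    have e7 := hF.nv cur rfl
    have e8 := hF.nv lab rfl
    simp [hE.size, hroot, hcur] at e1 e2 e3 e4 e5 e6 e7 e8
    have hpy : σ.na par y = p y := by rw [← hk]; exact hpar k
    have hyr : y ≠ r := by
      rintro rfl
      exact hx₀ (by rw [← hk', hp.iterate_root])
    rw [wp_seq, wp_setN, wp_ite]
    refine ⟨fun hc => ?_, fun hc => ?_⟩
    · simp [e1, e2, e3, e4, e5, e8, hy, hpy, hE.table.deg] at hc
      simp only [wp_seq, wp_setN, wp_setA]
      refine ⟨0, .inr ⟨by simp, rfl, y, hyr, ⟨k, hk⟩, hc.1, hc.2, ?_⟩, ?_⟩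
      · simpa [e1, e5, e6, e7, hy, hpy] using isAdj_exchange ht hrc
      · simp; omega
    · simp [e1, e2, e3, e4, e5, e8, hy, hpy, hE.table.deg] at hc
      rw [wp_setN]
      refine ⟨90 * (dp (p y) + 1), .inl ⟨by simpa using hs, by simpa using ht, p y,
        by simp [e1, hy, hpy], ⟨k + 1, by rw [Function.iterate_succ_apply', hk]⟩, ?_, rfl⟩, ?_⟩
      · cases k' with
        | zero =>
          obtain rfl : y = x₀ := hk'
          have := hc hl₀
          tauto
        | succ k' => exact ⟨k', hk'⟩
      · have := hp.depth y hyr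
        simp
        omega
  · rintro t τ ⟨B, hI, hc, ht⟩
    rcases hI with ⟨hs, -⟩ | ⟨hs, rfl, h⟩
    · simp [hs] at hc
    · refine ⟨?_, h⟩
      simp at ht ⊢
      omega

theorem wp_checkSwap (hTG : T ≤ G) (hp : Rooted T r p dp) {σ : State} {c : Fin n}
    (hE : Env G T w L σ) (htree : IsAdj (σ.na tree) T) (hroot : σ.nv root = r)
    (hcur : σ.nv cur = c) (hpar : ∀ k, σ.na par (p^[k] c) = p (p^[k] c))
    (hM : ∀ m, σ.na M m = pathMax T (σ.na label) r p c m) :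
    wp checkSwap (fun t τ =>
      (t ≤ 50 ∧ NotEligible G T (σ.na label) L r p c ∧ τ.na = σ.na ∧
        ∀ v, v ≠ lab → τ.nv v = σ.nv v) ∨
      (t ≤ 100 * (dp c + 1) + 60 ∧ Swapped G T w L σ τ ∧ τ.nv found = 1 ∧ τ.nv walking = 0)) σ := by
  have hadj := hE.graph.eq_one_iff r c
  simp only [checkSwap, block, wp_seq, wp_setN, wp_when]
  simp [hroot, hcur, hE.size, hadj, hM, hE.top, hE.logn, hE.table.deg]
  refine ⟨fun hrc => ⟨fun h1 h2 h3 => ?_, fun h => .inl ⟨fun _ => ?_, ?_⟩⟩,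
    fun hrc => .inl fun h => absurd h hrc⟩
  -- The test makes the maximum positive, so it is attained by an edge of the path and is not the
  -- default of an empty maximum.
  · obtain ⟨x, hx, hk, hl, hd⟩ := exists_of_pathMax_pos (lt_of_le_of_lt (Nat.zero_le _) h1)
    have hd' : vdeg T (p x) = pathMax T (σ.na label) r p c (σ.na label (r * n + c)) ∨
        vdeg T x = pathMax T (σ.na label) r p c (σ.na label (r * n + c)) := by
      rcases max_choice (vdeg T (p x)) (vdeg T x) with h | h <;> rw [h] at hd <;> tauto
    refine (wp_swapEdges (c := c) (σ := σ.setN lab (σ.na label (r * n + c))) hp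
      (hE.congr rfl rfl rfl rfl rfl rfl rfl rfl rfl)
      (by simpa using htree) (by simpa using hroot) (by simpa using hcur) hrc.ne
      (by simpa using hpar) ⟨x, hx, hk, by simpa using hl, by simpa [hM] using hd'⟩).mono ?_
    rintro t τ ⟨ht, y, hy, ⟨k, hk⟩, hl', hd', hA⟩
    simp [hM] at hl' hd'
    obtain ⟨s1, s2⟩ := isSwap_of_label hTG hE.wt hE.labels hp hrc hy hk hl' hd' h1 h2 h3
    exact .inr ⟨by omega, _, s1, by simpa using hA, s2⟩
  · rintro ⟨h1, h2, h3⟩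
    have := h h1 h2
    omega
  · intro v hv
    simp [hv]

theorem wp_raise {e : NExp} {σ : State} :
    wp (.when (.lt (.get M pos) e) (.setA M pos e)) (fun t τ => t ≤ 2 * e.cost + 7 ∧
      τ = σ.setA M (σ.nv pos) (max (σ.na M (σ.nv pos)) (e.eval σ))) σ := by
  simp only [wp_when, wp_setA]
  simp
  refine ⟨fun h => ⟨by omega, ?_⟩, fun h => ⟨by omega, ?_⟩⟩
  · rw [max_eq_right h.le]
  · rw [max_eq_left h, State.setA, Function.update_eq_self, Function.update_eq_self]

/-- The state of the traversal in memory. -/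
def Walking (G T : SimpleGraph (Fin n)) (L : ℕ) (r : Fin n) (p : Fin n → Fin n) (σ : State)
    (c : Fin n) (D : Finset (Fin n)) (ρ : State) : Prop :=
  ρ.nv walking = 1 ∧ ρ.nv found = 0 ∧ ρ.nv cur = c ∧ IsAdj (ρ.na tree) T ∧
    Dfs G T (σ.na label) (σ.na nbr) L r p c D (ρ.na par) (ρ.na ptr) (ρ.na sav) (ρ.na M)

/-- The memory after a traversal. -/
def Walked (G T : SimpleGraph (Fin n)) (w : Sym2 (Fin n) → ℝ) (L : ℕ) (r : Fin n)
    (p : Fin n → Fin n) (σ τ : State) : Prop :=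
  (τ.nv found = 1 ∧ Swapped G T w L σ τ) ∨
    (τ.nv found = 0 ∧ IsAdj (τ.na tree) T ∧ ∀ z, z ≠ r → NotEligible G T (σ.na label) L r p z)

theorem unread_le (hT : T.IsTree) (r : Fin n) (pt : ℕ → ℕ) : unread T {r} pt ≤ 4 * n := by
  classical
  have h := sum_vdeg hT
  rw [Fintype.card_fin] at h
  calc unread T {r} pt ≤ ∑ z : Fin n, (vdeg T z + 2) := Finset.sum_le_sum fun z _ => by
        split_ifs <;> omega
    _ = ∑ z : Fin n, vdeg T z + 2 * n := by simp [Finset.sum_add_distrib, mul_comm]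
    _ ≤ 4 * n := by omega

end Round

end Fischer

namespace Fischer

open NVar NArr RVar RArr SimpleGraph

/-! ### Correctness and linear running time of a traversal -/

section Traverse

variable {n : ℕ} {G T : SimpleGraph (Fin n)} {w : Sym2 (Fin n) → ℝ} {L : ℕ} {r : Fin n}
  {p : Fin n → Fin n} {dp : Fin n → ℕ}

/-- A cut: the explicit memory state is replaced by the facts about it that matter from then on. -/
theorem wp_of {s : Stmt} {Q : ℕ → State → Prop} {σ : State} (P : State → Prop) (h : P σ)
    (hP : ∀ τ, P τ → wp s Q τ) : wp s Q σ :=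
  hP σ h

/-- A graph edge whose weight does not occur in the tree is labelled `numW`, and its test reads that
cell of `M`. It must hold zero for the test to fail, yet a traversal clears only the cells before
it; hence the invariant that `M` vanishes from `numW` on. -/
theorem pathMax_eq_zero (hp : Rooted T r p dp) {W : ℕ → ℝ} {N : ℕ} {lab : ℕ → ℕ}
    (hlab : Labeling T W N lab) {m : ℕ} (hm : N ≤ m) (z : Fin n) : pathMax T lab r p z m = 0 := by
  by_contra h
  obtain ⟨x, hx, -, hl, -⟩ := exists_of_pathMax_pos (Nat.pos_of_ne_zero h)
  have := hlab.tree _ _ (hp.adj x hx)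
  omega

theorem Dfs.iterate_mem {lab nb : ℕ → ℕ} {c : Fin n} {D : Finset (Fin n)} {pr pt sv mx : ℕ → ℕ}
    (h : Dfs G T lab nb L r p c D pr pt sv mx) {z : Fin n} (hz : z ∈ D) (k : ℕ) :
    p^[k] z ∈ D := by
  induction k generalizing z with
  | zero => exact hz
  | succ k ih => exact ih (h.up z hz)

theorem Swapped.congr {σ σ' τ : State} (h : Swapped G T w L σ τ)
    (e1 : σ'.ra wt = σ.ra wt) (e2 : σ'.nv numW = σ.nv numW) (e3 : σ'.na label = σ.na label) :
    Swapped G T w L σ' τ := by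
  unfold Swapped at *
  rwa [e1, e2, e3]

theorem wp_traverse (hTG : T ≤ G) (hT : T.IsTree) (hp : Rooted T r p dp) (hdp : ∀ v, dp v < n)
    {σ : State} (hE : Env G T w L σ) (htree : IsAdj (σ.na tree) T) (hroot : σ.nv root = r)
    (hfound : σ.nv found = 0) (hN : σ.nv numW ≤ n) (hM : ∀ m, σ.nv numW ≤ m → σ.na M m = 0) :
    wp traverse (fun t τ => t ≤ 3000 * n ∧ Walked G T w L r p σ τ ∧
      ∀ m, σ.nv numW ≤ m → τ.na M m = 0) σ := by
  have hn1 : 1 ≤ n := by have := r.2; omega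
  simp only [traverse, block]
  rw [wp_seq]
  refine (wp_for_frame (σ.nv numW) 4
    (fun a ρ => ∀ m, (m < a ∨ σ.nv numW ≤ m) → ρ.na M m = 0) rfl (by decide) rfl rfl
    (by simpa using hM) ?_).frame.mono ?_
  · intro a ρ hF ha haN hI
    simp only [wp_setA]
    simp [ha]
    intro m hm
    rw [Function.update_apply]
    split_ifs with he
    · rfl
    · exact hI m (by omega)
  rintro t₁ τ₁ ⟨⟨ht₁, hM₁⟩, hF₁⟩
  have hM₁' : ∀ m, τ₁.na M m = 0 := fun m => hM₁ m (by omega)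
  clear hM₁
  rw [wp_seq, wp_setA, wp_seq, wp_setA, wp_seq, wp_setN, wp_seq, wp_setN]
  have hroot₁ : τ₁.nv root = r := (hF₁.nv _ rfl).trans hroot
  have hfound₁ : τ₁.nv found = 0 := (hF₁.nv _ rfl).trans hfound
  have htree₁ : IsAdj (τ₁.na tree) T := by rw [hF₁.na _ rfl]; exact htree
  have hE₁ : Env G T w L τ₁ := hE.congr (hF₁.nv _ rfl) (hF₁.nv _ rfl) (hF₁.nv _ rfl)
    (hF₁.na _ rfl) (hF₁.ra _ rfl) (hF₁.nv _ rfl) (hF₁.na _ rfl) (hF₁.na _ rfl) (hF₁.na _ rfl)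
  have hw₁ := hF₁.ra wt rfl
  have hnw₁ := hF₁.nv numW rfl
  have hl₁ := hF₁.na label rfl
  have hnb₁ := hF₁.na nbr rfl
  refine wp_of (fun τ => Walking G T L r p σ r {r} τ ∧ Env G T w L τ ∧ τ.nv root = r ∧
    τ.ra wt = σ.ra wt ∧ τ.nv numW = σ.nv numW ∧ τ.na label = σ.na label ∧ τ.na nbr = σ.na nbr)
    ⟨⟨by simp, by simp [hfound₁], by simp [hroot₁], by simpa using htree₁,
      Dfs.start hp (by simp [hroot₁]) (by simp [hroot₁]) (by simpa using hM₁')⟩,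
      hE₁.congr rfl rfl rfl rfl rfl rfl rfl rfl rfl, by simpa using hroot₁, by simpa using hw₁,
      by simpa using hnw₁, by simpa using hl₁, by simpa using hnb₁⟩ ?_
  clear hroot₁ hfound₁ htree₁ hE₁ hw₁ hnw₁ hl₁ hnb₁ hM₁'
  rintro τ₂ ⟨hW₂, hE₂, hr₂, hw₂, hnw₂, hl₂, hnb₂⟩
  -- Unread entries plus depth fall by at least one in every turn that continues the traversal:
  -- reading an entry lowers the first, an ascent the second. The reserve of `100 * n + 300` pays
  -- for the single climb made if a swap is found.
  refine (wp_loop_frame (fun B ρ =>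
    (∃ c D, Walking G T L r p σ c D ρ ∧
      B = 300 * (unread T D (ρ.na ptr) + dp c + 1) + (100 * n + 300)) ∨
    (ρ.nv walking = 0 ∧ Walked G T w L r p σ ρ ∧ (∀ m, σ.nv numW ≤ m → ρ.na M m = 0) ∧ B = 0))
    ?_ (.inl ⟨r, {r}, hW₂, rfl⟩)).mono ?_
  · rintro B ρ hF hI hc
    rcases hI with ⟨c, D, ⟨hw, hf, hcur, ht, hD⟩, rfl⟩ | ⟨hw, -⟩
    swap
    · simp [hw] at hc
    clear hc
    have hEρ : Env G T w L ρ := hE₂.congr (hF.nv _ rfl) (hF.nv _ rfl) (hF.nv _ rfl)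
      (hF.na _ rfl) (hF.ra _ rfl) (hF.nv _ rfl) (hF.na _ rfl) (hF.na _ rfl) (hF.na _ rfl)
    have hroot := (hF.nv root rfl).trans hr₂
    have hwt := (hF.ra wt rfl).trans hw₂
    have hnw := (hF.nv numW rfl).trans hnw₂
    have hlab := (hF.na label rfl).trans hl₂
    have hnb := (hF.na nbr rfl).trans hnb₂
    have hdeg := hEρ.table.deg
    have hrows := hEρ.table.row
    have hlabels := hEρ.labels
    have hsize := hEρ.size
    rw [hnb] at hrows
    rw [hwt, hnw, hlab] at hlabels
    rw [wp_ite]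
    refine ⟨fun hlt => ?_, fun hge => ?_⟩
    · simp only [BExp.holds, NExp.eval, hcur, hdeg] at hlt
      obtain ⟨v, hv, hadj, hchild⟩ := hD.child hp (hrows c) hlt
      rw [wp_seq, wp_setN, wp_seq, wp_setA, wp_when]
      refine ⟨fun hne => ?_, fun heq => ?_⟩
      · simp [hcur, hsize, hnb, hv, hD.par c hD.cur_mem, ← Fin.ext_iff] at hne
        obtain ⟨hvD, hvr, hvc⟩ := hchild hne
        have hdv := hp.depth v hvr
        rw [hvc] at hdv
        have hdn := hdp v
        rw [wp_seq, wp_setN, wp_seq, wp_setA, wp_seq]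
        refine wp_raise.mono ?_
        rintro t₃ _ ⟨ht₃, rfl⟩
        rw [wp_seq]
        refine wp_raise.mono ?_
        rintro t₄ _ ⟨ht₄, rfl⟩
        rw [wp_seq, wp_setA, wp_seq, wp_setA, wp_seq, wp_setN]
        refine wp_of (fun τ => τ.nv cur = v ∧ τ.na par = Function.update (ρ.na par) v c ∧
          τ.na ptr = Function.update (Function.update (ρ.na ptr) c (ρ.na ptr c + 1)) v 0 ∧
          τ.na sav = Function.update (ρ.na sav) v (ρ.na M (σ.na label (c * n + v))) ∧
          (∀ m, τ.na M m = pathMax T (σ.na label) r p v m) ∧ τ.na tree = ρ.na tree ∧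
          (∀ u, u ≠ nxt → u ≠ pos → u ≠ cur → τ.nv u = ρ.nv u) ∧
          (∀ a, a ≠ par → a ≠ ptr → a ≠ sav → a ≠ M → τ.na a = ρ.na a) ∧ τ.ra = ρ.ra)
          ?_ ?_
        · refine ⟨?_, ?_, ?_, ?_, fun m => ?_, ?_, ?_, ?_, ?_⟩
          · simp [hcur, hsize, hnb, hv]
          · simp [hcur, hsize, hnb, hv]
          · simp [hcur, hsize, hnb, hv]
          · simp [hcur, hsize, hnb, hv, hlab]
          · simp [hcur, hsize, hnb, hv, hlab, hdeg, hD.max]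
            rw [pathMax_of_ne hvr, hvc, Function.update_apply]
            simp only [hD.max]
            split_ifs with he
            · rw [he]
            · rfl
          · simp
          · intro u h1 h2 h3
            simp [h1, h2, h3]
          · intro a h1 h2 h3 h4
            simp [h1, h2, h3, h4]
          · simp
        · rintro τ ⟨g1, g2, g3, g4, g5, g6, g7, g8, g9⟩
          have hEτ : Env G T w L τ := hEρ.congr (g7 _ (by decide) (by decide) (by decide))
            (g7 _ (by decide) (by decide) (by decide)) (g7 _ (by decide) (by decide) (by decide))
            (g8 _ (by decide) (by decide) (by decide) (by decide)) (by rw [g9])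
            (g7 _ (by decide) (by decide) (by decide))
            (g8 _ (by decide) (by decide) (by decide) (by decide))
            (g8 _ (by decide) (by decide) (by decide) (by decide))
            (g8 _ (by decide) (by decide) (by decide) (by decide))
          have hlabτ : τ.na label = σ.na label :=
            (g8 _ (by decide) (by decide) (by decide) (by decide)).trans hlab
          refine (wp_checkSwap (c := v) hTG hp hEτ (by rw [g6]; exact ht)
            ((g7 _ (by decide) (by decide) (by decide)).trans hroot) g1 ?_
            (by rw [hlabτ]; exact g5)).frame.mono ?_
          · intro k
            rw [g2]
            cases k with
            | zero => simp [hvc]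
            | succ k =>
              rw [Function.iterate_succ_apply, hvc]
              have hm := hD.iterate_mem hD.cur_mem k
              rw [Function.update_of_ne, hD.par _ hm]
              exact fun e => hvD (Fin.ext e ▸ hm)
          · rintro t₅ τ₅ ⟨h, hG⟩
            rcases h with ⟨ht₅, hne', ena, env⟩ | ⟨ht₅, hS, hf₅, hw₅⟩
            · rw [hlabτ] at hne'
              have hu := hD.unread_descend hlt hvD
              refine ⟨300 * (unread T (insert v D) (τ₅.na ptr) + dp v + 1) + (100 * n + 300),
                .inl ⟨v, insert v D, ⟨?_, ?_, ?_, ?_, ?_⟩, rfl⟩, ?_⟩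
              · rw [env _ (by decide), g7 _ (by decide) (by decide) (by decide), hw]
              · rw [env _ (by decide), g7 _ (by decide) (by decide) (by decide), hf]
              · rw [env _ (by decide), g1]
              · rw [ena, g6]; exact ht
              · rw [ena, g2, g3, g4]
                exact hD.descend hlt hv hvD hvr hvc g5 hne'
              · rw [ena, g3]
                simp at ht₃ ht₄ ⊢
                omega
            · refine ⟨0, .inr ⟨hw₅, .inl ⟨hf₅, hS.congr ?_ ?_ hlabτ.symm⟩, fun m hm => ?_, rfl⟩,
                ?_⟩
              · rw [g9, hwt]
              · rw [g7 _ (by decide) (by decide) (by decide), hnw]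
              · rw [hG.na M rfl, g5]
                exact pathMax_eq_zero hp hlabels hm v
              · simp at ht₃ ht₄ ⊢
                omega
      · simp [hcur, hsize, hnb, hv, hD.par c hD.cur_mem, ← Fin.ext_iff] at heq
        have hu := hD.unread_skip hlt
        refine ⟨_, .inl ⟨c, D, ⟨by simpa using hw, by simpa using hf, by simpa using hcur,
          by simpa using ht, ?_⟩, rfl⟩, ?_⟩
        · simpa [hcur] using hD.skip hlt (by rw [hv, heq])
        · simp [hcur]
          omega
    · simp only [BExp.holds, NExp.eval, hcur, hdeg] at hge
      rw [wp_ite]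
      refine ⟨fun heq => ?_, fun hne => ?_⟩
      · simp [hcur, hroot, ← Fin.ext_iff] at heq
        subst heq
        rw [wp_setN]
        refine ⟨0, .inr ⟨by simp, .inr ⟨by simpa using hf, by simpa using ht,
          hD.finish hp hT.connected hrows hge⟩, fun m hm => ?_, rfl⟩, ?_⟩
        · simp [hD.max, pathMax_eq_zero hp hlabels hm]
        · simp
          omega
      · simp [hcur, hroot, ← Fin.ext_iff] at hne
        have hd := hp.depth c hne
        rw [wp_seq, wp_setA, wp_setN]
        refine ⟨_, .inl ⟨p c, D, ⟨by simpa using hw, by simpa using hf,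
          by simp [hcur, hD.par c hD.cur_mem], by simpa using ht,
          hD.ascend hge hne fun m => ?_⟩, rfl⟩, ?_⟩
        · simp [hcur, hsize, hD.par c hD.cur_mem, hlab, Function.update_apply]
        · simp
          omega
  · rintro t τ ⟨B, hI, hc, ht⟩
    rcases hI with ⟨c, D, ⟨hw, -⟩, -⟩ | ⟨hw, hW, hM', rfl⟩
    · simp [hw] at hc
    · refine ⟨?_, hW, hM'⟩
      have hu := unread_le hT r (τ₂.na ptr)
      have h0 := hp.depth_root
      simp at ht ⊢
      omega

end Traverse

end Fischer

namespace Fischer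

open NVar NArr RVar RArr SimpleGraph

/-! ### Rounds and the whole local search -/

section LocalSearch

variable {n : ℕ} {G T : SimpleGraph (Fin n)} {w : Sym2 (Fin n) → ℝ} {L : ℕ}

theorem wp_round (hT : IsMWST G w T) {σ : State} (hsize : σ.nv size = n)
    (hlogn : σ.nv logn = L) (hgraph : IsAdj (σ.na graph) G)
    (hwt : ∀ u v : Fin n, G.Adj u v → σ.ra wt (u * n + v) = w s(u, v))
    (hlab : Labeling T (σ.ra wt) (σ.nv numW) (σ.na label)) (htree : IsAdj (σ.na tree) T)
    (hN : σ.nv numW ≤ n) (hM : ∀ m, σ.nv numW ≤ m → σ.na M m = 0) :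
    wp round (fun t τ => t ≤ 4000 * n ^ 2 ∧ (∀ m, σ.nv numW ≤ m → τ.na M m = 0) ∧
      ((τ.nv found = 1 ∧ Swapped G T w L σ τ) ∨
        (τ.nv found = 0 ∧ IsAdj (τ.na tree) T ∧ LocallyOptimal G w L T))) σ := by
  have hn1 : 1 ≤ n := by
    have := hT.1.2.connected.nonempty
    exact Fin.pos_iff_nonempty.2 this
  simp only [round, block]
  rw [wp_seq]
  refine (wp_computeDegrees hsize hn1 htree).frame.mono ?_
  rintro t₁ τ₁ ⟨⟨ht₁, htop, htab⟩, hF₁⟩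
  rw [wp_seq, wp_setN, wp_seq, wp_setN]
  have hE₁ : Env G T w L τ₁ := ⟨(hF₁.nv _ rfl).trans hsize, (hF₁.nv _ rfl).trans hlogn, htop,
    by rw [hF₁.na _ rfl]; exact hgraph, by rw [hF₁.ra _ rfl]; exact hwt,
    by rw [hF₁.na label rfl, hF₁.ra wt rfl, hF₁.nv numW rfl]; exact hlab, htab⟩
  have hw₁ := hF₁.ra wt rfl
  have hnw₁ := hF₁.nv numW rfl
  have hl₁ := hF₁.na label rfl
  have hM₁ := hF₁.na M rfl
  have htr₁ := hF₁.na tree rfl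
  refine (wp_loop_frame (fun B ρ => (∀ m, σ.nv numW ≤ m → ρ.na M m = 0) ∧
    ((ρ.nv found = 1 ∧ Swapped G T w L σ ρ ∧ B = 0) ∨
      (ρ.nv found = 0 ∧ IsAdj (ρ.na tree) T ∧ ∃ a ≤ n, ρ.nv root = a ∧
        (∀ r : Fin n, r.1 < a → ∃ p dp, Rooted T r p dp ∧
          ∀ z, z ≠ r → NotEligible G T (σ.na label) L r p z) ∧
        B = (n - a) * (3000 * n + 50)))) ?_
    ⟨by simpa [hM₁] using hM, .inr ⟨by simp, by simpa [htr₁] using htree, 0, Nat.zero_le _,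
      by simp, by simp, rfl⟩⟩).frame.mono ?_
  · rintro B ρ hF ⟨hM', hI⟩ hc
    rcases hI with ⟨hf, -⟩ | ⟨hf, ht, a, ha, hroot, hall, rfl⟩
    · simp [hf] at hc
    have hEρ : Env G T w L ρ := hE₁.congr (hF.nv _ rfl) (hF.nv _ rfl) (hF.nv _ rfl)
      (hF.na _ rfl) (hF.ra _ rfl) (hF.nv _ rfl) (hF.na _ rfl) (hF.na _ rfl) (hF.na _ rfl)
    have hw' := (hF.ra wt rfl).trans hw₁
    have hnw' := (hF.nv numW rfl).trans hnw₁
    have hl' := (hF.na label rfl).trans hl₁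
    simp [hroot, hEρ.size, hf] at hc
    obtain ⟨p, dp, hp, hdp⟩ := exists_rooted hT.1.2 (⟨a, hc⟩ : Fin n)
    rw [wp_seq]
    refine (wp_traverse hT.1.1 hT.1.2 hp (fun v => by simpa using hdp v) hEρ ht hroot hf
      (by rw [hnw']; exact hN) (by rw [hnw']; exact hM')).frame.mono ?_
    rintro t τ ⟨⟨ht', hW, hMτ⟩, hG⟩
    rw [wp_setN]
    rw [hnw'] at hMτ
    obtain ⟨d, rfl⟩ : ∃ d, n = a + 1 + d := ⟨n - (a + 1), by omega⟩
    rcases hW with ⟨hf', hS⟩ | ⟨hf', hA, hne⟩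
    · refine ⟨0, ⟨by simpa using hMτ, .inl ⟨by simpa using hf', ?_, rfl⟩⟩, ?_⟩
      · obtain ⟨T', h1, h2, h3⟩ := hS
        exact ⟨T', h1, by simpa using h2, by rw [← hw', ← hnw', ← hl']; exact h3⟩
      · have e2 : a + 1 + d - a = d + 1 := by omega
        rw [e2, Nat.add_mul]
        simp
        omega
    · have hr' := (hG.nv root rfl).trans hroot
      refine ⟨(a + 1 + d - (a + 1)) * (3000 * (a + 1 + d) + 50), ⟨by simpa using hMτ, .inr
        ⟨by simpa using hf', by simpa using hA, a + 1, hc, by simp [hr'], fun r hr => ?_, rfl⟩⟩,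
        ?_⟩
      · by_cases he : r.1 = a
        · obtain rfl : r = ⟨a, hc⟩ := Fin.ext he
          exact ⟨p, dp, hp, by rw [← hl']; exact hne⟩
        · exact hall r (by omega)
      · have e1 : a + 1 + d - (a + 1) = d := by omega
        have e2 : a + 1 + d - a = d + 1 := by omega
        rw [e1, e2, Nat.add_mul]
        simp
        omega
  · rintro t τ ⟨⟨B, ⟨hM', hI⟩, hc, ht⟩, hG⟩
    have hn2 : n ≤ n * n := Nat.le_mul_self n
    refine ⟨?_, hM', ?_⟩
    · simp at ht ⊢
      ring_nf at *
      omega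
    · rcases hI with ⟨hf, hS, -⟩ | ⟨hf, hA, a, ha, hroot, hall, -⟩
      · exact .inl ⟨hf, hS⟩
      · refine .inr ⟨hf, hA, locallyOptimal_of_notEligible hT.1.1 hwt hlab fun r => hall r ?_⟩
        have hs := hG.nv size rfl
        simp [hE₁.size] at hs
        simp [hroot, hs, hf] at hc
        exact r.2.trans_le hc

theorem wp_localSearch {b : ℝ} (hT : IsMWST G w T) {σ : State} (hsize : σ.nv size = n)
    (hbase : σ.rv base = b) (hL : (n : ℝ) ≤ b ^ L) (hlt : ∀ m < L, b ^ m < n)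
    (hgraph : IsAdj (σ.na graph) G)
    (hwt : ∀ u v : Fin n, G.Adj u v → σ.ra wt (u * n + v) = w s(u, v))
    (htree : IsAdj (σ.na tree) T) (hM : ∀ m, σ.na M m = 0) :
    wp localSearch (fun t τ =>
      (t : ℝ) ≤ 16 * (L + 1) + 1000 * n ^ 3 + 5000 * n ^ 2 * (swapBound L T + 1) + 20 ∧
      ∃ T', IsAdj (τ.na tree) T' ∧ IsMWST G w T' ∧ LocallyOptimal G w L T') σ := by
  have hn1 : 1 ≤ n := by
    have := hT.1.2.connected.nonempty
    exact Fin.pos_iff_nonempty.2 this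
  have hn2 : 1 ≤ n ^ 2 := Nat.one_le_pow _ _ hn1
  simp only [localSearch, block]
  rw [wp_seq]
  refine (wp_computeLog hbase hsize hL hlt).frame.mono ?_
  rintro t₁ τ₁ ⟨⟨ht₁, hlog⟩, hF₁⟩
  rw [wp_seq]
  refine (wp_labelWeights (T := T) (w := w) ((hF₁.nv _ rfl).trans hsize) hT.1.2
    (by rw [hF₁.na _ rfl]; exact htree)
    (by rw [hF₁.ra _ rfl]; exact fun u v h => hwt u v (hT.1.1 h))).frame.mono ?_
  rintro t₂ τ₂ ⟨⟨ht₂, hN, hlab⟩, hF₂⟩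
  rw [wp_seq, wp_setN]
  have g1 : τ₂.nv size = n := (hF₂.nv _ rfl).trans ((hF₁.nv _ rfl).trans hsize)
  have g2 : τ₂.nv logn = L := (hF₂.nv _ rfl).trans hlog
  have g3 : IsAdj (τ₂.na graph) G := by rw [hF₂.na _ rfl, hF₁.na _ rfl]; exact hgraph
  have g5 : τ₂.ra wt = σ.ra wt := (hF₂.ra _ rfl).trans (hF₁.ra _ rfl)
  have g6 : IsAdj (τ₂.na tree) T := by rw [hF₂.na _ rfl, hF₁.na _ rfl]; exact htree
  have g7 : ∀ m, τ₂.na M m = 0 := by rw [hF₂.na _ rfl, hF₁.na _ rfl]; exact hM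
  rw [← hF₂.ra wt rfl] at hlab
  -- Loop budgets are natural numbers, so the real bound is rounded up. The one added to `swapBound`
  -- pays for the last round, which makes no swap.
  obtain ⟨K, hK⟩ : ∃ K : ℕ, K = ⌈5000 * (n : ℝ) ^ 2 * (swapBound L T + 1)⌉₊ := ⟨_, rfl⟩
  have hK1 : 5000 * (n : ℝ) ^ 2 * (swapBound L T + 1) ≤ K := hK ▸ Nat.le_ceil _
  have hK2 : (K : ℝ) < 5000 * (n : ℝ) ^ 2 * (swapBound L T + 1) + 1 := by
    rw [hK]
    refine Nat.ceil_lt_add_one ?_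
    have := swapBound_nonneg L T
    positivity
  -- The labels stay those of the starting tree; the invariant says that they also label the current
  -- tree.
  refine (wp_loop_frame (fun B ρ => (∀ m, τ₂.nv numW ≤ m → ρ.na M m = 0) ∧ ∃ T',
    IsAdj (ρ.na tree) T' ∧ IsMWST G w T' ∧
    ((ρ.nv going = 1 ∧ Labeling T' (τ₂.ra wt) (τ₂.nv numW) (τ₂.na label) ∧
      5000 * (n : ℝ) ^ 2 * (swapBound L T' + 1) ≤ B) ∨
      (ρ.nv going = 0 ∧ LocallyOptimal G w L T'))) ?_
    (B := K) ⟨by simpa using fun m _ => g7 m, T, by simpa using g6, hT,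
      .inl ⟨by simp, hlab, hK1⟩⟩).mono ?_
  · rintro B ρ hF ⟨hM', T', ht, hT', hI⟩ hc
    rcases hI with ⟨hg, hlab', hB⟩ | ⟨hg, -⟩
    swap
    · simp [hg] at hc
    have e1 : ρ.nv numW = τ₂.nv numW := hF.nv _ rfl
    have e2 : ρ.na label = τ₂.na label := hF.na _ rfl
    have e3 : ρ.ra wt = τ₂.ra wt := hF.ra _ rfl
    rw [wp_seq]
    refine (wp_round hT' ((hF.nv _ rfl).trans g1) ((hF.nv _ rfl).trans g2)
      (by rw [hF.na _ rfl]; exact g3) (by rw [e3, g5]; exact hwt)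
      (by rw [e1, e2, e3]; exact hlab') ht (by rw [e1]; exact hN)
      (by rw [e1]; exact hM')).mono ?_
    rintro t τ ⟨ht', hMτ, hR⟩
    rw [e1] at hMτ
    rw [wp_setN]
    have hBn : 5000 * n ^ 2 ≤ B := by
      have h1 := swapBound_nonneg L T'
      have h2 : (0 : ℝ) ≤ 5000 * (n : ℝ) ^ 2 := by positivity
      have h3 : (5000 * (n : ℝ) ^ 2) ≤ B := by nlinarith
      exact_mod_cast h3
    rcases hR with ⟨hf, T'', hs, hA, hl''⟩ | ⟨hf, hA, hopt⟩
    · have hdrop := hs.swapBound_add_one_le hT'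
      refine ⟨B - 5000 * n ^ 2, ⟨by simpa using hMτ, T'', by simpa using hA, hs.isMWST hT',
        .inl ⟨by simpa using hf, by rw [← e1, ← e2, ← e3]; exact hl'', ?_⟩⟩, ?_⟩
      · rw [Nat.cast_sub hBn]
        push_cast
        have h2 : (0 : ℝ) ≤ 5000 * (n : ℝ) ^ 2 := by positivity
        nlinarith
      · simp
        omega
    · refine ⟨0, ⟨by simpa using hMτ, T', by simpa using hA, hT', .inr ⟨by simpa using hf, hopt⟩⟩,
        ?_⟩
      simp
      omega
  · rintro t τ ⟨B, ⟨-, T', hA, hT', hI⟩, hc, ht⟩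
    rcases hI with ⟨hg, -⟩ | ⟨hg, hopt⟩
    · simp [hg] at hc
    · refine ⟨?_, T', hA, hT', hopt⟩
      simp at ht ⊢
      have hb1 : t₁ + (t₂ + (2 + t)) ≤ 16 * (L + 1) + 1000 * n ^ 3 + K + 8 := by omega
      have hb2 : ((t₁ + (t₂ + (2 + t)) : ℕ) : ℝ) ≤ 16 * (L + 1) + 1000 * n ^ 3 + K + 8 := by
        exact_mod_cast hb1
      push_cast at hb2
      linarith

end LocalSearch

end Fischer

namespace Fischer

open NVar NArr RVar RArr SimpleGraph

/-! ### The construction of a minimum weight spanning tree -/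

section Prim

variable {n : ℕ} {G : SimpleGraph (Fin n)} {w : Sym2 (Fin n) → ℝ}

/-- Climb from `v` to the root `u`: the step that first enters `S` uses an edge across the boundary.
It lies on the path between `u` and `v`, so it may be exchanged for `uv`. -/
theorem exists_crossing {V : Type} [Fintype V] {T : SimpleGraph V} (hT : T.IsTree) {S : Set V}
    {u v : V} (hu : u ∈ S) (hv : v ∉ S) :
    ∃ x y, T.Adj x y ∧ x ∈ S ∧ y ∉ S ∧ ¬ (T.deleteEdges {s(x, y)}).Reachable u v := by
  classical
  obtain ⟨p, dp, hp, -⟩ := exists_rooted hT u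
  have hex : ∃ k, p^[k] v ∈ S := ⟨dp v, by rwa [hp.iterate_eq_root le_rfl]⟩
  obtain ⟨k, hk⟩ : ∃ k, Nat.find hex = k + 1 :=
    Nat.exists_eq_succ_of_ne_zero fun h => hv (by simpa [h] using Nat.find_spec hex)
  have h1 : p (p^[k] v) ∈ S := by
    have := Nat.find_spec hex
    rwa [hk, Function.iterate_succ_apply'] at this
  have h2 : p^[k] v ∉ S := Nat.find_min hex (by omega)
  have h3 : p^[k] v ≠ u := fun e => h2 (e ▸ hu)
  exact ⟨_, _, hp.adj _ h3, h1, h2, hp.not_reachable h3 rfl⟩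

/-- The edge `uv` of `G` leaves the set `S` of vertices. -/
def Leaves (G : SimpleGraph (Fin n)) (S : Finset (Fin n)) (u v : Fin n) : Prop :=
  u ∈ S ∧ v ∉ S ∧ G.Adj u v

/-- `F` is a tree on the set `S` of vertices which contains the vertex `r` and extends to a minimum
weight spanning tree. -/
structure Partial (G : SimpleGraph (Fin n)) (w : Sym2 (Fin n) → ℝ) (r : Fin n)
    (S : Finset (Fin n)) (F : SimpleGraph (Fin n)) : Prop where
  root_mem : r ∈ S
  mem : ∀ u v, F.Adj u v → u ∈ S ∧ v ∈ S
  reachable : ∀ u ∈ S, F.Reachable r u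
  extends_to : ∃ T, IsMWST G w T ∧ F ≤ T

theorem Partial.start (hG : G.Connected) (r : Fin n) : Partial G w r {r} ⊥ := by
  obtain ⟨T, hT⟩ := exists_isMWST hG w
  exact ⟨by simp, by simp, by simp, T, hT, bot_le⟩

theorem Partial.exists_leaves {r : Fin n} {S : Finset (Fin n)} {F : SimpleGraph (Fin n)}
    (h : Partial G w r S F) (hS : S.card < n) : ∃ u v, Leaves G S u v := by
  obtain ⟨v, hv⟩ : ∃ v, v ∉ S := by
    by_contra! hcon
    have : S = Finset.univ := Finset.eq_univ_of_forall hcon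
    rw [this] at hS
    simp at hS
  obtain ⟨T, hT, -⟩ := h.extends_to
  obtain ⟨x, y, hxy, hx, hy, -⟩ := exists_crossing hT.1.2 (S := (S : Set (Fin n))) h.root_mem hv
  exact ⟨x, y, hx, hy, hT.1.1 hxy⟩

/-- The cut property. An MWST containing `F` has an edge across the boundary of `S` on its path from
`u` to `v`. That edge is not in `F` and weighs at least as much as `uv`, so exchanging it leaves an
MWST containing both `F` and `uv`. -/
theorem Partial.grow {r : Fin n} {S : Finset (Fin n)} {F : SimpleGraph (Fin n)}
    (h : Partial G w r S F) {u v : Fin n} (huv : Leaves G S u v)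
    (hmin : ∀ u' v', Leaves G S u' v' → w s(u, v) ≤ w s(u', v')) :
    Partial G w r (insert v S) (F ⊔ edge u v) := by
  obtain ⟨hu, hv, hadj⟩ := huv
  refine ⟨Finset.mem_insert_of_mem h.root_mem, fun a b hab => ?_, fun a ha => ?_, ?_⟩
  · rw [sup_adj, edge_adj] at hab
    rcases hab with hab | ⟨⟨rfl, rfl⟩ | ⟨rfl, rfl⟩, -⟩
    · exact ⟨Finset.mem_insert_of_mem (h.mem a b hab).1, Finset.mem_insert_of_mem (h.mem a b hab).2⟩
    · exact ⟨Finset.mem_insert_of_mem hu, Finset.mem_insert_self _ _⟩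
    · exact ⟨Finset.mem_insert_self _ _, Finset.mem_insert_of_mem hu⟩
  · rcases Finset.mem_insert.1 ha with rfl | ha
    · refine ((h.reachable u hu).mono le_sup_left).trans (Adj.reachable ?_)
      rw [sup_adj, edge_adj]
      exact .inr ⟨.inl ⟨rfl, rfl⟩, hadj.ne⟩
    · exact (h.reachable a ha).mono le_sup_left
  · obtain ⟨T, hT, hF⟩ := h.extends_to
    obtain ⟨x, y, hxy, hx, hy, hr⟩ := exists_crossing hT.1.2 (S := (S : Set (Fin n))) hu hv
    refine ⟨_, hT.exchange hxy hadj hr (hmin x y ⟨hx, hy, hT.1.1 hxy⟩), ?_⟩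
    refine sup_le (fun a b hab => exchange_adj.2 (.inl ⟨hF hab, fun e => hy ?_⟩)) le_sup_right
    rcases Sym2.eq_iff.1 e with ⟨rfl, rfl⟩ | ⟨rfl, rfl⟩
    · exact (h.mem _ _ hab).2
    · exact (h.mem _ _ hab).1

theorem Partial.isMWST {r : Fin n} {S : Finset (Fin n)} {F : SimpleGraph (Fin n)}
    (h : Partial G w r S F) (hS : S.card = n) : IsMWST G w F := by
  have hS' : S = Finset.univ := Finset.eq_univ_of_card _ (by simpa using hS)
  obtain ⟨T, hT, hF⟩ := h.extends_to
  have hr : ∀ u, F.Reachable r u := fun u => h.reachable u (by simp [hS'])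
  have : Nonempty (Fin n) := ⟨r⟩
  have hcon : F.Connected := ⟨fun a b => (hr a).symm.trans (hr b)⟩
  -- Trees are minimal connected graphs, so a connected spanning subgraph of `T` is `T` itself.
  have := (isTree_iff_minimal_connected.1 hT.1.2).eq_of_le hcon hF
  rwa [this]

/-- The search for a lightest edge leaving `S` has come to the pair `(a, c)`. -/
def Searched (G : SimpleGraph (Fin n)) (w : Sym2 (Fin n) → ℝ) (S : Finset (Fin n)) (a c : ℕ)
    (ρ : State) : Prop :=
  (ρ.nv found = 0 ∧ ∀ u v : Fin n, (u.1 < a ∨ (u.1 = a ∧ v.1 < c)) → ¬ Leaves G S u v) ∨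
  (ρ.nv found ≠ 0 ∧ ∃ u v : Fin n, ρ.nv x = u ∧ ρ.nv y = v ∧ Leaves G S u v ∧
    ρ.rv best = w s(u, v) ∧ ∀ u' v' : Fin n, (u'.1 < a ∨ (u'.1 = a ∧ v'.1 < c)) →
      Leaves G S u' v' → w s(u, v) ≤ w s(u', v'))

theorem Searched.row {S : Finset (Fin n)} {a : ℕ} {ρ : State} (h : Searched G w S a n ρ) :
    Searched G w S (a + 1) 0 ρ := by
  rcases h with ⟨h1, h2⟩ | ⟨h1, u, v, h2, h3, h4, h5, h6⟩
  · exact .inl ⟨h1, fun u v huv => h2 u v (by omega)⟩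
  · exact .inr ⟨h1, u, v, h2, h3, h4, h5, fun u' v' huv => h6 u' v' (by omega)⟩

theorem Searched.skip {S : Finset (Fin n)} {u v : Fin n} {ρ : State}
    (h : Searched G w S u v ρ)
    (hno : ¬ (Leaves G S u v ∧ (ρ.nv found = 0 ∨ w s(u, v) < ρ.rv best))) :
    Searched G w S u (v + 1) ρ := by
  have hcase : ∀ u' v' : Fin n, (u'.1 < u.1 ∨ (u'.1 = u.1 ∧ v'.1 < v.1 + 1)) →
      (u' = u ∧ v' = v) ∨ (u'.1 < u.1 ∨ (u'.1 = u.1 ∧ v'.1 < v.1)) := by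
    intro u' v' h
    simp only [Fin.ext_iff]
    omega
  rcases h with ⟨h1, h2⟩ | ⟨h1, a, c, h2, h3, h4, h5, h6⟩
  · refine .inl ⟨h1, fun u' v' huv => ?_⟩
    rcases hcase u' v' huv with ⟨rfl, rfl⟩ | h'
    · exact fun hl => hno ⟨hl, .inl h1⟩
    · exact h2 u' v' h'
  · refine .inr ⟨h1, a, c, h2, h3, h4, h5, fun u' v' huv hl => ?_⟩
    rcases hcase u' v' huv with ⟨rfl, rfl⟩ | h'
    · rw [← h5]
      exact not_lt.1 fun hlt => hno ⟨hl, .inr hlt⟩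
    · exact h6 u' v' h' hl

theorem Searched.take {S : Finset (Fin n)} {u v : Fin n} {ρ τ : State}
    (h : Searched G w S u v ρ) (hl : Leaves G S u v)
    (hlt : ρ.nv found = 0 ∨ w s(u, v) < ρ.rv best) (h1 : τ.nv found ≠ 0) (h2 : τ.nv x = u)
    (h3 : τ.nv y = v) (h4 : τ.rv best = w s(u, v)) : Searched G w S u (v + 1) τ := by
  refine .inr ⟨h1, u, v, h2, h3, hl, h4, fun u' v' huv hl' => ?_⟩
  by_cases he : u' = u ∧ v' = v
  · rw [he.1, he.2]
  · have h' : u'.1 < u.1 ∨ (u'.1 = u.1 ∧ v'.1 < v.1) := by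
      simp only [Fin.ext_iff] at he
      omega
    rcases h with ⟨-, g⟩ | ⟨g0, a, c, -, -, -, g5, g6⟩
    · exact absurd hl' (g u' v' h')
    · have := g6 u' v' h' hl'
      rcases hlt with hlt | hlt
      · exact absurd hlt g0
      · rw [g5] at hlt
        linarith

theorem isAdj_sup_edge {f : ℕ → ℕ} {F : SimpleGraph (Fin n)} (hf : IsAdj f F) {u v : Fin n}
    (huv : u ≠ v) : IsAdj (Function.update (Function.update f (u * n + v) 1) (v * n + u) 1)
      (F ⊔ edge u v) := by
  intro a b
  simp only [Function.update_apply, cell_inj b.2 (Fin.is_lt _), ← Fin.ext_iff, sup_adj, edge_adj]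
  have h1 := (hf a b).1
  have h2 := (hf a b).2
  constructor
  · intro h
    grind
  · intro h
    grind

theorem wp_growTree (hG : G.Connected) {σ : State} (hsize : σ.nv size = n)
    (hgraph : IsAdj (σ.na graph) G)
    (hwt : ∀ u v : Fin n, G.Adj u v → σ.ra wt (u * n + v) = w s(u, v))
    (htree : IsAdj (σ.na tree) (⊥ : SimpleGraph (Fin n))) (hin : ∀ q, σ.na inTree q = 0) :
    wp growTree (fun t τ => t ≤ 500 * n ^ 3 ∧ ∃ T, IsAdj (τ.na tree) T ∧ IsMWST G w T) σ := by
  have hn1 : 1 ≤ n := Fin.pos_iff_nonempty.2 hG.nonempty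
  have : NeZero n := ⟨by omega⟩
  simp only [growTree, block]
  rw [wp_seq, wp_setA, wp_seq, wp_setN]
  refine (wp_loop_frame (fun B ρ => ∃ S F, Partial G w (0 : Fin n) S F ∧ IsAdj (ρ.na tree) F ∧
    (∀ u : Fin n, ρ.na inTree u = if u ∈ S then 1 else 0) ∧ ρ.nv k = S.card ∧ S.card ≤ n ∧
    B = (n - S.card) * (n * (n * 70 + 40) + 60)) ?_
    ⟨{0}, ⊥, .start hG 0, by simpa using htree, ?_, by simp, by simpa using hn1, rfl⟩).frame.mono ?_
  · rintro B ρ hF ⟨S, F, hP, ht, hS, hk, hcard, rfl⟩ hc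
    have e0 : ρ.nv size = n := (hF.nv _ rfl).trans hsize
    have e1 : ρ.na graph = σ.na graph := hF.na _ rfl
    have e2 : ρ.ra wt = σ.ra wt := hF.ra _ rfl
    simp [hk, e0] at hc
    rw [wp_seq, wp_setN, wp_seq]
    refine (wp_for_frame n (n * 70 + 30) (fun a τ => Searched G w S a 0 τ)
      (by simpa using e0) (by decide) rfl rfl (.inl ⟨by simp, by simp⟩) ?_).frame.mono ?_
    · intro a τ hF' ha haN hI
      have f0 : τ.nv size = n := (hF'.nv _ rfl).trans e0
      refine (wp_for_frame n 60 (fun c τ => Searched G w S a c τ) f0 (by decide) rfl rfl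
        (by simpa [Searched] using hI) ?_).mono ?_
      · intro c υ hF'' hc' hcN hJ
        have g0 : υ.nv size = n := (hF''.nv _ rfl).trans f0
        have g1 : υ.nv i = a := (hF''.nv _ rfl).trans ha
        have g2 : υ.na graph = σ.na graph := (hF''.na _ rfl).trans ((hF'.na _ rfl).trans e1)
        have g3 : υ.ra wt = σ.ra wt := (hF''.ra _ rfl).trans ((hF'.ra _ rfl).trans e2)
        have g4 : υ.na inTree = ρ.na inTree := (hF''.na _ rfl).trans (hF'.na _ rfl)
        have hadj := hgraph.eq_one_iff ⟨a, haN⟩ ⟨c, hcN⟩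
        have hSa := hS ⟨a, haN⟩
        have hSc := hS ⟨c, hcN⟩
        have hw := hwt ⟨a, haN⟩ ⟨c, hcN⟩
        simp only at hadj hSa hSc hw
        have hcond : BExp.holds υ (.and (.and (.eq (.get inTree i) 1) (.eq (.get inTree j) 0))
            (.and (.eq (.get graph (cell i j)) 1)
              (.or (.eq found 0) (.rlt (.get wt (cell i j)) best)))) ↔
            (Leaves G S ⟨a, haN⟩ ⟨c, hcN⟩ ∧
              (υ.nv found = 0 ∨ w s(⟨a, haN⟩, ⟨c, hcN⟩) < υ.rv best)) := by
          simp [g0, g1, g2, g3, g4, hc', hadj, hSa, hSc, Leaves]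
          constructor
          · rintro ⟨⟨h1, h2⟩, h3, h4⟩
            exact ⟨⟨h1, h2, h3⟩, by rwa [← hw h3]⟩
          · rintro ⟨⟨h1, h2, h3⟩, h4⟩
            exact ⟨⟨h1, h2⟩, h3, by rwa [hw h3]⟩
        rw [wp_when, hcond]
        refine ⟨fun h => ?_, fun h => ⟨by simp, ?_⟩⟩
        · simp only [wp_seq, wp_setN, wp_setR]
          refine ⟨by simp, hJ.take h.1 h.2 (by simp) (by simp [g1]) (by simp [hc']) ?_⟩
          simp [g0, g1, g3, hc', hw h.1.2.2]
        · simpa [Searched] using hJ.skip h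
      · rintro t υ ⟨ht', hJ⟩
        exact ⟨by omega, by simpa [Searched] using hJ.row⟩
    · rintro t τ ⟨⟨ht', hJ⟩, hG'⟩
      rcases hJ with ⟨-, hno⟩ | ⟨-, u, v, hx, hy, hl, -, hmin⟩
      · obtain ⟨u, v, huv⟩ := hP.exists_leaves hc
        exact absurd huv (hno u v (.inl u.2))
      · have f0 : τ.nv size = n := (hG'.nv _ rfl).trans e0
        have f1 : τ.na tree = ρ.na tree := hG'.na _ rfl
        have f2 : τ.na inTree = ρ.na inTree := hG'.na _ rfl
        have f3 : τ.nv k = S.card := (hG'.nv _ rfl).trans hk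
        have hcard' : (insert v S).card = S.card + 1 := Finset.card_insert_of_notMem hl.2.1
        simp only [wp_seq, wp_setA, wp_setN]
        refine ⟨_, ⟨insert v S, F ⊔ edge u v, hP.grow hl fun u' v' h => hmin u' v' (.inl u'.2) h,
          ?_, fun z => ?_, ?_, by omega, rfl⟩, ?_⟩
        · simpa [hx, hy, f0, f1] using isAdj_sup_edge ht hl.2.2.ne
        · have hz : Function.update (ρ.na inTree) (v : ℕ) 1 z = if z ∈ insert v S then 1 else 0 := by
            simp only [Function.update_apply, ← Fin.ext_iff, hS]
            by_cases he : z = v <;> simp [he]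
          simpa [hy, f2] using hz
        · simp [f3, hcard']
        · rw [hcard']
          obtain ⟨d, hd⟩ : ∃ d, n = S.card + 1 + d := ⟨n - (S.card + 1), by omega⟩
          have q1 : n - (S.card + 1) = d := by omega
          have q2 : n - S.card = d + 1 := by omega
          rw [q1, q2, Nat.add_mul d 1]
          simp
          ring_nf at ht' ⊢
          omega
  · intro u
    simp only [NExp.eval, State.setN_na, State.setA_na, if_true,
      Function.update_apply, hin, Finset.mem_singleton, Fin.ext_iff, Fin.val_zero]
  · rintro t τ ⟨⟨B, ⟨S, F, hP, ht, hS, hk, hcard, rfl⟩, hc, hB⟩, hF⟩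
    have e0 : τ.nv size = n := (hF.nv _ rfl).trans hsize
    simp [hk, e0] at hc
    refine ⟨?_, F, ht, hP.isMWST (le_antisymm hcard hc)⟩
    have hn2 : n ≤ n * n := Nat.le_mul_self n
    have hn3 : n * n ≤ n * n * n := Nat.le_mul_of_pos_right _ hn1
    have hle : (n - 1) * (n * (n * 70 + 40) + 60) ≤ n * (n * (n * 70 + 40) + 60) :=
      Nat.mul_le_mul_right _ (Nat.sub_le _ _)
    simp at hB ⊢
    ring_nf at *
    omega

end Prim

end Fischer

namespace Fischer

open NVar NArr RVar RArr SimpleGraph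

/-! ### The running time -/

section Main

/-- The least `L` such that `b ^ L` is at least `n`. -/
theorem exists_log {b : ℝ} (hb : 1 < b) {n : ℕ} (hn : 1 ≤ n) :
    ∃ L : ℕ, (n : ℝ) ≤ b ^ L ∧ (∀ m < L, b ^ m < n) ∧ b ^ L ≤ b * n ∧
      (L : ℝ) ≤ (1 + 1 / (b - 1)) * n ∧ ⌈Real.logb b n⌉ = L := by
  classical
  have hex : ∃ m : ℕ, (n : ℝ) ≤ b ^ m := by
    obtain ⟨m, hm⟩ := pow_unbounded_of_one_lt (n : ℝ) hb
    exact ⟨m, hm.le⟩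
  have hn1 : (1 : ℝ) ≤ n := by exact_mod_cast hn
  have hn0 : (0 : ℝ) < n := by linarith
  have hspec := Nat.find_spec hex
  have hmin : ∀ m < Nat.find hex, b ^ m < n := fun m hm => not_le.1 (Nat.find_min hex hm)
  have hpos : 0 < 1 / (b - 1) := one_div_pos.2 (by linarith)
  have hlogn : Real.logb b n ≤ Nat.find hex := by
    rw [Real.logb_le_iff_le_rpow hb hn0, Real.rpow_natCast]
    exact hspec
  refine ⟨Nat.find hex, hspec, hmin, ?_⟩
  generalize Nat.find hex = L at *
  cases L with
  | zero =>
    refine ⟨by rw [pow_zero]; nlinarith, by simp; positivity, ?_⟩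
    have h0 : (n : ℝ) = 1 := le_antisymm (by simpa using hspec) hn1
    simp [h0]
  | succ l =>
    have hl := hmin l (Nat.lt_succ_self l)
    refine ⟨by rw [pow_succ']; nlinarith, ?_, ?_⟩
    -- Bernoulli's inequality makes `L` at most linear in `n`, which is crude but ample for the time
    -- spent on computing the logarithm.
    · have h1 := one_add_mul_sub_le_pow (a := b) (by linarith) l
      have h2 : (l : ℝ) * (b - 1) ≤ n := by linarith
      have h3 : (l : ℝ) ≤ 1 / (b - 1) * n := by
        rw [one_div, inv_mul_eq_div, le_div_iff₀ (by linarith)]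
        exact h2
      push_cast
      linarith
    · rw [Int.ceil_eq_iff]
      refine ⟨?_, by exact_mod_cast hlogn⟩
      push_cast
      rw [add_sub_cancel_right, Real.lt_logb_iff_rpow_lt hb hn0, Real.rpow_natCast]
      exact hl

variable {n : ℕ} {G : SimpleGraph (Fin n)} {w : Sym2 (Fin n) → ℝ} {b : ℝ}

theorem findsWithin_of_wp (hb : 1 < b) {L : ℕ} (hL : (n : ℝ) ≤ b ^ L)
    (hceil : ⌈Real.logb b (n : ℝ)⌉ = L) {s : Stmt} {σ : State} {B : ℝ}
    (h : wp s (fun t τ => (t : ℝ) ≤ B ∧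
      ∃ T, IsAdj (τ.na tree) T ∧ IsMWST G w T ∧ LocallyOptimal G w L T) σ) :
    FindsWithin s σ b G w B := by
  obtain ⟨t, τ, he, ht, T, hA, hT, hopt⟩ := h
  refine ⟨t, τ, T, he, ht, hA, hT, ?_⟩
  obtain ⟨T', hT', hd⟩ := exists_maxDeg_eq_optDeg hT
  rw [hceil, ← hd]
  push_cast
  exact maxDeg_le_of_locallyOptimal hb (by simpa using hL) hT hT' hopt

end Main

end Fischer

theorem mainTheorem2 (b : ℝ) (hb : 1 < b) :
    ∃ C : ℝ, ∀ (n : ℕ) (G : SimpleGraph (Fin n)) (w : Sym2 (Fin n) → ℝ), G.Connected →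
      (∀ T₀ : SimpleGraph (Fin n), Fischer.IsMWST G w T₀ →
        Fischer.FindsWithin Fischer.localSearch (Fischer.input b G w T₀) b G w
          (C * (n : ℝ) ^ (3 + 1 / Real.log b))) ∧
      Fischer.FindsWithin Fischer.algorithm (Fischer.input b G w ⊥) b G w
        (C * (n : ℝ) ^ (3 + 1 / Real.log b)) := by
  obtain ⟨C, hC0, hC⟩ := Fischer.exists_const_swaps b hb
  -- The first term covers the logarithm, and 6520 = 1000 + 5000 + 20 + 500 collects the labels, the
  -- final round, the overhead and the starting tree. The last term covers the rounds with swaps.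
  refine ⟨16 * (2 + 1 / (b - 1)) + 6520 + 5000 * C, fun n G w hG => ?_⟩
  have hn : 1 ≤ n := Fin.pos_iff_nonempty.2 hG.nonempty
  obtain ⟨L, hL, hlt, hLb, hLn, hceil⟩ := Fischer.exists_log hb hn
  have hn1 : (1 : ℝ) ≤ n := by exact_mod_cast hn
  have hlb : 0 < Real.log b := Real.log_pos hb
  have hpos : 0 < 1 / (b - 1) := one_div_pos.2 (by linarith)
  set P : ℝ := (n : ℝ) ^ (3 + 1 / Real.log b) with hP
  have h3 : (n : ℝ) ^ 3 ≤ P := by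
    rw [hP, ← Real.rpow_natCast]
    exact Real.rpow_le_rpow_of_exponent_le hn1 (by
      have : 0 < 1 / Real.log b := one_div_pos.2 hlb
      push_cast; linarith)
  have h23 : (n : ℝ) ^ 2 ≤ (n : ℝ) ^ 3 := pow_le_pow_right₀ hn1 (by norm_num)
  have h13 : (n : ℝ) ≤ (n : ℝ) ^ 3 := by
    simpa using pow_le_pow_right₀ hn1 (by norm_num : 1 ≤ 3)
  -- The cost of growing a starting tree is included, so one estimate serves both claims.
  have time : ∀ T, Fischer.IsMWST G w T →
      16 * ((L : ℝ) + 1) + 1000 * (n : ℝ) ^ 3 +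
        5000 * (n : ℝ) ^ 2 * (Fischer.swapBound L T + 1) + 20 + 500 * (n : ℝ) ^ 3 ≤
      (16 * (2 + 1 / (b - 1)) + 6520 + 5000 * C) * P := by
    intro T hT
    have k1 := Fischer.swapBound_le hT.1.2 L
    rw [Fintype.card_fin] at k1
    have k2 := hC n L hn hLb
    have k3 : Fischer.swapBound L T * (n : ℝ) ^ 2 ≤ C * P :=
      (mul_le_mul_of_nonneg_right k1 (by positivity)).trans k2
    have k4 : (2 + 1 / (b - 1)) * n ≤ (2 + 1 / (b - 1)) * P :=
      mul_le_mul_of_nonneg_left (h13.trans h3) (by linarith)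
    linarith
  have hgraph := Fischer.isAdj_adjArray G
  have hwt : ∀ u v : Fin n, G.Adj u v → Fischer.weightArray G w (u * n + v) = w s(u, v) :=
    fun u v => (Fischer.weightArray_cell G w u v).1
  refine ⟨fun T₀ hT₀ => ?_, ?_⟩
  · refine Fischer.findsWithin_of_wp hb hL hceil ?_
    refine (Fischer.wp_localSearch hT₀ (σ := Fischer.input b G w T₀) rfl rfl hL hlt hgraph hwt
      (Fischer.isAdj_adjArray T₀) fun _ => rfl).mono ?_
    rintro t τ ⟨ht, h⟩
    have hnn : (0 : ℝ) ≤ 500 * (n : ℝ) ^ 3 := by positivity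
    exact ⟨by linarith [time T₀ hT₀], h⟩
  · refine Fischer.findsWithin_of_wp hb hL hceil ?_
    rw [Fischer.algorithm, Fischer.wp_seq]
    refine (Fischer.wp_growTree hG (σ := Fischer.input b G w ⊥) rfl hgraph hwt
      (Fischer.isAdj_adjArray ⊥) fun _ => rfl).frame.mono ?_
    rintro t₁ τ₁ ⟨⟨ht₁, T, hA, hT⟩, hF⟩
    refine (Fischer.wp_localSearch hT (σ := τ₁) (b := b) ((hF.nv _ rfl).trans rfl)
      ((hF.rv _ rfl).trans rfl) hL hlt (by rw [hF.na _ rfl]; exact hgraph)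
      (by rw [hF.ra _ rfl]; exact hwt) hA (by rw [hF.na _ rfl]; exact fun _ => rfl)).mono ?_
    rintro t τ ⟨ht, h⟩
    have ht₁' : (t₁ : ℝ) ≤ 500 * (n : ℝ) ^ 3 := by exact_mod_cast ht₁
    refine ⟨?_, h⟩
    push_cast
    linarith [time T hT]
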